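/- **Systems.** A homogeneous KZ-type system (in $x_0,\dots,x_3$, with $x_4=\infty$) on a finite-dimensional complex vector space $V$ is a family of residues $A_{ij}=A_{ji}\in\mathrm{End}(V)$ $(0\le i,j\le 4)$ with $A_{ii}=0$, $\sum_{j=0}^4A_{ij}=0$ for all $i$, and $[A_{ij},A_{kl}]=0$ whenever $\{i,j\}\cap\{k,l\}=\emptyset$; it encodes $\frac{\partial u}{\partial x_i}=\sum_{\nu\ne i,\,\nu\le3}\frac{A_{i\nu}}{x_i-x_\nu}u$ $(0\le i\le 3)$, normalized by $(x_0,x_1,x_2,x_3,x_4)=(x,y,1,0,\infty)$. A permutation of the five indices acts on such systems. **Middle convolution.** For $\lambda,\tau\in\mathbb C$ let $\tilde A_{ij}\in\mathrm{End}(V^3)$ be the homogeneous KZ-type system determined by $$\tilde A_{01}=\begin{pmatrix}A_{01}-\tau-\lambda&A_{02}&A_{03}+\lambda\\0&0&0\\0&0&0\end{pmatrix},\quad \tilde A_{02}=\begin{pmatrix}0&0&0\\A_{01}&A_{02}-\tau-\lambda&A_{03}+\lambda\\0&0&0\end{pmatrix},\quad \tilde A_{03}=\begin{pmatrix}\tau&0&0\\0&\tau&0\\A_{01}&A_{02}&A_{03}\end{pmatrix},$$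 $$\tilde A_{12}=\begin{pmatrix}A_{12}+A_{02}&-A_{02}&0\\-A_{01}&A_{12}+A_{01}&0\\0&0&A_{12}\end{pmatrix},\quad \tilde A_{13}=\begin{pmatrix}A_{13}+A_{03}+\lambda&0&-A_{03}-\lambda\\0&A_{13}&0\\-A_{01}&0&A_{01}+A_{13}\end{pmatrix},\quad \tilde A_{23}=\begin{pmatrix}A_{23}&0&0\\0&A_{03}+A_{23}+\lambda&-A_{03}-\lambda\\0&-A_{02}&A_{02}+A_{23}\end{pmatrix},$$ and let $K_x(\lambda,\tau)$ be the operation replacing $(A_{ij})$ by the system induced by $(\tilde A_{ij})$ on $V^3/\mathcal L$, where $\mathcal L=\bigl(\ker A_{01}\oplus\ker A_{02}\oplus\ker(A_{03}+\lambda)\bigr)+\ker(\tilde A_{04}+\tau)$ (this subspace is invariant). Let $K_y(\lambda,\tau)$ and $\tilde K_{x,y}(\lambda,\tau)$ be the conjugates of $K_x(\lambda,\tau)$ by the index permutations $(0\,1)$ and $(0\,2)(3\,4)$. **The system of $F_{p,q,r}$.** Let $p,q,r\ge1$, $\alpha,\alpha'\in\mathbb C^p$, $\beta,\beta'\in\mathbb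 C^q$, $\gamma,\gamma'\in\mathbb C^r$. Start from the rank one system of the function $x^{\alpha'_p}(1-x)^{-\alpha_p-\alpha'_p}y^{\beta'_q}(1-y)^{-\beta_q-\beta'_q}$, i.e. $A_{01}=0$, $A_{02}=-\alpha_p-\alpha'_p$, $A_{03}=\alpha'_p$, $A_{12}=-\beta_q-\beta'_q$, $A_{13}=\beta'_q$, $A_{23}=\alpha_p+\beta_q$, and apply successively $\tilde K_{x,y}(\gamma_k,\gamma'_k)$ for $k=1,\dots,r$, then $K_y(\beta_j,\beta'_j)$ for $j=1,\dots,q-1$, then $K_x(\alpha_i,\alpha'_i)$ for $i=1,\dots,p-1$. (For $\alpha'_p=\beta'_q=0$ this is the KZ-type system realizing $F_{p,q,r}(x,y)=\sum_{m,n\ge0}\frac{\prod_i(\alpha_i)_m\prod_j(\beta_j)_n\prod_k(\gamma_k)_{m+n}}{\prod_i(1-\alpha'_i)_m\prod_j(1-\beta'_j)_n\prod_k(1-\gamma'_k)_{m+n}}x^my^n$.) Let $A_{ij}$ denote the residues of the resulting system. **Theorem.** Suppose that the numbers $\alpha_i+\alpha'_{i'}$, $\beta_j+\beta'_{j'}$,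 $\gamma_k+\gamma'_{k'}$, $\alpha_i+\beta_j+\gamma'_k$ and $\alpha'_i+\beta'_j+\gamma_k$ are all nonzero. Then the system has rank $R:=pq+qr+rp$, and with $\alpha''=\sum_i(\alpha_i+\alpha'_i)$, $\beta''=\sum_j(\beta_j+\beta'_j)$, $\gamma''=\sum_k(\gamma_k+\gamma'_k)$, and $i,j,k$ running over $1\le i\le p$, $1\le j\le q$, $1\le k\le r$, the simultaneous eigenvalues of the 15 pairs of commuting residues, counted with algebraic multiplicity (the dimension of the simultaneous generalized eigenspace; $[\lambda:\lambda']_m$ means that the pair $(\lambda,\lambda')$ is listed $m$ times, no index meaning $m=1$, and the multiplicities of coinciding pairs add up), are $$\begin{aligned} [A_{01}:A_{23}]&=\{[0:\alpha_i+\beta_j],[0:\gamma_k]_{p+q-1},[-\alpha''-\beta'':\gamma_k]\},\\ [A_{01}:A_{24}]&=\{[0:\alpha'_i+\beta'_j],[0:\gamma'_k]_{p+q-1},[-\alpha''-\beta'':\gamma'_k]\},\\ [A_{01}:A_{34}]&=\{[0:0]_{R-(p+q+r)+1},[0:-\alpha''-\beta''-\gamma''],[-\alpha''-\beta'':-\alpha''-\beta''-\gamma''],\\&\qquad[0:-\beta''-\gamma'']_{p-1},[0:-\alpha''-\gamma'']_{q-1},[-\alpha''-\beta'':-\alpha''-\beta'']_{r-1}\},\\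 [A_{02}:A_{13}]&=\{[-\alpha''-\gamma'':\beta'_j],[0:\beta'_j]_{p+r-1},[0:\alpha_i+\gamma'_k]\},\\ [A_{02}:A_{14}]&=\{[-\alpha''-\gamma'':\beta_j],[0:\beta_j]_{p+r-1},[0:\alpha'_i+\gamma_k]\},\\ [A_{02}:A_{34}]&=\{[0:0]_{R-(p+q+r)+1},[-\alpha''-\gamma'':-\alpha''-\beta''-\gamma''],[0:-\alpha''-\beta''-\gamma''],\\&\qquad[0:-\beta''-\gamma'']_{p-1},[-\alpha''-\gamma'':-\alpha''-\gamma'']_{q-1},[0:-\alpha''-\beta'']_{r-1}\},\\ [A_{03}:A_{12}]&=\{[\alpha'_i:-\beta''-\gamma''],[\alpha'_i:0]_{q+r-1},[\beta_j+\gamma'_k:0]\},\\ [A_{03}:A_{14}]&=\{[\alpha'_i:\beta_j],[\beta_j+\gamma'_k:\beta_j],[\alpha'_i:\alpha'_i+\gamma_k]\},\\ [A_{03}:A_{24}]&=\{[\alpha'_i:\alpha'_i+\beta'_j],[\alpha'_i:\gamma'_k],[\beta_j+\gamma'_k:\gamma'_k]\},\\ [A_{04}:A_{12}]&=\{[\alpha_i:-\beta''-\gamma''],[\alpha_i:0]_{q+r-1},[\beta'_j+\gamma_k:0]\},\\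 [A_{04}:A_{13}]&=\{[\alpha_i:\beta'_j],[\alpha_i:\alpha_i+\gamma'_k],[\beta'_j+\gamma_k:\beta'_j]\},\\ [A_{04}:A_{23}]&=\{[\alpha_i:\alpha_i+\beta_j],[\alpha_i:\gamma_k],[\beta'_j+\gamma_k:\gamma_k]\},\\ [A_{12}:A_{34}]&=\{[0:0]_{R-(p+q+r)+1},[-\beta''-\gamma'':-\alpha''-\beta''-\gamma''],[0:-\alpha''-\beta''-\gamma''],\\&\qquad[-\beta''-\gamma'':-\beta''-\gamma'']_{p-1},[0:-\alpha''-\gamma'']_{q-1},[0:-\alpha''-\beta'']_{r-1}\},\\ [A_{13}:A_{24}]&=\{[\beta'_j:\alpha'_i+\beta'_j],[\beta'_j:\gamma'_k],[\alpha_i+\gamma'_k:\gamma'_k]\},\\ [A_{14}:A_{23}]&=\{[\beta_j:\alpha_i+\beta_j],[\beta_j:\gamma_k],[\alpha'_i+\gamma_k:\gamma_k]\}. \end{aligned}$$ If moreover the $\alpha_i$ are pairwise distinct, and likewise the $\alpha'_i$, the $\beta_j$, the $\beta'_j$, the $\gamma_k$ and the $\gamma'_k$; if for all $i,j,k$ one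 has $\alpha_i\ne\beta'_j+\gamma_k$, $\alpha'_i\ne\beta_j+\gamma'_k$, $\beta_j\ne\alpha'_i+\gamma_k$, $\beta'_j\ne\alpha_i+\gamma'_k$, $\gamma_k\ne\alpha_i+\beta_j$, $\gamma'_k\ne\alpha'_i+\beta'_j$; and if $\alpha'',\beta'',\gamma'',\alpha''+\beta'',\alpha''+\gamma'',\beta''+\gamma'',\alpha''+\beta''+\gamma''$ are all nonzero, then the same 15 lists hold with the dimensions of the simultaneous eigenspaces $\ker(A_{ij}-\lambda)\cap\ker(A_{kl}-\lambda')$ as multiplicities. -/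

import Mathlib

/-! ### Homogeneous KZ-type systems in the variables `x₀, …, x₃` (and `x₄ = ∞`) -/

/-- A homogeneous KZ-type system `∂u/∂xᵢ = ∑_{ν ≠ i} A_{i,ν}/(xᵢ - x_ν) u` (`0 ≤ i ≤ 3`) on a
finite dimensional complex vector space, given by its residue endomorphisms `A i j`, `0 ≤ i, j ≤ 4`,
where `4` is the index of the point at infinity.

The relation `∑ j, A i j = 0` for `i ≤ 3` is the definition `A_{i,4} = -∑_{ν ≤ 3} A_{i,ν}`; for
`i = 4` it says `-2 ∑_{0 ≤ i < j ≤ 3} A_{i,j} = 0`, which is the homogeneity of the system.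
In the presence of these relations the sum `A_{i,j,k}` of the residues over a triple equals the
residue of the complementary pair, and sums over four indices vanish. Hence the compatibility
condition of the system is the commutation of the residues along disjoint pairs. -/
structure KZSystem where
  V : Type
  [grp : AddCommGroup V]
  [mod : Module ℂ V]
  [fin : FiniteDimensional ℂ V]
  A : Fin 5 → Fin 5 → Module.End ℂ V
  symm : ∀ i j, A i j = A j i
  diag : ∀ i, A i i = 0
  row : ∀ i, ∑ j, A i j = 0
  comm : ∀ i j k l, i ≠ k → i ≠ l → j ≠ k → j ≠ l → Commute (A i j) (A k l)

namespace KZSystem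

attribute [instance] KZSystem.grp KZSystem.mod KZSystem.fin

/-- The full array of residues determined by the six residues `A_{i,j}`, `0 ≤ i < j ≤ 3`. -/
def residues {R : Type} [Ring R] (b01 b02 b03 b12 b13 b23 : R) : Fin 5 → Fin 5 → R :=
  ![![0, b01, b02, b03, -(b01 + b02 + b03)],
    ![b01, 0, b12, b13, -(b01 + b12 + b13)],
    ![b02, b12, 0, b23, -(b02 + b12 + b23)],
    ![b03, b13, b23, 0, -(b03 + b13 + b23)],
    ![-(b01 + b02 + b03), -(b01 + b12 + b13), -(b02 + b12 + b23), -(b03 + b13 + b23), 0]]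

section
variable {R : Type} [Ring R] {b01 b02 b03 b12 b13 b23 : R}

theorem residues_symm (i j : Fin 5) :
    residues b01 b02 b03 b12 b13 b23 i j = residues b01 b02 b03 b12 b13 b23 j i := by
  fin_cases i <;> fin_cases j <;> rfl

theorem residues_diag (i : Fin 5) : residues b01 b02 b03 b12 b13 b23 i i = 0 := by
  fin_cases i <;> rfl

theorem residues_row (h : b01 + b02 + b03 + b12 + b13 + b23 = 0) (i : Fin 5) :
    ∑ j, residues b01 b02 b03 b12 b13 b23 i j = 0 := by
  have h' : b23 = -(b01 + b02 + b03 + b12 + b13) := by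
    rw [eq_neg_iff_add_eq_zero, ← h]; abel
  subst h'
  fin_cases i <;> simp [residues, Fin.sum_univ_five] <;> abel

theorem residues_comm (h : b01 + b02 + b03 + b12 + b13 + b23 = 0)
    (c1 : Commute b01 b23) (c2 : Commute b02 b13) (c3 : Commute b03 b12)
    (d1 : Commute b01 (b02 + b12)) (d2 : Commute b02 (b01 + b12)) (d3 : Commute b12 (b01 + b02))
    (e1 : Commute b01 (b03 + b13)) (e2 : Commute b03 (b01 + b13)) (e3 : Commute b13 (b01 + b03))
    (f1 : Commute b02 (b03 + b23)) (f2 : Commute b03 (b02 + b23)) (f3 : Commute b23 (b02 + b03))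
    (g1 : Commute b12 (b13 + b23)) (g2 : Commute b13 (b12 + b23)) (g3 : Commute b23 (b12 + b13))
    (i j k l : Fin 5) (hik : i ≠ k) (hil : i ≠ l) (hjk : j ≠ k) (hjl : j ≠ l) :
    Commute (residues b01 b02 b03 b12 b13 b23 i j) (residues b01 b02 b03 b12 b13 b23 k l) := by
  have h' : b23 = -(b01 + b02 + b03 + b12 + b13) := by
    rw [eq_neg_iff_add_eq_zero, ← h]; abel
  have key : ∀ a b c : R, Commute a b → c = a + b → Commute a c := by
    rintro a b c hab rfl; exact (Commute.refl a).add_right hab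
  have p01_24 : Commute b01 (-(b02 + b12 + b23)) := key _ _ _ e1 (by rw [h']; abel)
  have p01_34 : Commute b01 (-(b03 + b13 + b23)) := key _ _ _ d1 (by rw [h']; abel)
  have p02_14 : Commute b02 (-(b01 + b12 + b13)) := key _ _ _ f1 (by rw [h']; abel)
  have p02_34 : Commute b02 (-(b03 + b13 + b23)) := key _ _ _ d2 (by rw [h']; abel)
  have p03_14 : Commute b03 (-(b01 + b12 + b13)) := key _ _ _ f2 (by rw [h']; abel)
  have p03_24 : Commute b03 (-(b02 + b12 + b23)) := key _ _ _ e2 (by rw [h']; abel)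
  have p12_04 : Commute b12 (-(b01 + b02 + b03)) := key _ _ _ g1 (by rw [h']; abel)
  have p12_34 : Commute b12 (-(b03 + b13 + b23)) := key _ _ _ d3 (by rw [h']; abel)
  have p13_04 : Commute b13 (-(b01 + b02 + b03)) := key _ _ _ g2 (by rw [h']; abel)
  have p13_24 : Commute b13 (-(b02 + b12 + b23)) := key _ _ _ e3 (by rw [h']; abel)
  have p23_04 : Commute b23 (-(b01 + b02 + b03)) := key _ _ _ g3 (by rw [h']; abel)
  have p23_14 : Commute b23 (-(b01 + b12 + b13)) := key _ _ _ f3 (by rw [h']; abel)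
  have z : ∀ i, residues b01 b02 b03 b12 b13 b23 i i = 0 := residues_diag
  have main : ∀ i j k l : Fin 5, i < j → k < l → i < k → j ≠ k → j ≠ l →
      Commute (residues b01 b02 b03 b12 b13 b23 i j)
        (residues b01 b02 b03 b12 b13 b23 k l) := by
    intro i j k l h1 h2 h3 h4 h5
    fin_cases i <;> fin_cases j <;> first | (exfalso; revert h1; decide) | skip
    all_goals fin_cases k <;> first | (exfalso; revert h3; decide) | (exfalso; revert h4; decide) | skip
    all_goals fin_cases l <;> first | (exfalso; revert h2; decide) | (exfalso; revert h5; decide) | skip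
    all_goals first | assumption | (apply Commute.symm; assumption)
  have main2 : ∀ i j k l : Fin 5, i < j → k < l → i ≠ k → j ≠ k → j ≠ l → i ≠ l →
      Commute (residues b01 b02 b03 b12 b13 b23 i j)
        (residues b01 b02 b03 b12 b13 b23 k l) := by
    intro i j k l h1 h2 h3 h4 h5 h6
    rcases lt_or_gt_of_ne h3 with h | h
    · exact main i j k l h1 h2 h h4 h5
    · exact (main k l i j h2 h1 h h6.symm h5.symm).symm
  have main3 : ∀ i j k l : Fin 5, i < j → i ≠ k → j ≠ k → j ≠ l → i ≠ l →
      Commute (residues b01 b02 b03 b12 b13 b23 i j)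
        (residues b01 b02 b03 b12 b13 b23 k l) := by
    intro i j k l h1 h3 h4 h5 h6
    rcases lt_trichotomy k l with h | h | h
    · exact main2 i j k l h1 h h3 h4 h5 h6
    · subst h; rw [z]; exact Commute.zero_right _
    · rw [residues_symm k l]; exact main2 i j l k h1 h h6 h5 h4 h3
  rcases lt_trichotomy i j with h | h | h
  · exact main3 i j k l h hik hjk hjl hil
  · subst h; rw [z]; exact Commute.zero_left _
  · rw [residues_symm i j]; exact main3 j i k l h hjk hik hil hjl

end

/-- The action of a permutation of the five points on KZ-type systems. -/
def perm (S : KZSystem) (σ : Equiv.Perm (Fin 5)) : KZSystem where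
  V := S.V
  A i j := S.A (σ i) (σ j)
  symm i j := S.symm _ _
  diag i := S.diag _
  row i := by rw [Equiv.sum_comp σ (S.A (σ i))]; exact S.row _
  comm i j k l h1 h2 h3 h4 := S.comm _ _ _ _ (σ.injective.ne h1) (σ.injective.ne h2)
    (σ.injective.ne h3) (σ.injective.ne h4)

/-- The system induced on the quotient by a common invariant subspace. -/
def quotient (S : KZSystem) (L : Submodule ℂ S.V) (hL : ∀ i j, L ≤ L.comap (S.A i j)) :
    KZSystem where
  V := S.V ⧸ L
  A i j := L.mapQ L (S.A i j) (hL i j)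
  symm i j := by simp only [S.symm i j]
  diag i := by
    apply Submodule.linearMap_qext
    ext v
    simp [S.diag i]
  row i := by
    apply Submodule.linearMap_qext
    ext v
    have := congrArg (fun f : Module.End ℂ S.V => L.mkQ (f v)) (S.row i)
    simpa [LinearMap.sum_apply] using this
  comm i j k l h1 h2 h3 h4 := by
    apply Submodule.linearMap_qext
    ext v
    have := congrArg (fun f : Module.End ℂ S.V => L.mkQ (f v)) (S.comm i j k l h1 h2 h3 h4).eq
    simpa using this

/-! ### Convolution and middle convolution -/

/-- The endomorphism of `V³` given by a `3 × 3` block matrix. -/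
abbrev block {V : Type} [AddCommGroup V] [Module ℂ V]
    (M : Matrix (Fin 3) (Fin 3) (Module.End ℂ V)) : Module.End ℂ (Fin 3 → V) :=
  (endVecRingEquivMatrixEnd (Fin 3) ℂ V).symm M


section
variable {R : Type} [Ring R]

theorem commute_of_entries {m00 m01 m02 m10 m11 m12 m20 m21 m22 n00 n01 n02 n10 n11 n12 n20 n21 n22 : R}
    (h00 : m00 * n00 + m01 * n10 + m02 * n20 =
      n00 * m00 + n01 * m10 + n02 * m20)
    (h01 : m00 * n01 + m01 * n11 + m02 * n21 =
      n00 * m01 + n01 * m11 + n02 * m21)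
    (h02 : m00 * n02 + m01 * n12 + m02 * n22 =
      n00 * m02 + n01 * m12 + n02 * m22)
    (h10 : m10 * n00 + m11 * n10 + m12 * n20 =
      n10 * m00 + n11 * m10 + n12 * m20)
    (h11 : m10 * n01 + m11 * n11 + m12 * n21 =
      n10 * m01 + n11 * m11 + n12 * m21)
    (h12 : m10 * n02 + m11 * n12 + m12 * n22 =
      n10 * m02 + n11 * m12 + n12 * m22)
    (h20 : m20 * n00 + m21 * n10 + m22 * n20 =
      n20 * m00 + n21 * m10 + n22 * m20)
    (h21 : m20 * n01 + m21 * n11 + m22 * n21 =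
      n20 * m01 + n21 * m11 + n22 * m21)
    (h22 : m20 * n02 + m21 * n12 + m22 * n22 =
      n20 * m02 + n21 * m12 + n22 * m22) :
    Commute !![m00, m01, m02; m10, m11, m12; m20, m21, m22]
      (!![n00, n01, n02; n10, n11, n12; n20, n21, n22]) := by
  ext i j
  simp only [Matrix.mul_apply, Fin.sum_univ_three]
  fin_cases i <;> fin_cases j <;> assumption

theorem commute_add_of_entries {m00 m01 m02 m10 m11 m12 m20 m21 m22 n00 n01 n02 n10 n11 n12 n20 n21 n22 k00 k01 k02 k10 k11 k12 k20 k21 k22 : R}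
    (h00 : m00 * (n00 + k00) + m01 * (n10 + k10) + m02 * (n20 + k20) =
      (n00 + k00) * m00 + (n01 + k01) * m10 + (n02 + k02) * m20)
    (h01 : m00 * (n01 + k01) + m01 * (n11 + k11) + m02 * (n21 + k21) =
      (n00 + k00) * m01 + (n01 + k01) * m11 + (n02 + k02) * m21)
    (h02 : m00 * (n02 + k02) + m01 * (n12 + k12) + m02 * (n22 + k22) =
      (n00 + k00) * m02 + (n01 + k01) * m12 + (n02 + k02) * m22)
    (h10 : m10 * (n00 + k00) + m11 * (n10 + k10) + m12 * (n20 + k20) =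
      (n10 + k10) * m00 + (n11 + k11) * m10 + (n12 + k12) * m20)
    (h11 : m10 * (n01 + k01) + m11 * (n11 + k11) + m12 * (n21 + k21) =
      (n10 + k10) * m01 + (n11 + k11) * m11 + (n12 + k12) * m21)
    (h12 : m10 * (n02 + k02) + m11 * (n12 + k12) + m12 * (n22 + k22) =
      (n10 + k10) * m02 + (n11 + k11) * m12 + (n12 + k12) * m22)
    (h20 : m20 * (n00 + k00) + m21 * (n10 + k10) + m22 * (n20 + k20) =
      (n20 + k20) * m00 + (n21 + k21) * m10 + (n22 + k22) * m20)
    (h21 : m20 * (n01 + k01) + m21 * (n11 + k11) + m22 * (n21 + k21) =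
      (n20 + k20) * m01 + (n21 + k21) * m11 + (n22 + k22) * m21)
    (h22 : m20 * (n02 + k02) + m21 * (n12 + k12) + m22 * (n22 + k22) =
      (n20 + k20) * m02 + (n21 + k21) * m12 + (n22 + k22) * m22) :
    Commute !![m00, m01, m02; m10, m11, m12; m20, m21, m22]
      (!![n00, n01, n02; n10, n11, n12; n20, n21, n22] + !![k00, k01, k02; k10, k11, k12; k20, k21, k22]) := by
  ext i j
  simp only [Matrix.mul_apply, Fin.sum_univ_three, Matrix.add_apply]
  fin_cases i <;> fin_cases j <;> assumption

end

section
variable {R : Type} [Ring R] [Algebra ℂ R]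

/-- The block matrix `Ã_{0,1}` of the convolution with parameters `lam`, `tau`, in terms of the residues
`a = A₀₁, b = A₀₂, c = A₀₃, d = A₁₂, e = A₁₃, f = A₂₃`. -/
def conv01 (lam tau : ℂ) (a b c : R) : Matrix (Fin 3) (Fin 3) R :=
  !![a - (tau + lam) • 1, b, c + lam • 1;
     0, 0, 0;
     0, 0, 0]

/-- The block matrix `Ã_{0,2}` of the convolution. -/
def conv02 (lam tau : ℂ) (a b c : R) : Matrix (Fin 3) (Fin 3) R :=
  !![0, 0, 0;
     a, b - (tau + lam) • 1, c + lam • 1;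
     0, 0, 0]

/-- The block matrix `Ã_{0,3}` of the convolution. -/
def conv03 (tau : ℂ) (a b c : R) : Matrix (Fin 3) (Fin 3) R :=
  !![tau • 1, 0, 0;
     0, tau • 1, 0;
     a, b, c]

/-- The block matrix `Ã_{1,2}` of the convolution. -/
def conv12 (a b d : R) : Matrix (Fin 3) (Fin 3) R :=
  !![d + b, -b, 0;
     -a, d + a, 0;
     0, 0, d]

/-- The block matrix `Ã_{1,3}` of the convolution. -/
def conv13 (lam : ℂ) (a c e : R) : Matrix (Fin 3) (Fin 3) R :=
  !![e + c + lam • 1, 0, -(c + lam • 1);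
     0, e, 0;
     -a, 0, a + e]

/-- The block matrix `Ã_{2,3}` of the convolution. -/
def conv23 (lam : ℂ) (b c f : R) : Matrix (Fin 3) (Fin 3) R :=
  !![f, 0, 0;
     0, c + f + lam • 1, -(c + lam • 1);
     0, -b, b + f]

theorem conv_row {lam tau : ℂ} {a b c d e f : R} (h : a + b + c + d + e + f = 0) :
    conv01 lam tau a b c + conv02 lam tau a b c + conv03 tau a b c + conv12 a b d
      + conv13 lam a c e + conv23 lam b c f = 0 := by
  have h' : f = -(a + b + c + d + e) := by
    rw [eq_neg_iff_add_eq_zero, ← h]; abel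
  subst h'
  ext i j
  fin_cases i <;> fin_cases j <;> simp [conv01, conv02, conv03, conv12, conv13, conv23] <;> module

set_option maxHeartbeats 2000000 in
theorem conv_comm {lam tau : ℂ} {a b c d e f : R}
    (fa : f * a = a * f) (eb : e * b = b * e) (dc : d * c = c * d)
    (da : d * a = a * d + a * b - b * a) (db : d * b = b * d + b * a - a * b)
    (ea : e * a = a * e + a * c - c * a) (ec : e * c = c * e + c * a - a * c)
    (fb : f * b = b * f + b * c - c * b) (fc : f * c = c * f + c * b - b * c)
    (ed : e * d = d * e + d * f - f * d) (fe : f * e = e * f + e * d - d * e) :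
    let b01 := conv01 lam tau a b c
    let b02 := conv02 lam tau a b c
    let b03 := conv03 tau a b c
    let b12 := conv12 a b d
    let b13 := conv13 lam a c e
    let b23 := conv23 lam b c f
    Commute b01 b23 ∧ Commute b02 b13 ∧ Commute b03 b12 ∧
    Commute b01 (b02 + b12) ∧ Commute b02 (b01 + b12) ∧ Commute b12 (b01 + b02) ∧
    Commute b01 (b03 + b13) ∧ Commute b03 (b01 + b13) ∧ Commute b13 (b01 + b03) ∧
    Commute b02 (b03 + b23) ∧ Commute b03 (b02 + b23) ∧ Commute b23 (b02 + b03) ∧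
    Commute b12 (b13 + b23) ∧ Commute b13 (b12 + b23) ∧ Commute b23 (b12 + b13) := by
  intro b01 b02 b03 b12 b13 b23
  subst b01 b02 b03 b12 b13 b23
  have fe' : f * d = d * f + d * e - e * d := by rw [ed]; abel
  refine ⟨?_, ?_, ?_, ?_, ?_, ?_, ?_, ?_, ?_, ?_, ?_, ?_, ?_, ?_, ?_⟩
  all_goals
    try unfold conv01
    try unfold conv02
    try unfold conv03
    try unfold conv12
    try unfold conv13
    try unfold conv23
    first | apply commute_of_entries | apply commute_add_of_entries
  all_goals
    simp only [mul_zero, zero_mul, add_zero, zero_add, mul_add, add_mul, mul_sub, sub_mul,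
      mul_neg, neg_mul, mul_one, one_mul, smul_mul_assoc, mul_smul_comm, add_smul, smul_add,
      smul_neg, smul_sub, neg_add, neg_sub, smul_smul,
      fa, eb, dc, da, db, ea, ec, fb, fc, fe, fe']
    try module

end

theorem comm_triple (S : KZSystem) (i j l m n : Fin 5) (him : i ≠ m) (hin : i ≠ n) (hjm : j ≠ m)
    (hjn : j ≠ n) (hil : i ≠ l) (hjl : j ≠ l)
    (h : ∑ k, S.A l k = S.A l i + S.A l j + S.A l m + S.A l n) :
    S.A l i * S.A i j + S.A l j * S.A i j = S.A i j * S.A l i + S.A i j * S.A l j := by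
  have h1 : S.A l i + S.A l j = -(S.A l m + S.A l n) := by
    rw [eq_neg_iff_add_eq_zero, ← S.row l, h]; abel
  have h2 : Commute (S.A i j) (S.A l i + S.A l j) := by
    rw [h1]
    exact ((S.comm i j l m hil him hjl hjm).add_right (S.comm i j l n hil hin hjl hjn)).neg_right
  rw [← add_mul, ← mul_add, h2.eq]

/-- The relations among the residues with indices `≤ 3`, in the form used for block matrices. -/
theorem relations (S : KZSystem) :
    let a := S.A 0 1
    let b := S.A 0 2
    let c := S.A 0 3
    let d := S.A 1 2
    let e := S.A 1 3
    let f := S.A 2 3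
    a + b + c + d + e + f = 0 ∧
    f * a = a * f ∧ e * b = b * e ∧ d * c = c * d ∧
    d * a = a * d + a * b - b * a ∧ d * b = b * d + b * a - a * b ∧
    e * a = a * e + a * c - c * a ∧ e * c = c * e + c * a - a * c ∧
    f * b = b * f + b * c - c * b ∧ f * c = c * f + c * b - b * c ∧
    e * d = d * e + d * f - f * d ∧ f * e = e * f + e * d - d * e := by
  intro a b c d e f
  have r : ∀ i, S.A i 0 + S.A i 1 + S.A i 2 + S.A i 3 + S.A i 4 = 0 := by
    intro i; rw [← S.row i, Fin.sum_univ_five]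
  have s10 : S.A 1 0 = a := S.symm 1 0
  have s20 : S.A 2 0 = b := S.symm 2 0
  have s30 : S.A 3 0 = c := S.symm 3 0
  have s21 : S.A 2 1 = d := S.symm 2 1
  have s31 : S.A 3 1 = e := S.symm 3 1
  have s32 : S.A 3 2 = f := S.symm 3 2
  have hsum : a + b + c + d + e + f = 0 := by
    have r0 := r 0
    have r1 := r 1
    have r2 := r 2
    have r3 := r 3
    have r4 := r 4
    rw [S.symm 4 0, S.symm 4 1, S.symm 4 2, S.symm 4 3] at r4
    simp only [S.diag, s10, s20, s30, s21, s31, s32] at r0 r1 r2 r3 r4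
    have h2 : (2 : ℂ) • (a + b + c + d + e + f) = 0 := by
      have t0 : S.A 0 4 = -(a + b + c) := by
        rw [eq_neg_iff_add_eq_zero, ← r0]; abel
      have t1 : S.A 1 4 = -(a + d + e) := by
        rw [eq_neg_iff_add_eq_zero, ← r1]; abel
      have t2 : S.A 2 4 = -(b + d + f) := by
        rw [eq_neg_iff_add_eq_zero, ← r2]; abel
      have t3 : S.A 3 4 = -(c + e + f) := by
        rw [eq_neg_iff_add_eq_zero, ← r3]; abel
      rw [t0, t1, t2, t3, add_zero] at r4
      rw [← neg_eq_zero, ← r4, two_smul]; abel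
    exact (smul_eq_zero.mp h2).resolve_left two_ne_zero
  have T := S.comm_triple
  have k012 := T 0 1 2 3 4 (by decide) (by decide) (by decide) (by decide) (by decide) (by decide)
    (by rw [Fin.sum_univ_five, S.diag]; abel)
  have k021 := T 0 2 1 3 4 (by decide) (by decide) (by decide) (by decide) (by decide) (by decide)
    (by rw [Fin.sum_univ_five, S.diag]; abel)
  have k013 := T 0 1 3 2 4 (by decide) (by decide) (by decide) (by decide) (by decide) (by decide)
    (by rw [Fin.sum_univ_five, S.diag]; abel)
  have k031 := T 0 3 1 2 4 (by decide) (by decide) (by decide) (by decide) (by decide) (by decide)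
    (by rw [Fin.sum_univ_five, S.diag]; abel)
  have k023 := T 0 2 3 1 4 (by decide) (by decide) (by decide) (by decide) (by decide) (by decide)
    (by rw [Fin.sum_univ_five, S.diag]; abel)
  have k032 := T 0 3 2 1 4 (by decide) (by decide) (by decide) (by decide) (by decide) (by decide)
    (by rw [Fin.sum_univ_five, S.diag]; abel)
  have k123 := T 1 2 3 0 4 (by decide) (by decide) (by decide) (by decide) (by decide) (by decide)
    (by rw [Fin.sum_univ_five, S.diag]; abel)
  have k132 := T 1 3 2 0 4 (by decide) (by decide) (by decide) (by decide) (by decide) (by decide)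
    (by rw [Fin.sum_univ_five, S.diag]; abel)
  simp only [s10, s20, s30, s21, s31, s32] at k012 k021 k013 k031 k023 k032 k123 k132
  change b * a + d * a = a * b + a * d at k012
  change a * b + d * b = b * a + b * d at k021
  change c * a + e * a = a * c + a * e at k013
  change a * c + e * c = c * a + c * e at k031
  change c * b + f * b = b * c + b * f at k023
  change b * c + f * c = c * b + c * f at k032
  change e * d + f * d = d * e + d * f at k123
  change d * e + f * e = e * d + e * f at k132
  have fin : ∀ x y z w : Module.End ℂ S.V, x + y = z + w → y = w + z - x := by
    intro x y z w h
    rw [eq_sub_iff_add_eq, add_comm y x, h, add_comm]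
  refine ⟨hsum, (S.comm 2 3 0 1 ?_ ?_ ?_ ?_).eq, (S.comm 1 3 0 2 ?_ ?_ ?_ ?_).eq,
    (S.comm 1 2 0 3 ?_ ?_ ?_ ?_).eq, fin _ _ _ _ k012, fin _ _ _ _ k021, fin _ _ _ _ k013,
    fin _ _ _ _ k031, fin _ _ _ _ k023, fin _ _ _ _ k032, ?_, fin _ _ _ _ k132⟩
  all_goals first | decide | skip
  rw [eq_sub_iff_add_eq, k123]

/-- The convolution: the system satisfied by the vector `K̃_x^{-tau-lam, lam} u`. -/
def conv (lam tau : ℂ) (S : KZSystem) : KZSystem where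
  V := Fin 3 → S.V
  A := residues (block (conv01 lam tau (S.A 0 1) (S.A 0 2) (S.A 0 3)))
    (block (conv02 lam tau (S.A 0 1) (S.A 0 2) (S.A 0 3)))
    (block (conv03 tau (S.A 0 1) (S.A 0 2) (S.A 0 3)))
    (block (conv12 (S.A 0 1) (S.A 0 2) (S.A 1 2)))
    (block (conv13 lam (S.A 0 1) (S.A 0 3) (S.A 1 3)))
    (block (conv23 lam (S.A 0 2) (S.A 0 3) (S.A 2 3)))
  symm := residues_symm
  diag := residues_diag
  row := by
    obtain ⟨h, -⟩ := S.relations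
    apply residues_row
    simp only [block, ← map_add, conv_row h, map_zero]
  comm := by
    obtain ⟨h, fa, eb, dc, da, db, ea, ec, fb, fc, ed, fe⟩ := S.relations
    obtain ⟨h1, h2, h3, h4, h5, h6, h7, h8, h9, h10, h11, h12, h13, h14, h15⟩ :=
      conv_comm (lam := lam) (tau := tau) fa eb dc da db ea ec fb fc ed fe
    have m : ∀ {M N : Matrix (Fin 3) (Fin 3) (Module.End ℂ S.V)}, Commute M N →
        Commute (block M) (block N) := fun h => h.map _
    have m2 : ∀ {M N N' : Matrix (Fin 3) (Fin 3) (Module.End ℂ S.V)}, Commute M (N + N') →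
        Commute (block M) (block N + block N') := fun h => by
      have := h.map (endVecRingEquivMatrixEnd (Fin 3) ℂ S.V).symm
      rwa [map_add] at this
    apply residues_comm
    · simp only [block, ← map_add, conv_row h, map_zero]
    · exact m h1
    · exact m h2
    · exact m h3
    · exact m2 h4
    · exact m2 h5
    · exact m2 h6
    · exact m2 h7
    · exact m2 h8
    · exact m2 h9
    · exact m2 h10
    · exact m2 h11
    · exact m2 h12
    · exact m2 h13
    · exact m2 h14
    · exact m2 h15

/-- The subspace `ker A₀₁ ⊕ ker A₀₂ ⊕ ker (A₀₃ + lam)` of `V³`. -/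
def kerPart (lam : ℂ) (S : KZSystem) : Submodule ℂ (Fin 3 → S.V) :=
  Submodule.pi Set.univ
    ![LinearMap.ker (S.A 0 1), LinearMap.ker (S.A 0 2), LinearMap.ker (S.A 0 3 + lam • 1)]

/-- The subspace `𝓛 = (ker A₀₁ ⊕ ker A₀₂ ⊕ ker (A₀₃ + lam)) + ker (Ã₀₄ + tau)` of `V³`. -/
def mcKer (lam tau : ℂ) (S : KZSystem) : Submodule ℂ (S.conv lam tau).V :=
  S.kerPart lam ⊔ LinearMap.ker ((S.conv lam tau).A 0 4 + tau • 1)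

theorem mem_kerPart {lam : ℂ} {S : KZSystem} {v : Fin 3 → S.V} :
    v ∈ S.kerPart lam ↔
      S.A 0 1 (v 0) = 0 ∧ S.A 0 2 (v 1) = 0 ∧ S.A 0 3 (v 2) + lam • v 2 = 0 := by
  simp [kerPart, Submodule.mem_pi, Fin.forall_fin_succ]

theorem block_apply {V : Type} [AddCommGroup V] [Module ℂ V]
    (M : Matrix (Fin 3) (Fin 3) (Module.End ℂ V)) (v : Fin 3 → V) (i : Fin 3) :
    block M v i = M i 0 (v 0) + M i 1 (v 1) + M i 2 (v 2) := by
  change ∑ j, M i j (v j) = _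
  rw [Fin.sum_univ_three]

theorem invariant_of_six {W : Type} [AddCommGroup W] [Module ℂ W] (L : Submodule ℂ W)
    {b01 b02 b03 b12 b13 b23 : Module.End ℂ W}
    (h01 : ∀ v ∈ L, b01 v ∈ L) (h02 : ∀ v ∈ L, b02 v ∈ L) (h03 : ∀ v ∈ L, b03 v ∈ L)
    (h12 : ∀ v ∈ L, b12 v ∈ L) (h13 : ∀ v ∈ L, b13 v ∈ L) (h23 : ∀ v ∈ L, b23 v ∈ L)
    (i j : Fin 5) : ∀ v ∈ L, residues b01 b02 b03 b12 b13 b23 i j v ∈ L := by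
  intro v hv
  have k : ∀ x y z : Module.End ℂ W, x v ∈ L → y v ∈ L → z v ∈ L → (-(x + y + z)) v ∈ L := by
    intro x y z hx hy hz
    exact L.neg_mem (L.add_mem (L.add_mem hx hy) hz)
  have z : (0 : Module.End ℂ W) v ∈ L := L.zero_mem
  have i01 := h01 v hv
  have i02 := h02 v hv
  have i03 := h03 v hv
  have i12 := h12 v hv
  have i13 := h13 v hv
  have i23 := h23 v hv
  fin_cases i <;> fin_cases j <;> first | assumption | (apply k <;> assumption)

theorem apply_eq_of_mul_eq {V : Type} [AddCommGroup V] [Module ℂ V] {x y z : Module.End ℂ V}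
    (h : x * y = z) (v : V) : x (y v) = z v := by rw [← h]; rfl

theorem kerPart_invariant (lam tau : ℂ) (S : KZSystem) (i j : Fin 5) :
    ∀ v ∈ S.kerPart lam, (S.conv lam tau).A i j v ∈ S.kerPart lam := by
  obtain ⟨h, fa, eb, dc, da, db, ea, ec, fb, fc, ed, fe⟩ := S.relations
  have fa' := apply_eq_of_mul_eq fa
  have eb' := apply_eq_of_mul_eq eb
  have dc' := apply_eq_of_mul_eq dc
  have da' := apply_eq_of_mul_eq da
  have db' := apply_eq_of_mul_eq db
  have ea' := apply_eq_of_mul_eq ea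
  have ec' := apply_eq_of_mul_eq ec
  have fb' := apply_eq_of_mul_eq fb
  have fc' := apply_eq_of_mul_eq fc
  simp only [Module.End.mul_apply, LinearMap.sub_apply, LinearMap.add_apply] at fa' eb' dc' da' db' ea' ec' fb' fc'
  refine invariant_of_six (S.kerPart lam) ?_ ?_ ?_ ?_ ?_ ?_ i j
  all_goals
    intro v hv
    obtain ⟨h0, h1, h2⟩ := mem_kerPart.mp hv
    have h2' : S.A 0 3 (v 2) = -(lam • v 2) := eq_neg_of_add_eq_zero_left h2
    rw [mem_kerPart]
    simp [block_apply, conv01, conv02, conv03, conv12, conv13, conv23, h0, h1, h2']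
  · have q0 := da' (v 0)
    have q1 := db' (v 1)
    have q2 := dc' (v 2)
    simp only [h0, h1, h2', map_zero, map_neg, map_smul] at q0 q1 q2
    refine ⟨?_, ?_, ?_⟩
    · linear_combination (norm := module) -q0
    · linear_combination (norm := module) -q1
    · linear_combination (norm := module) -q2
  · have q0 := ea' (v 0)
    have q1 := eb' (v 1)
    have q2 := ec' (v 2)
    simp only [h0, h1, h2', map_zero, map_neg, map_smul] at q0 q1 q2
    refine ⟨?_, ?_, ?_⟩
    · linear_combination (norm := module) -q0
    · linear_combination (norm := module) -q1
    · linear_combination (norm := module) -q2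
  · have q0 := fa' (v 0)
    have q1 := fb' (v 1)
    have q2 := fc' (v 2)
    simp only [h0, h1, h2', map_zero, map_neg, map_smul] at q0 q1 q2
    refine ⟨?_, ?_, ?_⟩
    · linear_combination (norm := module) -q0
    · linear_combination (norm := module) -q1
    · linear_combination (norm := module) -q2

theorem mem_of_eq_zero {W : Type} [AddCommGroup W] [Module ℂ W] (L : Submodule ℂ W) {w : W}
    (h : w = 0) : w ∈ L := h ▸ L.zero_mem

theorem mem_of_eq_smul {W : Type} [AddCommGroup W] [Module ℂ W] (L : Submodule ℂ W) {v w : W}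
    {t : ℂ} (hv : v ∈ L) (h : w = t • v) : w ∈ L := h ▸ L.smul_mem t hv

theorem mcKer_invariant (lam tau : ℂ) (S : KZSystem) (i j : Fin 5) :
    S.mcKer lam tau ≤ (S.mcKer lam tau).comap ((S.conv lam tau).A i j) := by
  have main : ∀ v ∈ LinearMap.ker ((S.conv lam tau).A 0 4 + tau • 1),
      (S.conv lam tau).A i j v ∈ LinearMap.ker ((S.conv lam tau).A 0 4 + tau • 1) := by
    have hc : ∀ k l : Fin 5, 0 ≠ k → 0 ≠ l → 4 ≠ k → 4 ≠ l →
        ∀ v ∈ LinearMap.ker ((S.conv lam tau).A 0 4 + tau • 1),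
          (S.conv lam tau).A k l v ∈ LinearMap.ker ((S.conv lam tau).A 0 4 + tau • 1) := by
      intro k l h1 h2 h3 h4 v hv
      have hcomm : Commute ((S.conv lam tau).A 0 4 + tau • 1) ((S.conv lam tau).A k l) :=
        ((S.conv lam tau).comm 0 4 k l h1 h2 h3 h4).add_left
          ((Commute.one_left _).smul_left tau)
      have := congrArg (fun g : Module.End ℂ (S.conv lam tau).V => g v) hcomm.eq
      simp only [Module.End.mul_apply] at this
      rw [LinearMap.mem_ker] at hv ⊢
      rw [this, hv, map_zero]
    have hz : ∀ v ∈ LinearMap.ker ((S.conv lam tau).A 0 4 + tau • 1),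
        block (conv01 lam tau (S.A 0 1) (S.A 0 2) (S.A 0 3)) v = 0 ∧
        block (conv02 lam tau (S.A 0 1) (S.A 0 2) (S.A 0 3)) v = 0 ∧
        block (conv03 tau (S.A 0 1) (S.A 0 2) (S.A 0 3)) v = tau • v := by
      intro v hv
      have hv' : -(block (conv01 lam tau (S.A 0 1) (S.A 0 2) (S.A 0 3)) v
          + block (conv02 lam tau (S.A 0 1) (S.A 0 2) (S.A 0 3)) v
          + block (conv03 tau (S.A 0 1) (S.A 0 2) (S.A 0 3)) v) + tau • v = 0 := hv
      have e0 := congrFun hv' 0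
      have e1 := congrFun hv' 1
      have z1 : block (conv01 lam tau (S.A 0 1) (S.A 0 2) (S.A 0 3)) v = 0 := by
        funext k
        fin_cases k
        · simp [block_apply, conv01, conv02, conv03] at e0 ⊢
          linear_combination (norm := module) -e0
        · simp [block_apply, conv01]
        · simp [block_apply, conv01]
      have z2 : block (conv02 lam tau (S.A 0 1) (S.A 0 2) (S.A 0 3)) v = 0 := by
        funext k
        fin_cases k
        · simp [block_apply, conv02]
        · simp [block_apply, conv01, conv02, conv03] at e1 ⊢
          linear_combination (norm := module) -e1
        · simp [block_apply, conv02]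
      refine ⟨z1, z2, ?_⟩
      rw [z1, z2] at hv'
      linear_combination (norm := module) -hv'
    refine invariant_of_six _ ?_ ?_ ?_ ?_ ?_ ?_ i j
    · intro v hv; exact mem_of_eq_zero _ (hz v hv).1
    · intro v hv; exact mem_of_eq_zero _ (hz v hv).2.1
    · intro v hv; exact mem_of_eq_smul _ hv (hz v hv).2.2
    · exact hc 1 2 (by decide) (by decide) (by decide) (by decide)
    · exact hc 1 3 (by decide) (by decide) (by decide) (by decide)
    · exact hc 2 3 (by decide) (by decide) (by decide) (by decide)
  refine sup_le (fun v hv => ?_) (fun v hv => ?_)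
  · exact (le_sup_left : S.kerPart lam ≤ S.mcKer lam tau) (S.kerPart_invariant lam tau i j v hv)
  · exact (le_sup_right : _ ≤ S.mcKer lam tau) (main v hv)

/-- The transformation `K̃_x^{-tau-lam, lam}`: the system induced by the convolution on `V³ / 𝓛`. -/
noncomputable def midConv (lam tau : ℂ) (S : KZSystem) : KZSystem :=
  (S.conv lam tau).quotient (S.mcKer lam tau) (S.mcKer_invariant lam tau)

/-- The transformation `K_x^{-(lam + tau), lam}`, raising the number of parameters `α, α'`. -/
noncomputable def Kx (lam tau : ℂ) (S : KZSystem) : KZSystem := S.midConv lam tau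

/-- The transformation `K_y^{-(lam + tau), lam}`: the conjugate of `Kx` by the coordinate change
`(x, y) ↦ (y, x)`, that is, by the transposition `(0 1)` of the five points. -/
noncomputable def Ky (lam tau : ℂ) (S : KZSystem) : KZSystem :=
  ((S.perm (Equiv.swap 0 1)).midConv lam tau).perm (Equiv.swap 0 1)

/-- The transformation `K̃_{x,y}^{-(lam + tau), lam}`: the conjugate of `Kx` by the involutive
coordinate change `(x, y) ↦ (x, x/y)`, that is, by the permutation `(0 2)(3 4)` of the points. -/
noncomputable def Kxy (lam tau : ℂ) (S : KZSystem) : KZSystem :=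
  ((S.perm (Equiv.swap 0 2 * Equiv.swap 3 4)).midConv lam tau).perm
    (Equiv.swap 0 2 * Equiv.swap 3 4)

/-- The rank one system satisfied by `x^{α'} (1-x)^{-α-α'} y^{β'} (1-y)^{-β-β'}`. -/
def rankOne (α α' β β' : ℂ) : KZSystem where
  V := ℂ
  A := residues 0 (-(α + α') • 1) (α' • 1) (-(β + β') • 1) (β' • 1) ((α + β) • 1)
  symm := residues_symm
  diag := residues_diag
  row := residues_row (by module)
  comm := by
    have e : ∀ (f : Module.End ℂ ℂ) (x : ℂ), f x = x * f 1 := fun f x => by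
      rw [← smul_eq_mul, ← f.map_smul, smul_eq_mul, mul_one]
    have h : ∀ f g : Module.End ℂ ℂ, Commute f g := fun f g => by
      ext
      simp only [Module.End.mul_apply]
      rw [e f (g 1), e g (f 1), mul_comm]
    intros
    exact h _ _

end KZSystem

/-! ### The KZ-type system of `F_{p,q,r}` -/

open KZSystem in
/-- The KZ-type system realizing (for `α'_p = β'_q = 0`) the hypergeometric series
`F_{p,q,r}(α, β, γ; α', β', γ'; x, y)
  = ∑ (α)_m (β)_n (γ)_{m+n} / ((1-α')_m (1-β')_n (1-γ')_{m+n}) x^m y^n`,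
constructed along the integral representation
`F_{p,q,r} = ∏_{i<p} K_x ∏_{j<q} K_y ∏_{k≤r} K̃_{x,y} (1-x)^{-α_p} (1-y)^{-β_q}`.
(In general the function realized is the local solution with exponents `(α'_p, β'_q)` at the
origin of the hypergeometric system with the same parameters.) -/
noncomputable def kzF {p q r : ℕ} (hp : 0 < p) (hq : 0 < q) (α α' : Fin p → ℂ) (β β' : Fin q → ℂ)
    (γ γ' : Fin r → ℂ) : KZSystem :=
  let lastP : Fin p := ⟨p - 1, Nat.sub_lt hp one_pos⟩
  let lastQ : Fin q := ⟨q - 1, Nat.sub_lt hq one_pos⟩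
  let S₀ := rankOne (α lastP) (α' lastP) (β lastQ) (β' lastQ)
  let S₁ := (List.ofFn fun k : Fin r => (γ k, γ' k)).foldl (fun S c => S.Kxy c.1 c.2) S₀
  let S₂ := (List.ofFn fun j : Fin (q - 1) =>
    (β (j.castLE (Nat.sub_le q 1)), β' (j.castLE (Nat.sub_le q 1)))).foldl
      (fun S b => S.Ky b.1 b.2) S₁
  (List.ofFn fun i : Fin (p - 1) =>
    (α (i.castLE (Nat.sub_le p 1)), α' (i.castLE (Nat.sub_le p 1)))).foldl
      (fun S a => S.Kx a.1 a.2) S₂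

/-- `[A : B] = s` with multiplicities the dimensions of the simultaneous eigenspaces. -/
def HasSimultaneousEigenvalues {V : Type} [AddCommGroup V] [Module ℂ V] (A B : Module.End ℂ V)
    (s : Multiset (ℂ × ℂ)) : Prop :=
  ∀ μ ν : ℂ, Module.finrank ℂ ↥(A.eigenspace μ ⊓ B.eigenspace ν) = s.count (μ, ν)

/-- `[A : B] = s` with algebraic multiplicities, i.e. the dimensions of the simultaneous generalized
eigenspaces. -/
def HasSimultaneousGenEigenvalues {V : Type} [AddCommGroup V] [Module ℂ V] (A B : Module.End ℂ V)
    (s : Multiset (ℂ × ℂ)) : Prop :=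
  ∀ μ ν : ℂ, Module.finrank ℂ ↥(A.maxGenEigenspace μ ⊓ B.maxGenEigenspace ν) = s.count (μ, ν)

/-- The table of the 15 pairs of commuting residues: an entry `(i, j, k, l, s)` stands for
`[A_{i,j} : A_{k,l}] = s`. Below `a = α''`, `b = β''`, `c = γ''`. -/
noncomputable def tableF {p q r : ℕ} (α α' : Fin p → ℂ) (β β' : Fin q → ℂ) (γ γ' : Fin r → ℂ) :
    List (Fin 5 × Fin 5 × Fin 5 × Fin 5 × Multiset (ℂ × ℂ)) :=
  let R := p * q + q * r + r * p
  let a := ∑ i, (α i + α' i)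
  let b := ∑ j, (β j + β' j)
  let c := ∑ k, (γ k + γ' k)
  [(0, 1, 2, 3, (∑ i, ∑ j, {(0, α i + β j)}) + (p + q - 1) • (∑ k, {(0, γ k)})
      + (∑ k, {(-a - b, γ k)})),
   (0, 1, 2, 4, (∑ i, ∑ j, {(0, α' i + β' j)}) + (p + q - 1) • (∑ k, {(0, γ' k)})
      + (∑ k, {(-a - b, γ' k)})),
   (0, 1, 3, 4, (R - (p + q + r) + 1) • {(0, 0)} + {(0, -a - b - c)} + {(-a - b, -a - b - c)}
      + (p - 1) • {(0, -b - c)} + (q - 1) • {(0, -a - c)} + (r - 1) • {(-a - b, -a - b)}),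
   (0, 2, 1, 3, (∑ j, {(-a - c, β' j)}) + (p + r - 1) • (∑ j, {(0, β' j)})
      + (∑ i, ∑ k, {(0, α i + γ' k)})),
   (0, 2, 1, 4, (∑ j, {(-a - c, β j)}) + (p + r - 1) • (∑ j, {(0, β j)})
      + (∑ i, ∑ k, {(0, α' i + γ k)})),
   (0, 2, 3, 4, (R - (p + q + r) + 1) • {(0, 0)} + {(-a - c, -a - b - c)} + {(0, -a - b - c)}
      + (p - 1) • {(0, -b - c)} + (q - 1) • {(-a - c, -a - c)} + (r - 1) • {(0, -a - b)}),
   (0, 3, 1, 2, (∑ i, {(α' i, -b - c)}) + (q + r - 1) • (∑ i, {(α' i, 0)})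
      + (∑ j, ∑ k, {(β j + γ' k, 0)})),
   (0, 3, 1, 4, (∑ i, ∑ j, {(α' i, β j)}) + (∑ j, ∑ k, {(β j + γ' k, β j)})
      + (∑ i, ∑ k, {(α' i, α' i + γ k)})),
   (0, 3, 2, 4, (∑ i, ∑ j, {(α' i, α' i + β' j)}) + (∑ i, ∑ k, {(α' i, γ' k)})
      + (∑ j, ∑ k, {(β j + γ' k, γ' k)})),
   (0, 4, 1, 2, (∑ i, {(α i, -b - c)}) + (q + r - 1) • (∑ i, {(α i, 0)})
      + (∑ j, ∑ k, {(β' j + γ k, 0)})),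
   (0, 4, 1, 3, (∑ i, ∑ j, {(α i, β' j)}) + (∑ i, ∑ k, {(α i, α i + γ' k)})
      + (∑ j, ∑ k, {(β' j + γ k, β' j)})),
   (0, 4, 2, 3, (∑ i, ∑ j, {(α i, α i + β j)}) + (∑ i, ∑ k, {(α i, γ k)})
      + (∑ j, ∑ k, {(β' j + γ k, γ k)})),
   (1, 2, 3, 4, (R - (p + q + r) + 1) • {(0, 0)} + {(-b - c, -a - b - c)} + {(0, -a - b - c)}
      + (p - 1) • {(-b - c, -b - c)} + (q - 1) • {(0, -a - c)} + (r - 1) • {(0, -a - b)}),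
   (1, 3, 2, 4, (∑ i, ∑ j, {(β' j, α' i + β' j)}) + (∑ j, ∑ k, {(β' j, γ' k)})
      + (∑ i, ∑ k, {(α i + γ' k, γ' k)})),
   (1, 4, 2, 3, (∑ i, ∑ j, {(β j, α i + β j)}) + (∑ j, ∑ k, {(β j, γ k)})
      + (∑ i, ∑ k, {(α' i + γ k, γ k)}))]

/-- The genericity of the parameters under which no kernel other than `ker A₀₁` and `ker A₀₂`
occurs in the middle convolutions of the construction. -/
structure Nondegenerate {p q r : ℕ} (α α' : Fin p → ℂ) (β β' : Fin q → ℂ) (γ γ' : Fin r → ℂ) :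
    Prop where
  αα' : ∀ i i', α i + α' i' ≠ 0
  ββ' : ∀ j j', β j + β' j' ≠ 0
  γγ' : ∀ k k', γ k + γ' k' ≠ 0
  αβγ' : ∀ i j k, α i + β j + γ' k ≠ 0
  α'β'γ : ∀ i j k, α' i + β' j + γ k ≠ 0

/-- The genericity of the parameters which excludes coincidences of exponents that destroy the
semisimplicity of some residue. -/
structure NoCoincidence {p q r : ℕ} (α α' : Fin p → ℂ) (β β' : Fin q → ℂ) (γ γ' : Fin r → ℂ) :
    Prop where
  α_inj : Function.Injective α
  α'_inj : Function.Injective α'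
  β_inj : Function.Injective β
  β'_inj : Function.Injective β'
  γ_inj : Function.Injective γ
  γ'_inj : Function.Injective γ'
  α_ne : ∀ i j k, α i ≠ β' j + γ k
  α'_ne : ∀ i j k, α' i ≠ β j + γ' k
  β_ne : ∀ i j k, β j ≠ α' i + γ k
  β'_ne : ∀ i j k, β' j ≠ α i + γ' k
  γ_ne : ∀ i j k, γ k ≠ α i + β j
  γ'_ne : ∀ i j k, γ' k ≠ α' i + β' j
  a_ne : (∑ i, (α i + α' i)) ≠ 0
  b_ne : (∑ j, (β j + β' j)) ≠ 0
  c_ne : (∑ k, (γ k + γ' k)) ≠ 0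
  ab_ne : (∑ i, (α i + α' i)) + (∑ j, (β j + β' j)) ≠ 0
  ac_ne : (∑ i, (α i + α' i)) + (∑ k, (γ k + γ' k)) ≠ 0
  bc_ne : (∑ j, (β j + β' j)) + (∑ k, (γ k + γ' k)) ≠ 0
  abc_ne : (∑ i, (α i + α' i)) + (∑ j, (β j + β' j)) + (∑ k, (γ k + γ' k)) ≠ 0

/-!
The proof is an induction along the construction of the system, for a statement that is stable
under middle convolution. Besides the simultaneous eigenvalues of the six pairs made of the
residues `A₀₃`, `A₀₄`, `A₁₃`, `A₁₄`, `A₂₃`, `A₂₄`, it records how the three singular residues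
`A₀₁`, `A₀₂`, `A₁₂` are built: each factors as `V → X → V` through its image, on which it is a
scalar and on which its two commuting partners have known spectra, and the three images interact
only through operators of rank at most one, given by a vector `u` and a covector `φ` on each
image. The vectors add up to zero in `V`, and so do the pulled back covectors. This structure is
called `Frame`.

If `lam + tau ≠ 0`, `-lam` is not an eigenvalue of `A₀₃` and `-tau` is not one of `A₀₄`, the
subspace `𝓛` reduces to `ker A₀₁ ⊕ ker A₀₂`, and the middle convolution lives on `X × Y × V` with
`X = im A₀₁`, `Y = im A₀₂` (`exists_midConv_equiv`, `exists_isModel`). In these coordinates the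
images of the new `A₀₁`, `A₀₂` are again `X` and `Y`, while that of `A₁₂` grows by one dimension
(`presents_legX`, `presents_legY`, `presents_legZ`). Each of the six pairs preserves the graph of
`(s π_X, t π_Y)` over `V`, for some `s, t ∈ {0, 1}`, and acts on it as the old pair does; the
quotient is filtered by `X` and `Y`, where one of the two residues, or their difference, is a
scalar (the lemmas `spec0314_midConv` to `spec1423_midConv`). The eigenvalues of `A₃₄` follow from
a block triangular form. So a frame for the parameters `α, α', β, β', γ, γ'` yields one with `lam`
added to `α` and `tau` to `α'` (`nonempty_frame_midConv`). The permutations `(0 1)` and `(0 2)(3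
4)` permute the roles of the parameters (`Frame.swap`, `Frame.swapSwap`), which covers the other
two operations, and the genericity assumptions say that the eigenvalues to be avoided are avoided
at each step (`nonempty_frame_kzF`).

The nine pairs containing a singular residue `A` are read off from the exact sequence `0 → im A →
V → V / im A → 0`, on which `A` is a scalar and zero, respectively.

Under the stronger assumptions, the lists of the six pairs have no repetitions, so these residues
are diagonalizable, and the singular ones are multiples of projections. For `A₃₄ = A₀₁ + A₀₂ +
A₁₂` each generalized eigenspace is treated separately (`Frame.isDiagonal_A34`): for the
eigenvalue zero all three summands vanish, for `-α'' - β'' - γ''` the residue `A₀₁` has simple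
spectrum, and for the others the images of the three summands have total dimension equal to the
multiplicity, so that they form a direct sum decomposition, on each part of which `A₃₄` is a
scalar.
-/

open Module

/-! ### Generalized eigenspaces in exact sequences -/

section Spectra

variable {U V W : Type} [AddCommGroup U] [Module ℂ U] [AddCommGroup V] [Module ℂ V]
  [AddCommGroup W] [Module ℂ W]

/-- `s` is the multiset of eigenvalues of `A`, counted with algebraic multiplicity. -/
def HasGenEigenvalues (A : End ℂ V) (s : Multiset ℂ) : Prop :=
  ∀ μ : ℂ, finrank ℂ ↥(A.maxGenEigenspace μ) = s.count μ

theorem pow_sub_smul_intertwine {A : End ℂ V} {A' : End ℂ W} {f : V →ₗ[ℂ] W}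
    (hf : ∀ v, f (A v) = A' (f v)) (μ : ℂ) (n : ℕ) (v : V) :
    f (((A - μ • 1) ^ n) v) = ((A' - μ • 1) ^ n) (f v) := by
  induction n generalizing v with
  | zero => simp
  | succ n ih => simp [pow_succ, ih, hf]

theorem map_mem_maxGenEigenspace {A : End ℂ V} {A' : End ℂ W} {f : V →ₗ[ℂ] W}
    (hf : ∀ v, f (A v) = A' (f v)) {μ : ℂ} {v : V} (hv : v ∈ A.maxGenEigenspace μ) :
    f v ∈ A'.maxGenEigenspace μ := by
  rw [End.mem_maxGenEigenspace] at hv ⊢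
  obtain ⟨k, hk⟩ := hv
  exact ⟨k, by rw [← pow_sub_smul_intertwine hf, hk, map_zero]⟩

theorem mem_maxGenEigenspace_of_injective {A : End ℂ V} {A' : End ℂ W} {f : V →ₗ[ℂ] W}
    (hinj : Function.Injective f) (hf : ∀ v, f (A v) = A' (f v)) {μ : ℂ} {v : V} :
    f v ∈ A'.maxGenEigenspace μ ↔ v ∈ A.maxGenEigenspace μ := by
  refine ⟨fun hv => ?_, map_mem_maxGenEigenspace hf⟩
  rw [End.mem_maxGenEigenspace] at hv ⊢
  obtain ⟨k, hk⟩ := hv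
  exact ⟨k, hinj (by rw [pow_sub_smul_intertwine hf, hk, map_zero])⟩

/-- A surjective intertwiner is surjective on generalized eigenspaces, by the Fitting decomposition
of source and target. -/
theorem exists_mem_maxGenEigenspace [FiniteDimensional ℂ V] [FiniteDimensional ℂ W]
    {A : End ℂ V} {A' : End ℂ W} {f : V →ₗ[ℂ] W} (hsurj : Function.Surjective f)
    (hf : ∀ v, f (A v) = A' (f v)) {μ : ℂ} {w : W} (hw : w ∈ A'.maxGenEigenspace μ) :
    ∃ v ∈ A.maxGenEigenspace μ, f v = w := by
  rw [End.mem_maxGenEigenspace] at hw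
  obtain ⟨k, hk⟩ := hw
  obtain ⟨n, h1, h2, hkn⟩ := ((A - μ • 1).eventually_isCompl_ker_pow_range_pow.and
    ((A' - μ • 1).eventually_isCompl_ker_pow_range_pow.and (Filter.eventually_ge_atTop k))).exists
  obtain ⟨x, rfl⟩ := hsurj w
  obtain ⟨e, he, y, hy, rfl⟩ := Submodule.mem_sup.mp (h1.sup_eq_top ▸ Submodule.mem_top (x := x))
  obtain ⟨t, rfl⟩ := hy
  rw [LinearMap.mem_ker] at he
  refine ⟨e, (End.mem_maxGenEigenspace _ _ _).mpr ⟨n, he⟩, ?_⟩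
  have hz : f (((A - μ • 1) ^ n) t) = 0 := by
    refine (Submodule.disjoint_def.mp h2.disjoint) _ ?_ ?_
    · have h3 : ((A' - μ • 1) ^ n) (f (e + ((A - μ • 1) ^ n) t)) = 0 := by
        rw [← pow_sub_mul_pow (A' - μ • 1) hkn, Module.End.mul_apply, hk, map_zero]
      rw [map_add, map_add, ← pow_sub_smul_intertwine hf, he, map_zero, zero_add] at h3
      exact h3
    · rw [pow_sub_smul_intertwine hf]
      exact LinearMap.mem_range_self _ _
  rw [map_add, hz, add_zero]

theorem exists_mem_inf_maxGenEigenspace [FiniteDimensional ℂ V] [FiniteDimensional ℂ W]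
    {A B : End ℂ V} {A' B' : End ℂ W} (hAB : Commute A B) (hAB' : Commute A' B')
    {f : V →ₗ[ℂ] W} (hsurj : Function.Surjective f)
    (hA : ∀ v, f (A v) = A' (f v)) (hB : ∀ v, f (B v) = B' (f v)) {μ ν : ℂ} {w : W}
    (hw : w ∈ A'.maxGenEigenspace μ ⊓ B'.maxGenEigenspace ν) :
    ∃ v ∈ A.maxGenEigenspace μ ⊓ B.maxGenEigenspace ν, f v = w := by
  have h1 := End.mapsTo_maxGenEigenspace_of_comm hAB μ
  have h1' := End.mapsTo_maxGenEigenspace_of_comm hAB' μ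
  have h2 : ∀ v ∈ A.maxGenEigenspace μ, f v ∈ A'.maxGenEigenspace μ :=
    fun v hv => map_mem_maxGenEigenspace hA hv
  have hs : Function.Surjective (f.restrict h2) := by
    rintro ⟨y, hy⟩
    obtain ⟨v, hv, rfl⟩ := exists_mem_maxGenEigenspace hsurj hA hy
    exact ⟨⟨v, hv⟩, rfl⟩
  have hy : (⟨w, hw.1⟩ : A'.maxGenEigenspace μ) ∈ End.maxGenEigenspace (B'.restrict h1') ν :=
    (mem_maxGenEigenspace_of_injective (f := (A'.maxGenEigenspace μ).subtype)
      (Submodule.injective_subtype _) (fun _ => rfl)).mp hw.2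
  obtain ⟨v, hv, hvw⟩ := exists_mem_maxGenEigenspace (A := B.restrict h1) (A' := B'.restrict h1') hs
    (fun v => Subtype.ext (hB v)) hy
  refine ⟨v, ⟨v.2, ?_⟩, congrArg Subtype.val hvw⟩
  exact map_mem_maxGenEigenspace (f := (A.maxGenEigenspace μ).subtype) (fun _ => rfl) hv

/-- Additivity of the dimension of simultaneous generalized eigenspaces in exact sequences. -/
theorem finrank_inf_maxGenEigenspace_of_exact [FiniteDimensional ℂ V] [FiniteDimensional ℂ W]
    {AU BU : End ℂ U} {A B : End ℂ V} {AW BW : End ℂ W} (hAB : Commute A B)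
    {i : U →ₗ[ℂ] V} {f : V →ₗ[ℂ] W} (hi : Function.Injective i) (hf : Function.Surjective f)
    (hex : ∀ v, f v = 0 ↔ ∃ u, i u = v)
    (hiA : ∀ u, i (AU u) = A (i u)) (hiB : ∀ u, i (BU u) = B (i u))
    (hfA : ∀ v, f (A v) = AW (f v)) (hfB : ∀ v, f (B v) = BW (f v)) (μ ν : ℂ) :
    finrank ℂ ↥(A.maxGenEigenspace μ ⊓ B.maxGenEigenspace ν) =
      finrank ℂ ↥(AU.maxGenEigenspace μ ⊓ BU.maxGenEigenspace ν) +
      finrank ℂ ↥(AW.maxGenEigenspace μ ⊓ BW.maxGenEigenspace ν) := by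
  have hABW : Commute AW BW := by
    ext w
    obtain ⟨v, rfl⟩ := hf w
    have := congrArg (fun g : End ℂ V => f (g v)) hAB.eq
    simpa [hfA, hfB] using this
  have hi' : ∀ u ∈ AU.maxGenEigenspace μ ⊓ BU.maxGenEigenspace ν,
      i u ∈ A.maxGenEigenspace μ ⊓ B.maxGenEigenspace ν := fun u hu =>
    ⟨map_mem_maxGenEigenspace hiA hu.1, map_mem_maxGenEigenspace hiB hu.2⟩
  have hf' : ∀ v ∈ A.maxGenEigenspace μ ⊓ B.maxGenEigenspace ν,
      f v ∈ AW.maxGenEigenspace μ ⊓ BW.maxGenEigenspace ν := fun v hv =>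
    ⟨map_mem_maxGenEigenspace hfA hv.1, map_mem_maxGenEigenspace hfB hv.2⟩
  have hrange : LinearMap.range (f.restrict hf') = ⊤ := by
    rw [LinearMap.range_eq_top]
    rintro ⟨w, hw⟩
    obtain ⟨v, hv, rfl⟩ := exists_mem_inf_maxGenEigenspace hAB hABW hf hfA hfB hw
    exact ⟨⟨v, hv⟩, rfl⟩
  have hker : LinearMap.ker (f.restrict hf') = LinearMap.range (i.restrict hi') := by
    ext ⟨v, hv⟩
    simp only [LinearMap.mem_ker, LinearMap.mem_range, Subtype.ext_iff,
      LinearMap.coe_restrict_apply, Submodule.coe_zero]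
    rw [hex]
    constructor
    · rintro ⟨u, rfl⟩
      exact ⟨⟨u, (mem_maxGenEigenspace_of_injective hi hiA).mp hv.1,
        (mem_maxGenEigenspace_of_injective hi hiB).mp hv.2⟩, rfl⟩
    · rintro ⟨u, hu⟩
      exact ⟨u, hu⟩
  have hinj : Function.Injective (i.restrict hi') := fun x y hxy =>
    Subtype.ext (hi (congrArg Subtype.val hxy))
  rw [← LinearMap.finrank_range_add_finrank_ker (f.restrict hf'), hrange, hker, finrank_top,
    LinearMap.finrank_range_of_inj hinj, add_comm]

theorem HasSimultaneousGenEigenvalues.of_exact [FiniteDimensional ℂ V] [FiniteDimensional ℂ W]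
    {AU BU : End ℂ U} {A B : End ℂ V} {AW BW : End ℂ W} {s t : Multiset (ℂ × ℂ)}
    (hU : HasSimultaneousGenEigenvalues AU BU s) (hW : HasSimultaneousGenEigenvalues AW BW t)
    (hAB : Commute A B)
    {i : U →ₗ[ℂ] V} {f : V →ₗ[ℂ] W} (hi : Function.Injective i) (hf : Function.Surjective f)
    (hex : ∀ v, f v = 0 ↔ ∃ u, i u = v)
    (hiA : ∀ u, i (AU u) = A (i u)) (hiB : ∀ u, i (BU u) = B (i u))
    (hfA : ∀ v, f (A v) = AW (f v)) (hfB : ∀ v, f (B v) = BW (f v)) :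
    HasSimultaneousGenEigenvalues A B (s + t) := fun μ ν => by
  rw [finrank_inf_maxGenEigenspace_of_exact hAB hi hf hex hiA hiB hfA hfB, hU, hW,
    Multiset.count_add]

theorem finrank_maxGenEigenspace_of_exact [FiniteDimensional ℂ V] [FiniteDimensional ℂ W]
    {AU : End ℂ U} {A : End ℂ V} {AW : End ℂ W}
    {i : U →ₗ[ℂ] V} {f : V →ₗ[ℂ] W} (hi : Function.Injective i) (hf : Function.Surjective f)
    (hex : ∀ v, f v = 0 ↔ ∃ u, i u = v)
    (hiA : ∀ u, i (AU u) = A (i u)) (hfA : ∀ v, f (A v) = AW (f v)) (μ : ℂ) :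
    finrank ℂ ↥(A.maxGenEigenspace μ) =
      finrank ℂ ↥(AU.maxGenEigenspace μ) + finrank ℂ ↥(AW.maxGenEigenspace μ) := by
  have := finrank_inf_maxGenEigenspace_of_exact (Commute.refl A) hi hf hex hiA hiA hfA hfA μ μ
  rwa [inf_idem, inf_idem, inf_idem] at this

theorem HasGenEigenvalues.of_exact [FiniteDimensional ℂ V] [FiniteDimensional ℂ W]
    {AU : End ℂ U} {A : End ℂ V} {AW : End ℂ W} {s t : Multiset ℂ}
    (hU : HasGenEigenvalues AU s) (hW : HasGenEigenvalues AW t)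
    {i : U →ₗ[ℂ] V} {f : V →ₗ[ℂ] W} (hi : Function.Injective i) (hf : Function.Surjective f)
    (hex : ∀ v, f v = 0 ↔ ∃ u, i u = v)
    (hiA : ∀ u, i (AU u) = A (i u)) (hfA : ∀ v, f (A v) = AW (f v)) :
    HasGenEigenvalues A (s + t) := fun μ => by
  rw [finrank_maxGenEigenspace_of_exact hi hf hex hiA hfA, hU, hW, Multiset.count_add]

/-- A filtration with three steps: the subspace `f = g = 0` is the image of `U`, the map `g` is
only required to be an intertwiner on the kernel of `f`. -/
theorem HasSimultaneousGenEigenvalues.of_filtration {X : Type} [AddCommGroup X] [Module ℂ X]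
    [FiniteDimensional ℂ V] [FiniteDimensional ℂ W] [FiniteDimensional ℂ X]
    {AU BU : End ℂ U} {A B : End ℂ V} {AW BW : End ℂ W} {AX BX : End ℂ X}
    {s t r : Multiset (ℂ × ℂ)}
    (hU : HasSimultaneousGenEigenvalues AU BU s) (hW : HasSimultaneousGenEigenvalues AW BW t)
    (hX : HasSimultaneousGenEigenvalues AX BX r) (hAB : Commute A B)
    {i : U →ₗ[ℂ] V} {g : V →ₗ[ℂ] W} {f : V →ₗ[ℂ] X} (hi : Function.Injective i)
    (hfg : ∀ x w, ∃ v, f v = x ∧ g v = w)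
    (hfi : ∀ u, f (i u) = 0) (hgi : ∀ u, g (i u) = 0)
    (hex : ∀ v, f v = 0 → g v = 0 → ∃ u, i u = v)
    (hiA : ∀ u, i (AU u) = A (i u)) (hiB : ∀ u, i (BU u) = B (i u))
    (hgA : ∀ v, f v = 0 → g (A v) = AW (g v)) (hgB : ∀ v, f v = 0 → g (B v) = BW (g v))
    (hfA : ∀ v, f (A v) = AX (f v)) (hfB : ∀ v, f (B v) = BX (f v)) :
    HasSimultaneousGenEigenvalues A B (s + t + r) := by
  have kA : ∀ v ∈ LinearMap.ker f, A v ∈ LinearMap.ker f := fun v hv => by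
    rw [LinearMap.mem_ker] at hv ⊢; rw [hfA, hv, map_zero]
  have kB : ∀ v ∈ LinearMap.ker f, B v ∈ LinearMap.ker f := fun v hv => by
    rw [LinearMap.mem_ker] at hv ⊢; rw [hfB, hv, map_zero]
  have hK : HasSimultaneousGenEigenvalues (A.restrict kA) (B.restrict kB) (s + t) := by
    refine hU.of_exact hW ?_ (i := i.codRestrict (LinearMap.ker f) hfi)
      (f := g ∘ₗ (LinearMap.ker f).subtype) ?_ ?_ ?_ ?_ ?_ ?_ ?_
    · ext v
      exact congrArg (fun h : End ℂ V => h v) hAB.eq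
    · exact fun x y hxy => hi (congrArg Subtype.val hxy)
    · intro w
      obtain ⟨v, hv, rfl⟩ := hfg 0 w
      exact ⟨⟨v, hv⟩, rfl⟩
    · rintro ⟨v, hv⟩
      constructor
      · intro h
        obtain ⟨u, rfl⟩ := hex v hv h
        exact ⟨u, rfl⟩
      · rintro ⟨u, hu⟩
        rw [← hu]
        exact hgi u
    · exact fun u => Subtype.ext (hiA u)
    · exact fun u => Subtype.ext (hiB u)
    · exact fun v => hgA v v.2
    · exact fun v => hgB v v.2
  refine hK.of_exact hX hAB (i := (LinearMap.ker f).subtype) (Submodule.injective_subtype _)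
    (fun x => ?_) (fun v => ?_) (fun _ => rfl) (fun _ => rfl) hfA hfB
  · obtain ⟨v, hv, -⟩ := hfg x 0
    exact ⟨v, hv⟩
  · simp

theorem HasSimultaneousGenEigenvalues.symm {A B : End ℂ V} {s : Multiset (ℂ × ℂ)}
    (h : HasSimultaneousGenEigenvalues A B s) :
    HasSimultaneousGenEigenvalues B A (s.map Prod.swap) := fun μ ν => by
  rw [inf_comm, h, ← Multiset.count_map_eq_count' _ _ Prod.swap_injective]
  rfl

theorem maxGenEigenspace_add_smul_one (A : End ℂ V) (c μ : ℂ) :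
    (A + c • 1).maxGenEigenspace μ = A.maxGenEigenspace (μ - c) := by
  ext v
  have h : A + c • 1 - μ • 1 = A - (μ - c) • (1 : End ℂ V) := by module
  simp only [End.mem_maxGenEigenspace, h]

theorem maxGenEigenspace_smul_one (c μ : ℂ) :
    (c • (1 : End ℂ V)).maxGenEigenspace μ = if μ = c then ⊤ else ⊥ := by
  split_ifs with h
  · subst h
    exact eq_top_iff.mpr fun v _ => (End.mem_maxGenEigenspace _ _ _).mpr ⟨1, by simp⟩
  · refine eq_bot_iff.mpr fun v hv => ?_
    obtain ⟨k, hk⟩ := (End.mem_maxGenEigenspace _ _ _).mp hv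
    rw [← sub_smul, smul_pow, one_pow, LinearMap.smul_apply, smul_eq_zero] at hk
    exact hk.resolve_left (pow_ne_zero _ (sub_ne_zero.mpr (Ne.symm h)))

theorem HasGenEigenvalues.pair_smul_one_add {A : End ℂ V} {s : Multiset ℂ}
    (h : HasGenEigenvalues A s) (c d : ℂ) :
    HasSimultaneousGenEigenvalues (c • 1) (A + d • 1) (s.map fun z => (c, z + d)) := fun μ ν => by
  rw [maxGenEigenspace_smul_one, maxGenEigenspace_add_smul_one]
  by_cases hc : μ = c
  · subst hc
    have hinj : Function.Injective fun z : ℂ => (μ, z + d) := fun x y hxy => by simpa using hxy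
    rw [if_pos rfl, top_inf_eq, h, ← Multiset.count_map_eq_count' _ _ hinj, sub_add_cancel]
  · rw [if_neg hc, bot_inf_eq, finrank_bot, eq_comm, Multiset.count_eq_zero]
    simp [Ne.symm hc]

theorem HasGenEigenvalues.pair_add_add {A : End ℂ V} {s : Multiset ℂ}
    (h : HasGenEigenvalues A s) (c d : ℂ) :
    HasSimultaneousGenEigenvalues (A + c • 1) (A + d • 1) (s.map fun z => (z + c, z + d)) :=
  fun μ ν => by
  rw [maxGenEigenspace_add_smul_one, maxGenEigenspace_add_smul_one]
  by_cases hμ : μ - c = ν - d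
  · have hinj : Function.Injective fun z : ℂ => (z + c, z + d) := fun x y hxy => by
      simpa using congrArg Prod.fst hxy
    rw [hμ, inf_idem, h, ← Multiset.count_map_eq_count' _ _ hinj, sub_add_cancel, ← hμ,
      sub_add_cancel]
  · rw [(End.disjoint_genEigenspace A hμ _ _).eq_bot, finrank_bot, eq_comm, Multiset.count_eq_zero]
    simp only [Multiset.mem_map, Prod.mk.injEq, not_exists, not_and]
    rintro z - rfl rfl
    exact hμ (by ring)

theorem hasGenEigenvalues_smul_one (c : ℂ) :
    HasGenEigenvalues (c • (1 : End ℂ V)) (Multiset.replicate (finrank ℂ V) c) := fun μ => by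
  rw [maxGenEigenspace_smul_one, Multiset.count_replicate]
  by_cases h : μ = c
  · rw [if_pos h, if_pos h.symm, finrank_top]
  · rw [if_neg h, if_neg (Ne.symm h), finrank_bot]

theorem HasGenEigenvalues.charpoly_roots [FiniteDimensional ℂ V] {A : End ℂ V}
    {s : Multiset ℂ} (h : HasGenEigenvalues A s) : A.charpoly.roots = s := by
  ext μ
  rw [Polynomial.count_roots, ← LinearMap.finrank_maxGenEigenspace_eq, h]

theorem HasGenEigenvalues.finrank_eq [FiniteDimensional ℂ V] {A : End ℂ V}
    {s : Multiset ℂ} (h : HasGenEigenvalues A s) : finrank ℂ V = s.card := by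
  rw [← h.charpoly_roots, ← (IsAlgClosed.splits A.charpoly).natDegree_eq_card_roots,
    LinearMap.charpoly_natDegree]

theorem HasSimultaneousGenEigenvalues.right [FiniteDimensional ℂ V] {A B : End ℂ V}
    {s : Multiset (ℂ × ℂ)} (h : HasSimultaneousGenEigenvalues A B s) (hAB : Commute A B) :
    HasGenEigenvalues B (s.map Prod.snd) := fun ν => by
  have hE : ∀ v ∈ B.maxGenEigenspace ν, A v ∈ B.maxGenEigenspace ν :=
    End.mapsTo_maxGenEigenspace_of_comm hAB.symm ν
  have key : HasGenEigenvalues (V := B.maxGenEigenspace ν) (A.restrict hE)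
      ((s.filter fun z => ν = z.2).map Prod.fst) := fun μ => by
    have h1 : End.maxGenEigenspace (A.restrict hE) μ =
        (A.maxGenEigenspace μ).comap (B.maxGenEigenspace ν).subtype := by
      ext v
      exact (mem_maxGenEigenspace_of_injective (A' := A) (f := (B.maxGenEigenspace ν).subtype)
        (Submodule.injective_subtype _) (fun _ => rfl)).symm
    rw [h1, ← Submodule.finrank_map_subtype_eq, Submodule.map_comap_subtype, inf_comm, h,
      Multiset.count_map, Multiset.filter_filter, Multiset.count_eq_card_filter_eq]
    simp only [Prod.ext_iff]
  rw [key.finrank_eq, Multiset.card_map, Multiset.count_map]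

theorem HasSimultaneousGenEigenvalues.left [FiniteDimensional ℂ V] {A B : End ℂ V}
    {s : Multiset (ℂ × ℂ)} (h : HasSimultaneousGenEigenvalues A B s) (hAB : Commute A B) :
    HasGenEigenvalues A (s.map Prod.fst) := by
  simpa using h.symm.right hAB.symm

theorem HasGenEigenvalues.eq_zero_of_eigenvector [FiniteDimensional ℂ V] {A : End ℂ V}
    {s : Multiset ℂ} (h : HasGenEigenvalues A s) {μ : ℂ} (hμ : μ ∉ s) {v : V}
    (hv : A v = μ • v) : v = 0 := by
  have h1 := h μ
  rw [Multiset.count_eq_zero.mpr hμ, Submodule.finrank_eq_zero] at h1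
  have h2 : v ∈ A.maxGenEigenspace μ :=
    End.eigenspace_le_maxGenEigenspace (End.mem_eigenspace_iff.mpr hv)
  rwa [h1, Submodule.mem_bot] at h2

theorem HasGenEigenvalues.of_add_of_exact [FiniteDimensional ℂ V] [FiniteDimensional ℂ W]
    {AU : End ℂ U} {A : End ℂ V} {AW : End ℂ W} {s t : Multiset ℂ}
    (hU : HasGenEigenvalues AU s) (hV : HasGenEigenvalues A (s + t))
    {i : U →ₗ[ℂ] V} {f : V →ₗ[ℂ] W} (hi : Function.Injective i) (hf : Function.Surjective f)
    (hex : ∀ v, f v = 0 ↔ ∃ u, i u = v)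
    (hiA : ∀ u, i (AU u) = A (i u)) (hfA : ∀ v, f (A v) = AW (f v)) :
    HasGenEigenvalues AW t := fun μ => by
  have h := finrank_maxGenEigenspace_of_exact hi hf hex hiA hfA μ
  rw [hU, hV, Multiset.count_add] at h
  omega

/-- The eigenvalues of a scalar plus an operator of rank one. The value is added once more on both
sides in order to avoid subtraction. -/
theorem hasGenEigenvalues_smul_one_sub_smulRight [FiniteDimensional ℂ V] (κ : ℂ) (φ : V →ₗ[ℂ] ℂ)
    (u : V) : ∃ s : Multiset ℂ, HasGenEigenvalues (κ • 1 - φ.smulRight u) s ∧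
      s + {κ} = Multiset.replicate (finrank ℂ V) κ + {κ - φ u} := by
  by_cases hφ : φ = 0
  · subst hφ
    refine ⟨Multiset.replicate (finrank ℂ V) κ, ?_, by simp⟩
    have h0 : (κ • 1 - (0 : V →ₗ[ℂ] ℂ).smulRight u : End ℂ V) = κ • 1 := by
      ext; simp
    rw [h0]
    exact hasGenEigenvalues_smul_one κ
  · have hsurj : Function.Surjective φ := LinearMap.surjective hφ
    refine ⟨Multiset.replicate (finrank ℂ (LinearMap.ker φ)) κ + {κ - φ u}, ?_, ?_⟩
    · have h1 := hasGenEigenvalues_smul_one (V := ℂ) (κ - φ u)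
      rw [finrank_self, Multiset.replicate_one] at h1
      refine (hasGenEigenvalues_smul_one (V := LinearMap.ker φ) κ).of_exact h1
        (i := (LinearMap.ker φ).subtype) (f := φ) (Submodule.injective_subtype _) hsurj ?_ ?_ ?_
      · intro v; simp
      · rintro ⟨v, hv⟩
        rw [LinearMap.mem_ker] at hv
        simp [hv]
      · intro v
        simp
        ring
    · have h2 := LinearMap.finrank_range_add_finrank_ker φ
      rw [LinearMap.range_eq_top.mpr hsurj, finrank_top, finrank_self] at h2
      rw [← h2, Multiset.replicate_add, Multiset.replicate_one]
      abel

/-! ### Semisimplicity -/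

theorem le_eigenspace_of_finrank_le_one [FiniteDimensional ℂ V] {A : End ℂ V} {μ : ℂ}
    {p : Submodule ℂ V} (hp : p ≤ A.maxGenEigenspace μ) (hA : ∀ v ∈ p, A v ∈ p)
    (h1 : finrank ℂ p ≤ 1) : p ≤ A.eigenspace μ := by
  intro v hv
  by_cases hv0 : v = 0
  · rw [hv0]; exact zero_mem _
  obtain ⟨w, hw⟩ := finrank_le_one_iff.mp h1
  obtain ⟨c, hc⟩ := hw ⟨v, hv⟩
  have hc0 : c ≠ 0 := by
    rintro rfl
    exact hv0 (by simpa using (congrArg Subtype.val hc).symm)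
  obtain ⟨d, hd⟩ := hw ⟨A v, hA v hv⟩
  have hAv : A v = (d / c) • v := by
    have e1 : c • (w : V) = v := congrArg Subtype.val hc
    have e2 : d • (w : V) = A v := congrArg Subtype.val hd
    rw [← e2, ← e1, smul_smul, div_mul_cancel₀ _ hc0]
  have hmem : v ∈ A.maxGenEigenspace (d / c) :=
    End.eigenspace_le_maxGenEigenspace (End.mem_eigenspace_iff.mpr hAv)
  by_cases hμ : d / c = μ
  · exact End.mem_eigenspace_iff.mpr (hμ ▸ hAv)
  · exact absurd ((Submodule.disjoint_def.mp (End.disjoint_genEigenspace A hμ _ _)) v hmem (hp hv))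
      hv0

/-- A generalized eigenspace of `M` is an eigenspace if a commuting operator splits it into
lines. -/
theorem maxGenEigenspace_eq_eigenspace_of_finrank_inf_le_one [FiniteDimensional ℂ V]
    {A M : End ℂ V} (hAM : Commute A M) {ν : ℂ}
    (h : ∀ μ, finrank ℂ ↥(A.maxGenEigenspace μ ⊓ M.maxGenEigenspace ν) ≤ 1) :
    M.maxGenEigenspace ν = M.eigenspace ν := by
  refine le_antisymm ?_ End.eigenspace_le_maxGenEigenspace
  have hE : ∀ v ∈ M.maxGenEigenspace ν, A v ∈ M.maxGenEigenspace ν :=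
    End.mapsTo_maxGenEigenspace_of_comm hAM.symm ν
  rw [Submodule.eq_iSup_inf_genEigenspace ⊤ hE A.iSup_maxGenEigenspace_eq_top]
  refine iSup_le fun μ => le_eigenspace_of_finrank_le_one inf_le_left (fun v hv => ?_) ?_
  · exact ⟨End.mapsTo_maxGenEigenspace_of_comm (Commute.refl M) ν hv.1,
      End.mapsTo_maxGenEigenspace_of_comm hAM μ hv.2⟩
  · rw [inf_comm]
    exact h μ

/-- The generalized eigenspaces of `A` are eigenspaces. -/
def IsDiagonal (A : End ℂ V) : Prop := ∀ μ, A.maxGenEigenspace μ = A.eigenspace μ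

theorem HasSimultaneousGenEigenvalues.toEigenvalues {A B : End ℂ V} {s : Multiset (ℂ × ℂ)}
    (h : HasSimultaneousGenEigenvalues A B s) (hA : IsDiagonal A) (hB : IsDiagonal B) :
    HasSimultaneousEigenvalues A B s := fun μ ν => by
  rw [← hA, ← hB, h]

theorem HasSimultaneousGenEigenvalues.isDiagonal_right [FiniteDimensional ℂ V] {A B : End ℂ V}
    {s : Multiset (ℂ × ℂ)} (h : HasSimultaneousGenEigenvalues A B s) (hAB : Commute A B)
    (hs : s.Nodup) : IsDiagonal B := fun ν =>
  maxGenEigenspace_eq_eigenspace_of_finrank_inf_le_one hAB fun μ => by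
    rw [h]; exact Multiset.nodup_iff_count_le_one.mp hs _

theorem HasSimultaneousGenEigenvalues.isDiagonal_left [FiniteDimensional ℂ V] {A B : End ℂ V}
    {s : Multiset (ℂ × ℂ)} (h : HasSimultaneousGenEigenvalues A B s) (hAB : Commute A B)
    (hs : s.Nodup) : IsDiagonal A :=
  h.symm.isDiagonal_right hAB.symm (hs.map Prod.swap_injective)

theorem isDiagonal_of_apply_apply {A : End ℂ V} {κ : ℂ} (hκ : κ ≠ 0)
    (hA : ∀ v, A (A v) = κ • A v) : IsDiagonal A := fun μ => by
  refine le_antisymm (fun v hv => ?_) End.eigenspace_le_maxGenEigenspace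
  have hinv := End.mapsTo_maxGenEigenspace_of_comm (Commute.refl A) μ
  have hdis : ∀ c, c ≠ μ → ∀ w ∈ A.maxGenEigenspace μ, A w = c • w → w = 0 := fun c hc w hw h =>
    Submodule.disjoint_def.mp (End.disjoint_genEigenspace A hc ⊤ ⊤) w
      (End.eigenspace_le_maxGenEigenspace (End.mem_eigenspace_iff.mpr h)) hw
  rw [End.mem_eigenspace_iff]
  by_cases h0 : μ = 0
  · subst h0
    rw [zero_smul]
    exact hdis κ hκ _ (hinv hv) (hA v)
  · have hu : A v - κ • v = 0 := by
      refine hdis 0 (Ne.symm h0) _ (sub_mem (hinv hv) (Submodule.smul_mem _ _ hv)) ?_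
      rw [map_sub, map_smul, hA, sub_self, zero_smul]
    rw [sub_eq_zero] at hu
    by_cases hk : κ = μ
    · rw [hu, hk]
    · rw [hdis κ hk v hv hu, map_zero, smul_zero]

/-- On a generalized eigenspace on which the sum `M` of three multiples of projections is invertible
and equal in dimension to the sum of the ranks, the images of the three projections form a direct
sum decomposition, and `M` acts on each image as the projection does. -/
theorem maxGenEigenspace_eq_eigenspace_of_finrank_sum_le [FiniteDimensional ℂ V]
    {A₁ A₂ A₃ M : End ℂ V} (hM : M = A₁ + A₂ + A₃) {κ₁ κ₂ κ₃ ν : ℂ} (hν : ν ≠ 0)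
    (h₁ : ∀ v, A₁ (A₁ v) = κ₁ • A₁ v) (h₂ : ∀ v, A₂ (A₂ v) = κ₂ • A₂ v)
    (h₃ : ∀ v, A₃ (A₃ v) = κ₃ • A₃ v)
    (c₁ : Commute A₁ M) (c₂ : Commute A₂ M) (c₃ : Commute A₃ M)
    (hdim : finrank ℂ ↥(A₁.eigenspace κ₁ ⊓ M.maxGenEigenspace ν) +
      finrank ℂ ↥(A₂.eigenspace κ₂ ⊓ M.maxGenEigenspace ν) +
      finrank ℂ ↥(A₃.eigenspace κ₃ ⊓ M.maxGenEigenspace ν) ≤ finrank ℂ ↥(M.maxGenEigenspace ν)) :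
    M.maxGenEigenspace ν = M.eigenspace ν := by
  refine le_antisymm ?_ End.eigenspace_le_maxGenEigenspace
  set E := M.maxGenEigenspace ν with hE
  set E₁ := A₁.eigenspace κ₁ ⊓ E with hE₁
  set E₂ := A₂.eigenspace κ₂ ⊓ E with hE₂
  set E₃ := A₃.eigenspace κ₃ ⊓ E with hE₃
  have m₁ : ∀ v ∈ E, A₁ v ∈ E₁ := fun v hv => ⟨End.mem_eigenspace_iff.mpr (h₁ v),
    End.mapsTo_maxGenEigenspace_of_comm c₁.symm ν hv⟩
  have m₂ : ∀ v ∈ E, A₂ v ∈ E₂ := fun v hv => ⟨End.mem_eigenspace_iff.mpr (h₂ v),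
    End.mapsTo_maxGenEigenspace_of_comm c₂.symm ν hv⟩
  have m₃ : ∀ v ∈ E, A₃ v ∈ E₃ := fun v hv => ⟨End.mem_eigenspace_iff.mpr (h₃ v),
    End.mapsTo_maxGenEigenspace_of_comm c₃.symm ν hv⟩
  have mM : ∀ v ∈ E, M v ∈ E := End.mapsTo_maxGenEigenspace_of_comm (Commute.refl M) ν
  have n₁ : ∀ v ∈ E₁, M v ∈ E₁ := fun v hv =>
    ⟨End.mapsTo_genEigenspace_of_comm c₁ κ₁ 1 hv.1, mM v hv.2⟩
  have n₂ : ∀ v ∈ E₂, M v ∈ E₂ := fun v hv =>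
    ⟨End.mapsTo_genEigenspace_of_comm c₂ κ₂ 1 hv.1, mM v hv.2⟩
  have n₃ : ∀ v ∈ E₃, M v ∈ E₃ := fun v hv =>
    ⟨End.mapsTo_genEigenspace_of_comm c₃ κ₃ 1 hv.1, mM v hv.2⟩
  let F : (E₁ × E₂ × E₃) →ₗ[ℂ] V := E₁.subtype.coprod (E₂.subtype.coprod E₃.subtype)
  have hF : ∀ x y z, F (x, y, z) = (x : V) + (y + z) := fun x y z => rfl
  have hrange : E ≤ LinearMap.range F := by
    have hinj : Function.Injective (M.restrict mM) := by
      rw [← LinearMap.ker_eq_bot, LinearMap.ker_eq_bot']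
      rintro ⟨v, hv⟩ h0
      have h0' : M v = (0 : ℂ) • v := by rw [zero_smul]; exact congrArg Subtype.val h0
      refine Subtype.ext (Submodule.disjoint_def.mp (End.disjoint_genEigenspace M hν ⊤ ⊤) v hv
        (End.eigenspace_le_maxGenEigenspace (End.mem_eigenspace_iff.mpr h0')))
    intro v hv
    obtain ⟨⟨t, ht⟩, htv⟩ := LinearMap.surjective_of_injective hinj ⟨v, hv⟩
    have htv' : M t = v := congrArg Subtype.val htv
    refine ⟨(⟨_, m₁ t ht⟩, ⟨_, m₂ t ht⟩, ⟨_, m₃ t ht⟩), ?_⟩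
    rw [hF, ← htv', hM, ← add_assoc]
    rfl
  have hinj : Function.Injective F := by
    rw [← LinearMap.ker_eq_bot, ← Submodule.finrank_eq_zero]
    have e1 := LinearMap.finrank_range_add_finrank_ker F
    have e2 := Submodule.finrank_mono hrange
    rw [finrank_prod, finrank_prod] at e1
    omega
  have hz : ∀ x ∈ E₁, ∀ y ∈ E₂, ∀ z ∈ E₃, x + (y + z) = 0 → x = 0 ∧ y = 0 ∧ z = 0 := by
    intro x hx y hy z hz h
    have := hinj (a₁ := (⟨x, hx⟩, ⟨y, hy⟩, ⟨z, hz⟩)) (a₂ := 0) (by rw [hF, map_zero]; exact h)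
    simpa [Prod.ext_iff, Subtype.ext_iff] using this
  have fin : ∀ (κ : ℂ) (v : V), v ∈ E → κ • v - M v = 0 → v ∈ M.eigenspace ν := by
    intro κ v hv h
    rw [sub_eq_zero] at h
    by_cases hκ : κ = ν
    · exact End.mem_eigenspace_iff.mpr (hκ ▸ h.symm)
    · rw [Submodule.disjoint_def.mp (End.disjoint_genEigenspace M hκ ⊤ ⊤) v
        (End.eigenspace_le_maxGenEigenspace (End.mem_eigenspace_iff.mpr h.symm)) hv]
      exact zero_mem _
  have l₁ : ∀ v ∈ E₁, v ∈ M.eigenspace ν := fun v hv => by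
    refine fin κ₁ v hv.2 (hz _ (sub_mem (Submodule.smul_mem _ _ hv) (n₁ v hv)) _ (m₂ v hv.2) _
      (m₃ v hv.2) ?_).1
    rw [hM, ← End.mem_eigenspace_iff.mp hv.1]
    simp only [LinearMap.add_apply]
    abel
  have l₂ : ∀ v ∈ E₂, v ∈ M.eigenspace ν := fun v hv => by
    refine fin κ₂ v hv.2 (hz _ (m₁ v hv.2) _ (sub_mem (Submodule.smul_mem _ _ hv) (n₂ v hv)) _
      (m₃ v hv.2) ?_).2.1
    rw [hM, ← End.mem_eigenspace_iff.mp hv.1]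
    simp only [LinearMap.add_apply]
    abel
  have l₃ : ∀ v ∈ E₃, v ∈ M.eigenspace ν := fun v hv => by
    refine fin κ₃ v hv.2 (hz _ (m₁ v hv.2) _ (m₂ v hv.2) _
      (sub_mem (Submodule.smul_mem _ _ hv) (n₃ v hv)) ?_).2.2
    rw [hM, ← End.mem_eigenspace_iff.mp hv.1]
    simp only [LinearMap.add_apply]
    abel
  intro v hv
  obtain ⟨⟨x, y, z⟩, rfl⟩ := hrange hv
  rw [hF]
  exact add_mem (l₁ x x.2) (add_mem (l₂ y y.2) (l₃ z z.2))

end Spectra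

/-! ### Multisets of values on a product -/

namespace Multiset

/-- The multiset of the values `f a b`, where `a` runs through `s` and `b` through `t`. -/
def crossMap {ι κ σ : Type} (f : ι → κ → σ) (s : Multiset ι) (t : Multiset κ) : Multiset σ :=
  s.bind fun a => t.map (f a)

variable {ι κ σ : Type} (f : ι → κ → σ)

theorem crossMap_swap (s : Multiset ι) (t : Multiset κ) :
    crossMap f s t = crossMap (fun b a => f a b) t s :=
  bind_map_comm s t

@[simp]
theorem crossMap_cons_left (a : ι) (s : Multiset ι) (t : Multiset κ) :
    crossMap f (a ::ₘ s) t = t.map (f a) + crossMap f s t :=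
  cons_bind _ _ _

@[simp]
theorem crossMap_zero_left (t : Multiset κ) : crossMap f 0 t = 0 := zero_bind _

theorem map_crossMap {τ : Type} (g : σ → τ) (s : Multiset ι) (t : Multiset κ) :
    (crossMap f s t).map g = crossMap (fun a b => g (f a b)) s t := by
  simp [crossMap, map_bind]

theorem card_crossMap (s : Multiset ι) (t : Multiset κ) :
    card (crossMap f s t) = card s * card t := by
  simp [crossMap, card_bind]

theorem mem_crossMap {s : Multiset ι} {t : Multiset κ} {x : σ} :
    x ∈ crossMap f s t ↔ ∃ a ∈ s, ∃ b ∈ t, f a b = x := by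
  simp [crossMap]

end Multiset

section

open Multiset

/-! ### Frames -/

/-- A factorization `V → X → V` of an endomorphism of `V`, together with a vector and a covector of
`X`, and with two endomorphisms of `X`. -/
structure Leg (V : Type) [AddCommGroup V] [Module ℂ V] where
  X : Type
  [grp : AddCommGroup X]
  [mod : Module ℂ X]
  [fin : FiniteDimensional ℂ X]
  π : V →ₗ[ℂ] X
  ι : X →ₗ[ℂ] V
  u : X
  φ : X →ₗ[ℂ] ℂ
  B : End ℂ X
  B' : End ℂ X

attribute [instance] Leg.grp Leg.mod Leg.fin

namespace Leg

variable {V : Type} [AddCommGroup V] [Module ℂ V]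

/-- The leg `L` presents the image of the residue `A`, on which `A` is the scalar `-κ`, and the
restrictions to this image of two residues `C`, `C'` commuting with `A`, which have the eigenvalues
`s` and `s'`. -/
structure Presents (L : Leg V) (A C C' : End ℂ V) (κ c : ℂ) (s s' : Multiset ℂ) : Prop where
  fac : ∀ v, A v = L.ι (L.π v)
  inj : Function.Injective L.ι
  surj : Function.Surjective L.π
  π_ι : ∀ x, L.π (L.ι x) = (-κ) • x
  φ_u : L.φ L.u = c
  ι_B : ∀ x, L.ι (L.B x) = C (L.ι x)
  ι_B' : ∀ x, L.ι (L.B' x) = C' (L.ι x)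
  specB : HasGenEigenvalues L.B s
  specB' : HasGenEigenvalues L.B' s'

/-- The composition `M.X → V → L.X` is the operator of rank at most one given by the distinguished
covector of `M` and the distinguished vector of `L`. -/
def Cross (L M : Leg V) : Prop := ∀ y, L.π (M.ι y) = M.φ y • L.u

/-- At least one of the distinguished vectors and one of the distinguished covectors is nonzero. -/
def Nonzero (L M : Leg V) : Prop := (L.u ≠ 0 ∨ M.u ≠ 0) ∧ (L.φ ≠ 0 ∨ M.φ ≠ 0)

/-- The leg with the roles of `B` and `B'` exchanged. -/
def flip (L : Leg V) : Leg V := { L with B := L.B', B' := L.B }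

theorem Presents.flip {L : Leg V} {A C C' : End ℂ V} {κ c : ℂ} {s s' : Multiset ℂ}
    (h : L.Presents A C C' κ c s s') : L.flip.Presents A C' C κ c s' s :=
  ⟨h.fac, h.inj, h.surj, h.π_ι, h.φ_u, h.ι_B', h.ι_B, h.specB', h.specB⟩

theorem Presents.π_comm {L : Leg V} {A C C' : End ℂ V} {κ c : ℂ} {s s' : Multiset ℂ}
    (h : L.Presents A C C' κ c s s') (hc : Commute A C) (v : V) : L.π (C v) = L.B (L.π v) := by
  apply h.inj
  rw [← h.fac, h.ι_B, ← h.fac]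
  exact congrArg (fun f : End ℂ V => f v) hc.eq

theorem Presents.card_eq {L : Leg V} {A C C' : End ℂ V} {κ c : ℂ} {s s' : Multiset ℂ}
    (h : L.Presents A C C' κ c s s') : finrank ℂ L.X = s.card := h.specB.finrank_eq

theorem Presents.card_eq' {L : Leg V} {A C C' : End ℂ V} {κ c : ℂ} {s s' : Multiset ℂ}
    (h : L.Presents A C C' κ c s s') : finrank ℂ L.X = s'.card := h.specB'.finrank_eq

end Leg

/-- The structure of the system of `F_{p,q,r}` that is preserved by the middle convolutions. The
three singular residues `A₀₁`, `A₀₂`, `A₁₂` are scalars on their images `X`, `Y`, `Z`, which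
interact through operators of rank one: the map from one image to another is the covector of the
source times the vector of the target. The six pairs not involving `A₀₁`, `A₀₂`, `A₁₂`, `A₃₄` have
the listed simultaneous eigenvalues, and those of `A₃₄` are described by `s34_eq`, in which the
terms that would have to be subtracted are moved to the other side. The fields `nzXY`, `nzXZ`,
`nzYZ` make the image of `A₁₂` grow by exactly one dimension in a middle convolution. -/
structure Frame {V : Type} [AddCommGroup V] [Module ℂ V] (A : Fin 5 → Fin 5 → End ℂ V)
    (α α' β β' γ γ' : Multiset ℂ) where
  X : Leg V
  Y : Leg V
  Z : Leg V
  isX : X.Presents (A 0 1) (A 2 3) (A 2 4) ((α.sum + α'.sum) + (β.sum + β'.sum))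
    (γ.sum + γ'.sum) γ γ'
  isY : Y.Presents (A 0 2) (A 1 3) (A 1 4) ((α.sum + α'.sum) + (γ.sum + γ'.sum))
    (β.sum + β'.sum) β' β
  isZ : Z.Presents (A 1 2) (A 0 3) (A 0 4) ((β.sum + β'.sum) + (γ.sum + γ'.sum))
    (α.sum + α'.sum) α' α
  crossXY : X.Cross Y
  crossYX : Y.Cross X
  crossXZ : X.Cross Z
  crossZX : Z.Cross X
  crossYZ : Y.Cross Z
  crossZY : Z.Cross Y
  sum_u : X.ι X.u + Y.ι Y.u + Z.ι Z.u = 0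
  sum_φ : ∀ v, X.φ (X.π v) + Y.φ (Y.π v) + Z.φ (Z.π v) = 0
  nzXY : X.Nonzero Y
  nzXZ : X.Nonzero Z
  nzYZ : Y.Nonzero Z
  spec0314 : HasSimultaneousGenEigenvalues (A 0 3) (A 1 4)
    (crossMap (fun i j => (i, j)) α' β + crossMap (fun j k => (j + k, j)) β γ' +
      crossMap (fun i k => (i, i + k)) α' γ)
  spec0324 : HasSimultaneousGenEigenvalues (A 0 3) (A 2 4)
    (crossMap (fun i j => (i, i + j)) α' β' + crossMap (fun i k => (i, k)) α' γ' +
      crossMap (fun j k => (j + k, k)) β γ')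
  spec0413 : HasSimultaneousGenEigenvalues (A 0 4) (A 1 3)
    (crossMap (fun i j => (i, j)) α β' + crossMap (fun i k => (i, i + k)) α γ' +
      crossMap (fun j k => (j + k, j)) β' γ)
  spec0423 : HasSimultaneousGenEigenvalues (A 0 4) (A 2 3)
    (crossMap (fun i j => (i, i + j)) α β + crossMap (fun i k => (i, k)) α γ +
      crossMap (fun j k => (j + k, k)) β' γ)
  spec1324 : HasSimultaneousGenEigenvalues (A 1 3) (A 2 4)
    (crossMap (fun i j => (j, i + j)) α' β' + crossMap (fun j k => (j, k)) β' γ' +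
      crossMap (fun i k => (i + k, k)) α γ')
  spec1423 : HasSimultaneousGenEigenvalues (A 1 4) (A 2 3)
    (crossMap (fun i j => (j, i + j)) α β + crossMap (fun j k => (j, k)) β γ +
      crossMap (fun i k => (i + k, k)) α' γ)
  s34 : Multiset ℂ
  spec34 : HasGenEigenvalues (A 3 4) s34
  s34_eq : s34 + replicate (card α + card β + card γ) 0 +
      {-((β.sum + β'.sum) + (γ.sum + γ'.sum))} + {-((α.sum + α'.sum) + (γ.sum + γ'.sum))} +
      {-((α.sum + α'.sum) + (β.sum + β'.sum))} =
    replicate 2 (-((α.sum + α'.sum) + (β.sum + β'.sum) + (γ.sum + γ'.sum))) +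
      replicate (card α) (-((β.sum + β'.sum) + (γ.sum + γ'.sum))) +
      replicate (card β) (-((α.sum + α'.sum) + (γ.sum + γ'.sum))) +
      replicate (card γ) (-((α.sum + α'.sum) + (β.sum + β'.sum))) +
      replicate (card α * card β + card β * card γ + card γ * card α + 1) 0

namespace Frame

variable {V : Type} [AddCommGroup V] [Module ℂ V] {A : Fin 5 → Fin 5 → End ℂ V}
    {α α' β β' γ γ' : Multiset ℂ}

theorem _root_.Leg.Nonzero.symm {L M : Leg V} (h : L.Nonzero M) : M.Nonzero L :=
  ⟨h.1.symm, h.2.symm⟩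

theorem _root_.HasSimultaneousGenEigenvalues.symm_of_eq {A B : End ℂ V} {s t : Multiset (ℂ × ℂ)}
    (h : HasSimultaneousGenEigenvalues A B s) (hst : s.map Prod.swap = t) :
    HasSimultaneousGenEigenvalues B A t := hst ▸ h.symm

/-- The transposition `(0 1)` exchanges the roles of `α` and `β`. -/
def swap (F : Frame A α α' β β' γ γ') (hA : ∀ i j, A i j = A j i) :
    Frame (fun i j => A (Equiv.swap 0 1 i) (Equiv.swap 0 1 j)) β β' α α' γ γ' where
  X := F.X
  Y := F.Z
  Z := F.Y
  isX := by
    rw [add_comm (β.sum + β'.sum)]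
    show F.X.Presents (A 1 0) (A 2 3) (A 2 4) _ _ _ _
    rw [hA 1 0]
    exact F.isX
  isY := F.isZ
  isZ := F.isY
  crossXY := F.crossXZ
  crossYX := F.crossZX
  crossXZ := F.crossXY
  crossZX := F.crossYX
  crossYZ := F.crossZY
  crossZY := F.crossYZ
  sum_u := by rw [← F.sum_u]; abel
  sum_φ v := by rw [← F.sum_φ v]; ring
  nzXY := F.nzXZ
  nzXZ := F.nzXY
  nzYZ := F.nzYZ.symm
  spec0314 := F.spec0413.symm_of_eq (by
    simp only [Multiset.map_add, map_crossMap, Prod.swap_prod_mk]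
    rw [crossMap_swap _ α β'])
  spec0324 := by
    refine (show HasSimultaneousGenEigenvalues (A 1 3) (A 2 4) _ from ?_)
    convert F.spec1324 using 1
    rw [crossMap_swap _ β' α']
    simp only [add_comm]
  spec0413 := F.spec0314.symm_of_eq (by
    simp only [Multiset.map_add, map_crossMap, Prod.swap_prod_mk]
    rw [crossMap_swap _ α' β])
  spec0423 := by
    refine (show HasSimultaneousGenEigenvalues (A 1 4) (A 2 3) _ from ?_)
    convert F.spec1423 using 1
    rw [crossMap_swap _ β α]
    simp only [add_comm]
  spec1324 := by
    refine (show HasSimultaneousGenEigenvalues (A 0 3) (A 2 4) _ from ?_)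
    convert F.spec0324 using 1
    rw [crossMap_swap _ β' α']
    simp only [add_comm]
  spec1423 := by
    refine (show HasSimultaneousGenEigenvalues (A 0 4) (A 2 3) _ from ?_)
    convert F.spec0423 using 1
    rw [crossMap_swap _ β α]
    simp only [add_comm]
  s34 := F.s34
  spec34 := F.spec34
  s34_eq := by
    have h := F.s34_eq
    have e1 : card β + card α + card γ = card α + card β + card γ := by ring
    have e2 : card β * card α + card α * card γ + card γ * card β + 1 =
      card α * card β + card β * card γ + card γ * card α + 1 := by ring
    rw [e1, e2, add_comm (β.sum + β'.sum) (α.sum + α'.sum)]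
    refine Eq.trans ?_ (h.trans ?_) <;> abel

theorem _root_.Leg.Cross.flip {L M : Leg V} (h : L.Cross M) : L.flip.Cross M.flip := h

/-- The permutation `(0 2)(3 4)` exchanges the roles of `α` and `γ`, and those of `β` and `β'`. -/
def swapSwap (F : Frame A α α' β β' γ γ') (hA : ∀ i j, A i j = A j i) :
    Frame (fun i j => A ((Equiv.swap 0 2 * Equiv.swap 3 4 : Equiv.Perm (Fin 5)) i)
      ((Equiv.swap 0 2 * Equiv.swap 3 4 : Equiv.Perm (Fin 5)) j)) γ γ' β' β α α' where
  X := F.Z.flip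
  Y := F.Y.flip
  Z := F.X.flip
  isX := by
    show F.Z.flip.Presents (A 2 1) (A 0 4) (A 0 3) _ _ _ _
    rw [hA 2 1, add_comm β'.sum, add_comm (γ.sum + γ'.sum)]
    exact F.isZ.flip
  isY := by
    show F.Y.flip.Presents (A 2 0) (A 1 4) (A 1 3) _ _ _ _
    rw [hA 2 0, add_comm β'.sum, add_comm (γ.sum + γ'.sum)]
    exact F.isY.flip
  isZ := by
    show F.X.flip.Presents (A 1 0) (A 2 4) (A 2 3) _ _ _ _
    rw [hA 1 0, add_comm β'.sum, add_comm (β.sum + β'.sum)]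
    exact F.isX.flip
  crossXY := F.crossZY
  crossYX := F.crossYZ
  crossXZ := F.crossZX
  crossZX := F.crossXZ
  crossYZ := F.crossYX
  crossZY := F.crossXY
  sum_u := by
    show F.Z.ι F.Z.u + F.Y.ι F.Y.u + F.X.ι F.X.u = 0
    rw [← F.sum_u]; abel
  sum_φ v := by
    show F.Z.φ (F.Z.π v) + F.Y.φ (F.Y.π v) + F.X.φ (F.X.π v) = 0
    rw [← F.sum_φ v]; ring
  nzXY := F.nzYZ.symm
  nzXZ := F.nzXZ.symm
  nzYZ := F.nzXY.symm
  spec0314 := by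
    refine (show HasSimultaneousGenEigenvalues (A 2 4) (A 1 3) _ from F.spec1324.symm_of_eq ?_)
    simp only [Multiset.map_add, map_crossMap, Prod.swap_prod_mk]
    rw [crossMap_swap _ β' γ', crossMap_swap _ α' β', crossMap_swap _ α γ']
    simp only [add_comm, add_left_comm]
  spec0324 := by
    refine (show HasSimultaneousGenEigenvalues (A 2 4) (A 0 3) _ from F.spec0324.symm_of_eq ?_)
    simp only [Multiset.map_add, map_crossMap, Prod.swap_prod_mk]
    rw [crossMap_swap _ α' β', crossMap_swap _ α' γ', crossMap_swap _ β γ']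
    simp only [add_comm, add_left_comm, add_assoc]
  spec0413 := by
    refine (show HasSimultaneousGenEigenvalues (A 2 3) (A 1 4) _ from F.spec1423.symm_of_eq ?_)
    simp only [Multiset.map_add, map_crossMap, Prod.swap_prod_mk]
    rw [crossMap_swap _ β γ, crossMap_swap _ α' γ, crossMap_swap _ α β]
    simp only [add_comm, add_left_comm, add_assoc]
  spec0423 := by
    refine (show HasSimultaneousGenEigenvalues (A 2 3) (A 0 4) _ from F.spec0423.symm_of_eq ?_)
    simp only [Multiset.map_add, map_crossMap, Prod.swap_prod_mk]
    rw [crossMap_swap _ β' γ, crossMap_swap _ α γ, crossMap_swap _ α β]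
    simp only [add_comm, add_left_comm, add_assoc]
  spec1324 := by
    refine (show HasSimultaneousGenEigenvalues (A 1 4) (A 0 3) _ from F.spec0314.symm_of_eq ?_)
    simp only [Multiset.map_add, map_crossMap, Prod.swap_prod_mk]
    rw [crossMap_swap _ β γ', crossMap_swap _ α' β, crossMap_swap _ α' γ]
    simp only [add_comm, add_assoc]
  spec1423 := by
    refine (show HasSimultaneousGenEigenvalues (A 1 3) (A 0 4) _ from F.spec0413.symm_of_eq ?_)
    simp only [Multiset.map_add, map_crossMap, Prod.swap_prod_mk]
    rw [crossMap_swap _ β' γ, crossMap_swap _ α β', crossMap_swap _ α γ']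
    simp only [add_comm, add_left_comm, add_assoc]
  s34 := F.s34
  spec34 := by
    show HasGenEigenvalues (A 4 3) _
    rw [hA 4 3]
    exact F.spec34
  s34_eq := by
    have h := F.s34_eq
    have e1 : card γ + card β' + card α = card α + card β + card γ := by
      rw [← F.isY.card_eq, F.isY.card_eq']; ring
    have e2 : card γ * card β' + card β' * card α + card α * card γ + 1 =
        card α * card β + card β * card γ + card γ * card α + 1 := by
      rw [← F.isY.card_eq, F.isY.card_eq']; ring
    have e3 : card β' = card β := by rw [← F.isY.card_eq, F.isY.card_eq']
    have e4 : γ.sum + γ'.sum + (β'.sum + β.sum) = β.sum + β'.sum + (γ.sum + γ'.sum) := by ring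
    have e5 : γ.sum + γ'.sum + (α.sum + α'.sum) = α.sum + α'.sum + (γ.sum + γ'.sum) := by ring
    have e6 : β'.sum + β.sum + (α.sum + α'.sum) = α.sum + α'.sum + (β.sum + β'.sum) := by ring
    have e7 : β.sum + β'.sum + (γ.sum + γ'.sum) + (α.sum + α'.sum) =
      α.sum + α'.sum + (β.sum + β'.sum) + (γ.sum + γ'.sum) := by ring
    rw [e1, e2, e3, e4, e5, e6, e7]
    refine Eq.trans ?_ (h.trans ?_) <;> abel

end Frame

end

/-! ### Middle convolution of a frame -/

namespace KZSystem

variable (S : KZSystem)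

theorem A04_eq : S.A 0 4 = -(S.A 0 1 + S.A 0 2 + S.A 0 3) := by
  have h := S.row 0
  rw [Fin.sum_univ_five, S.diag, zero_add] at h
  exact eq_neg_of_add_eq_zero_right h

theorem A14_eq : S.A 1 4 = S.A 0 2 + S.A 0 3 + S.A 2 3 := by
  have h := S.row 1
  rw [Fin.sum_univ_five, S.diag, add_zero, S.symm 1 0] at h
  rw [eq_neg_of_add_eq_zero_right h, neg_eq_iff_add_eq_zero, ← S.relations.1]
  abel

theorem A24_eq : S.A 2 4 = S.A 0 1 + S.A 0 3 + S.A 1 3 := by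
  have h := S.row 2
  rw [Fin.sum_univ_five, S.diag, add_zero, S.symm 2 0, S.symm 2 1] at h
  rw [eq_neg_of_add_eq_zero_right h, neg_eq_iff_add_eq_zero, ← S.relations.1]
  abel

theorem A34_eq : S.A 3 4 = S.A 0 1 + S.A 0 2 + S.A 1 2 := by
  have h := S.row 3
  rw [Fin.sum_univ_five, S.diag, add_zero, S.symm 3 0, S.symm 3 1, S.symm 3 2] at h
  rw [eq_neg_of_add_eq_zero_right h, neg_eq_iff_add_eq_zero, ← S.relations.1]
  abel

variable {S} {lam tau : ℂ}

/-- For `lam + tau ≠ 0` the kernel of `Ã₀₄ + tau` is the diagonal copy of `ker (A₀₄ + tau)`,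
so it does not contribute if `-tau` is no eigenvalue of `A₀₄`. -/
theorem mcKer_eq_kerPart (hμ : lam + tau ≠ 0) (h04 : ∀ v, S.A 0 4 v = (-tau) • v → v = 0) :
    S.mcKer lam tau = S.kerPart lam := by
  have h : LinearMap.ker ((S.conv lam tau).A 0 4 + tau • 1) = ⊥ := by
    rw [LinearMap.ker_eq_bot']
    intro (v : Fin 3 → S.V) hv
    have hv' : -(block (conv01 lam tau (S.A 0 1) (S.A 0 2) (S.A 0 3)) v
        + block (conv02 lam tau (S.A 0 1) (S.A 0 2) (S.A 0 3)) v
        + block (conv03 tau (S.A 0 1) (S.A 0 2) (S.A 0 3)) v) + tau • v = 0 := hv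
    have e0 := congrFun hv' 0
    have e1 := congrFun hv' 1
    have e2 := congrFun hv' 2
    simp [block_apply, conv01, conv02, conv03] at e0 e1 e2
    have h02 : v 0 = v 2 := by
      refine smul_right_injective S.V hμ ?_
      show (lam + tau) • v 0 = (lam + tau) • v 2
      linear_combination (norm := module) e0 - e2
    have h12 : v 1 = v 2 := by
      refine smul_right_injective S.V hμ ?_
      show (lam + tau) • v 1 = (lam + tau) • v 2
      linear_combination (norm := module) e1 - e2
    have h2 : v 2 = 0 := by
      apply h04
      rw [S.A04_eq]
      rw [h02, h12] at e2
      simp only [LinearMap.neg_apply, LinearMap.add_apply]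
      linear_combination (norm := module) e2
    funext k
    fin_cases k
    · exact h02.trans h2
    · exact h12.trans h2
    · exact h2
  rw [mcKer, h]
  exact sup_bot_eq _

variable {α α' β β' γ γ' : Multiset ℂ}

/-- If `-lam` is no eigenvalue of `A₀₃` and `-tau` none of `A₀₄`, the middle convolution lives on
`im A₀₁ × im A₀₂ × V`. -/
theorem exists_midConv_equiv (F : Frame S.A α α' β β' γ γ')
    (hμ : lam + tau ≠ 0) (h03 : ∀ v, S.A 0 3 v = (-lam) • v → v = 0)
    (h04 : ∀ v, S.A 0 4 v = (-tau) • v → v = 0) :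
    ∃ e : (F.X.X × F.Y.X × S.V) ≃ₗ[ℂ] (S.midConv lam tau).V,
      ∀ i j (v w : Fin 3 → S.V), (S.conv lam tau).A i j v = w →
        (S.midConv lam tau).A i j (e (F.X.π (v 0), F.Y.π (v 1), v 2)) =
          e (F.X.π (w 0), F.Y.π (w 1), w 2) := by
  let P : (S.conv lam tau).V →ₗ[ℂ] (F.X.X × F.Y.X × S.V) :=
    (F.X.π ∘ₗ LinearMap.proj (φ := fun _ : Fin 3 => S.V) 0).prod
      ((F.Y.π ∘ₗ LinearMap.proj (φ := fun _ : Fin 3 => S.V) 1).prod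
        (LinearMap.proj (φ := fun _ : Fin 3 => S.V) 2))
  have hP : ∀ v : Fin 3 → S.V, P v = (F.X.π (v 0), F.Y.π (v 1), v 2) := fun v => rfl
  have hker : S.mcKer lam tau = LinearMap.ker P := by
    rw [mcKer_eq_kerPart hμ h04]
    ext (v : Fin 3 → S.V)
    show v ∈ S.kerPart lam ↔ P v = 0
    rw [hP, Prod.mk_eq_zero, Prod.mk_eq_zero]
    refine mem_kerPart.trans (and_congr ?_ (and_congr ?_ ?_))
    · rw [F.isX.fac, F.isX.inj.eq_iff' (map_zero _)]
    · rw [F.isY.fac, F.isY.inj.eq_iff' (map_zero _)]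
    · refine ⟨fun h => h03 _ ?_, fun h => ?_⟩
      · linear_combination (norm := module) h
      · rw [h, map_zero, smul_zero, add_zero]
  have hsurj : Function.Surjective P := by
    rintro ⟨x, y, v⟩
    obtain ⟨x, rfl⟩ := F.isX.surj x
    obtain ⟨y, rfl⟩ := F.isY.surj y
    exact ⟨(![x, y, v] : Fin 3 → S.V), rfl⟩
  let e' : ((S.conv lam tau).V ⧸ S.mcKer lam tau) ≃ₗ[ℂ] (F.X.X × F.Y.X × S.V) :=
    (Submodule.quotEquivOfEq _ _ hker).trans (P.quotKerEquivOfSurjective hsurj)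
  have he' : ∀ v, e' ((S.mcKer lam tau).mkQ v) = P v := fun v => rfl
  have he : ∀ v, e'.symm (P v) = (S.mcKer lam tau).mkQ v := fun v => by
    rw [← he', e'.symm_apply_apply]
  refine ⟨e'.symm, fun i j v w h => ?_⟩
  rw [← hP, ← hP]
  refine (congrArg ((S.midConv lam tau).A i j) (he v)).trans (Eq.trans ?_ (he w).symm)
  rw [← h]
  rfl

/-- The residues of the middle convolution in coordinates `X × Y × V`, where `V` is the space of the
original system and `X`, `Y` are the images of `A₀₁` and `A₀₂`. -/
structure IsModel (F : Frame S.A α α' β β' γ γ') (lam tau κX κY : ℂ)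
    (e : (F.X.X × F.Y.X × S.V) ≃ₗ[ℂ] (S.midConv lam tau).V) : Prop where
  f01 : ∀ x y v, (S.midConv lam tau).A 0 1 (e (x, y, v)) =
    e (-(κX + lam + tau) • x + F.Y.φ y • F.X.u + F.X.π (S.A 0 3 v + lam • v), 0, 0)
  f02 : ∀ x y v, (S.midConv lam tau).A 0 2 (e (x, y, v)) =
    e (0, F.X.φ x • F.Y.u - (κY + lam + tau) • y + F.Y.π (S.A 0 3 v + lam • v), 0)
  f03 : ∀ x y v, (S.midConv lam tau).A 0 3 (e (x, y, v)) =
    e (tau • x, tau • y, F.X.ι x + F.Y.ι y + S.A 0 3 v)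
  f12 : ∀ x y v, (S.midConv lam tau).A 1 2 (e (x, y, v)) =
    e (-(F.X.φ x + F.Y.φ y) • F.X.u, -(F.X.φ x + F.Y.φ y) • F.Y.u, S.A 1 2 v)
  f13 : ∀ x y v, (S.midConv lam tau).A 1 3 (e (x, y, v)) =
    e (F.X.B' x + (κX + lam) • x - F.X.π (S.A 0 3 v + lam • v), F.Y.B y,
      -F.X.ι x + S.A 0 1 v + S.A 1 3 v)
  f23 : ∀ x y v, (S.midConv lam tau).A 2 3 (e (x, y, v)) =
    e (F.X.B x, F.Y.B' y + (κY + lam) • y - F.Y.π (S.A 0 3 v + lam • v),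
      -F.Y.ι y + S.A 0 2 v + S.A 2 3 v)

theorem exists_isModel (F : Frame S.A α α' β β' γ γ')
    (hμ : lam + tau ≠ 0) (h03 : ∀ v, S.A 0 3 v = (-lam) • v → v = 0)
    (h04 : ∀ v, S.A 0 4 v = (-tau) • v → v = 0) :
    ∃ e, IsModel F lam tau ((α.sum + α'.sum) + (β.sum + β'.sum))
      ((α.sum + α'.sum) + (γ.sum + γ'.sum)) e := by
  obtain ⟨e, he⟩ := exists_midConv_equiv F hμ h03 h04
  have hX23 := F.isX.π_comm (S.comm 0 1 2 3 (by decide) (by decide) (by decide) (by decide))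
  have hX24 := F.isX.flip.π_comm (S.comm 0 1 2 4 (by decide) (by decide) (by decide) (by decide))
  have hY13 := F.isY.π_comm (S.comm 0 2 1 3 (by decide) (by decide) (by decide) (by decide))
  have hY14 := F.isY.flip.π_comm (S.comm 0 2 1 4 (by decide) (by decide) (by decide) (by decide))
  change ∀ v, F.X.π (S.A 2 4 v) = F.X.B' (F.X.π v) at hX24
  change ∀ v, F.Y.π (S.A 1 4 v) = F.Y.B' (F.Y.π v) at hY14
  rw [S.A24_eq] at hX24
  rw [S.A14_eq] at hY14
  simp only [LinearMap.add_apply, map_add, F.isX.fac, F.isX.π_ι, F.isY.fac, F.isY.π_ι] at hX24 hY14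
  have hc := F.sum_φ
  refine ⟨e, ?_, ?_, ?_, ?_, ?_, ?_⟩
  all_goals
    intro x y v
    obtain ⟨x, rfl⟩ := F.isX.surj x
    obtain ⟨y, rfl⟩ := F.isY.surj y
    refine (he _ _ (![x, y, v] : Fin 3 → S.V) _ rfl).trans (congrArg e ?_)
    refine Prod.ext ?_ (Prod.ext ?_ ?_)
  · show F.X.π (block (conv01 lam tau (S.A 0 1) (S.A 0 2) (S.A 0 3)) ![x, y, v] 0) = _
    simp [block_apply, conv01, F.isX.fac, F.isX.π_ι, F.isY.fac, F.crossXY _]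
    module
  · show F.Y.π (block (conv01 lam tau (S.A 0 1) (S.A 0 2) (S.A 0 3)) ![x, y, v] 1) = _
    simp [block_apply, conv01]
  · show block (conv01 lam tau (S.A 0 1) (S.A 0 2) (S.A 0 3)) ![x, y, v] 2 = _
    simp [block_apply, conv01]
  · show F.X.π (block (conv02 lam tau (S.A 0 1) (S.A 0 2) (S.A 0 3)) ![x, y, v] 0) = _
    simp [block_apply, conv02]
  · show F.Y.π (block (conv02 lam tau (S.A 0 1) (S.A 0 2) (S.A 0 3)) ![x, y, v] 1) = _
    simp [block_apply, conv02, F.isY.fac, F.isY.π_ι, F.isX.fac, F.crossYX _]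
    module
  · show block (conv02 lam tau (S.A 0 1) (S.A 0 2) (S.A 0 3)) ![x, y, v] 2 = _
    simp [block_apply, conv02]
  · show F.X.π (block (conv03 tau (S.A 0 1) (S.A 0 2) (S.A 0 3)) ![x, y, v] 0) = _
    simp [block_apply, conv03]
  · show F.Y.π (block (conv03 tau (S.A 0 1) (S.A 0 2) (S.A 0 3)) ![x, y, v] 1) = _
    simp [block_apply, conv03]
  · show block (conv03 tau (S.A 0 1) (S.A 0 2) (S.A 0 3)) ![x, y, v] 2 = _
    simp [block_apply, conv03, F.isX.fac, F.isY.fac]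
  · show F.X.π (block (conv12 (S.A 0 1) (S.A 0 2) (S.A 1 2)) ![x, y, v] 0) = _
    simp [block_apply, conv12, F.isY.fac, F.isZ.fac, F.crossXY _, F.crossXZ _]
    linear_combination (norm := module) hc x • F.X.u
  · show F.Y.π (block (conv12 (S.A 0 1) (S.A 0 2) (S.A 1 2)) ![x, y, v] 1) = _
    simp [block_apply, conv12, F.isX.fac, F.isZ.fac, F.crossYX _, F.crossYZ _]
    linear_combination (norm := module) hc y • F.Y.u
  · show block (conv12 (S.A 0 1) (S.A 0 2) (S.A 1 2)) ![x, y, v] 2 = _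
    simp [block_apply, conv12]
  · show F.X.π (block (conv13 lam (S.A 0 1) (S.A 0 3) (S.A 1 3)) ![x, y, v] 0) = _
    simp [block_apply, conv13]
    linear_combination (norm := module) hX24 x
  · show F.Y.π (block (conv13 lam (S.A 0 1) (S.A 0 3) (S.A 1 3)) ![x, y, v] 1) = _
    simp [block_apply, conv13, hY13]
  · show block (conv13 lam (S.A 0 1) (S.A 0 3) (S.A 1 3)) ![x, y, v] 2 = _
    simp [block_apply, conv13, F.isX.fac]
    abel
  · show F.X.π (block (conv23 lam (S.A 0 2) (S.A 0 3) (S.A 2 3)) ![x, y, v] 0) = _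
    simp [block_apply, conv23, hX23]
  · show F.Y.π (block (conv23 lam (S.A 0 2) (S.A 0 3) (S.A 2 3)) ![x, y, v] 1) = _
    simp [block_apply, conv23]
    linear_combination (norm := module) hY14 y
  · show block (conv23 lam (S.A 0 2) (S.A 0 3) (S.A 2 3)) ![x, y, v] 2 = _
    simp [block_apply, conv23, F.isY.fac]
    abel

end KZSystem

theorem HasSimultaneousGenEigenvalues.of_eq {V : Type} [AddCommGroup V] [Module ℂ V]
    {A B : End ℂ V} {s t : Multiset (ℂ × ℂ)}
    (h : HasSimultaneousGenEigenvalues A B s) (hst : s = t) :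
    HasSimultaneousGenEigenvalues A B t := hst ▸ h

/-- A presented residue has the eigenvalue `-κ` on its image and zero on the cokernel. -/
theorem Leg.Presents.hasGenEigenvalues {V : Type} [AddCommGroup V] [Module ℂ V]
    [FiniteDimensional ℂ V] {L : Leg V} {A C C' : End ℂ V} {κ c : ℂ} {s s' : Multiset ℂ}
    (h : L.Presents A C C' κ c s s') : ∃ m, finrank ℂ V = finrank ℂ L.X + m ∧
      HasGenEigenvalues A (Multiset.replicate (finrank ℂ L.X) (-κ) + Multiset.replicate m 0) := by
  refine ⟨finrank ℂ (V ⧸ LinearMap.range L.ι), ?_, ?_⟩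
  · rw [← LinearMap.finrank_range_of_inj h.inj, add_comm,
      Submodule.finrank_quotient_add_finrank]
  · refine (hasGenEigenvalues_smul_one (V := L.X) (-κ)).of_exact
      (hasGenEigenvalues_smul_one (V := V ⧸ LinearMap.range L.ι) 0) (i := L.ι)
      (f := (LinearMap.range L.ι).mkQ) h.inj (Submodule.mkQ_surjective _) ?_ ?_ ?_
    · intro v
      simp
    · intro x
      simp [h.fac, h.π_ι]
    · intro v
      simp [h.fac]

namespace KZSystem

variable {S : KZSystem} {lam tau : ℂ} {α α' β β' γ γ' : Multiset ℂ}

/-! ### The legs of a middle convolution -/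

namespace IsModel

variable {F : Frame S.A α α' β β' γ γ'} {κX κY : ℂ}
  {e : (F.X.X × F.Y.X × S.V) ≃ₗ[ℂ] (S.midConv lam tau).V}

theorem f04 (h : IsModel F lam tau κX κY e) (x y v) : (S.midConv lam tau).A 0 4 (e (x, y, v)) =
    e ((κX + lam) • x - F.Y.φ y • F.X.u - F.X.π (S.A 0 3 v + lam • v),
      (κY + lam) • y - F.X.φ x • F.Y.u - F.Y.π (S.A 0 3 v + lam • v),
      -(F.X.ι x + F.Y.ι y + S.A 0 3 v)) := by
  rw [KZSystem.A04_eq, LinearMap.neg_apply, LinearMap.add_apply, LinearMap.add_apply, h.f01, h.f02,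
    h.f03, ← map_add, ← map_add, ← map_neg]
  simp only [Prod.mk_add_mk, Prod.neg_mk]
  congr 1
  refine Prod.ext ?_ (Prod.ext ?_ ?_) <;> module

theorem f14 (h : IsModel F lam tau κX κY e) (x y v) : (S.midConv lam tau).A 1 4 (e (x, y, v)) =
    e (F.X.B x + tau • x, F.X.φ x • F.Y.u + F.Y.B' y, F.X.ι x + S.A 1 4 v) := by
  rw [KZSystem.A14_eq, KZSystem.A14_eq, LinearMap.add_apply, LinearMap.add_apply, h.f02, h.f23,
    h.f03, ← map_add, ← map_add]
  simp only [Prod.mk_add_mk, LinearMap.add_apply]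
  congr 1
  refine Prod.ext ?_ (Prod.ext ?_ ?_) <;> module

theorem f24 (h : IsModel F lam tau κX κY e) (x y v) : (S.midConv lam tau).A 2 4 (e (x, y, v)) =
    e (F.X.B' x + F.Y.φ y • F.X.u, F.Y.B y + tau • y, F.Y.ι y + S.A 2 4 v) := by
  rw [KZSystem.A24_eq, KZSystem.A24_eq, LinearMap.add_apply, LinearMap.add_apply, h.f01, h.f13,
    h.f03, ← map_add, ← map_add]
  simp only [Prod.mk_add_mk, LinearMap.add_apply]
  congr 1
  refine Prod.ext ?_ (Prod.ext ?_ ?_) <;> module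

theorem f34 (h : IsModel F lam tau κX κY e) (x y v) : (S.midConv lam tau).A 3 4 (e (x, y, v)) =
    e (-(κX + lam + tau) • x - F.X.φ x • F.X.u + F.X.π (S.A 0 3 v + lam • v),
      -(κY + lam + tau) • y - F.Y.φ y • F.Y.u + F.Y.π (S.A 0 3 v + lam • v), S.A 1 2 v) := by
  rw [KZSystem.A34_eq, LinearMap.add_apply, LinearMap.add_apply, h.f01, h.f02,
    h.f12, ← map_add, ← map_add]
  simp only [Prod.mk_add_mk]
  congr 1
  refine Prod.ext ?_ (Prod.ext ?_ ?_) <;> module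

end IsModel

/-- The leg of the middle convolution presenting the image of `A₀₁`. -/
noncomputable abbrev legX (F : Frame S.A α α' β β' γ γ') (κX : ℂ)
    (e : (F.X.X × F.Y.X × S.V) ≃ₗ[ℂ] (S.midConv lam tau).V) : Leg (S.midConv lam tau).V where
  X := F.X.X
  π := ((-(κX + lam + tau)) • (LinearMap.id : F.X.X →ₗ[ℂ] F.X.X)).coprod
    ((F.Y.φ.smulRight F.X.u).coprod (F.X.π ∘ₗ (S.A 0 3 + lam • LinearMap.id))) ∘ₗ
      e.symm.toLinearMap
  ι := e.toLinearMap ∘ₗ LinearMap.inl ℂ F.X.X (F.Y.X × S.V)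
  u := F.X.u
  φ := F.X.φ
  B := F.X.B
  B' := F.X.B'

/-- The leg of the middle convolution presenting the image of `A₀₂`. -/
noncomputable abbrev legY (F : Frame S.A α α' β β' γ γ') (κY : ℂ)
    (e : (F.X.X × F.Y.X × S.V) ≃ₗ[ℂ] (S.midConv lam tau).V) : Leg (S.midConv lam tau).V where
  X := F.Y.X
  π := (F.X.φ.smulRight F.Y.u).coprod
    (((-(κY + lam + tau)) • (LinearMap.id : F.Y.X →ₗ[ℂ] F.Y.X)).coprod
      (F.Y.π ∘ₗ (S.A 0 3 + lam • LinearMap.id))) ∘ₗ e.symm.toLinearMap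
  ι := e.toLinearMap ∘ₗ LinearMap.inr ℂ F.X.X (F.Y.X × S.V) ∘ₗ LinearMap.inl ℂ F.Y.X S.V
  u := F.Y.u
  φ := F.Y.φ
  B := F.Y.B
  B' := F.Y.B'

/-- The leg of the middle convolution presenting the image of `A₁₂`, whose dimension has increased
by one: it is spanned by the vector `(u_X, u_Y, 0)` and by the copy of `Z` in `V`. The formulas for
`B`, `B'` and `φ` express `A₀₃`, `A₀₄` and the maps to the other two images on these vectors, the
vector `u_X + u_Y` of `V` being rewritten as `-u_Z`. -/
noncomputable abbrev legZ (F : Frame S.A α α' β β' γ γ') (a : ℂ)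
    (e : (F.X.X × F.Y.X × S.V) ≃ₗ[ℂ] (S.midConv lam tau).V) : Leg (S.midConv lam tau).V where
  X := ℂ × F.Z.X
  π := ((-F.X.φ).coprod ((-F.Y.φ).coprod (0 : S.V →ₗ[ℂ] ℂ)) ∘ₗ e.symm.toLinearMap).prod
    (F.Z.π ∘ₗ LinearMap.snd ℂ F.Y.X S.V ∘ₗ LinearMap.snd ℂ F.X.X (F.Y.X × S.V) ∘ₗ
      e.symm.toLinearMap)
  ι := e.toLinearMap ∘ₗ (((LinearMap.fst ℂ ℂ F.Z.X).smulRight F.X.u).prod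
    (((LinearMap.fst ℂ ℂ F.Z.X).smulRight F.Y.u).prod (F.Z.ι ∘ₗ LinearMap.snd ℂ ℂ F.Z.X)))
  u := (-1, 0)
  φ := (-(a + lam + tau)) • LinearMap.fst ℂ ℂ F.Z.X +
    F.Z.φ ∘ₗ (F.Z.B + lam • LinearMap.id) ∘ₗ LinearMap.snd ℂ ℂ F.Z.X
  B := (tau • LinearMap.fst ℂ ℂ F.Z.X).prod
    (F.Z.B ∘ₗ LinearMap.snd ℂ ℂ F.Z.X - (LinearMap.fst ℂ ℂ F.Z.X).smulRight F.Z.u)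
  B' := (lam • LinearMap.fst ℂ ℂ F.Z.X - F.Z.φ ∘ₗ ((F.Z.B + lam • LinearMap.id) ∘ₗ
      LinearMap.snd ℂ ℂ F.Z.X - (LinearMap.fst ℂ ℂ F.Z.X).smulRight F.Z.u)).prod
    ((LinearMap.fst ℂ ℂ F.Z.X).smulRight F.Z.u - F.Z.B ∘ₗ LinearMap.snd ℂ ℂ F.Z.X)

section legs

variable (F : Frame S.A α α' β β' γ γ') (a κX κY : ℂ)
  (e : (F.X.X × F.Y.X × S.V) ≃ₗ[ℂ] (S.midConv lam tau).V)

theorem legX_π (x y v) : (legX F κX e).π (e (x, y, v)) =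
    -(κX + lam + tau) • x + F.Y.φ y • F.X.u + F.X.π (S.A 0 3 v + lam • v) := by
  show -(κX + lam + tau) • (e.symm (e (x, y, v))).1 + (F.Y.φ (e.symm (e (x, y, v))).2.1 • F.X.u +
    F.X.π (S.A 0 3 (e.symm (e (x, y, v))).2.2 + lam • (e.symm (e (x, y, v))).2.2)) = _
  rw [e.symm_apply_apply]
  module

theorem legX_ι (x) : (legX F κX e).ι x = e (x, 0, 0) := rfl

theorem legY_π (x y v) : (legY F κY e).π (e (x, y, v)) =
    F.X.φ x • F.Y.u - (κY + lam + tau) • y + F.Y.π (S.A 0 3 v + lam • v) := by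
  show F.X.φ (e.symm (e (x, y, v))).1 • F.Y.u + (-(κY + lam + tau) • (e.symm (e (x, y, v))).2.1 +
    F.Y.π (S.A 0 3 (e.symm (e (x, y, v))).2.2 + lam • (e.symm (e (x, y, v))).2.2)) = _
  rw [e.symm_apply_apply]
  module

theorem legY_ι (y) : (legY F κY e).ι y = e (0, y, 0) := rfl

theorem legZ_π (x y v) : (legZ F a e).π (e (x, y, v)) =
    (-(F.X.φ x + F.Y.φ y), F.Z.π v) := by
  show (-F.X.φ (e.symm (e (x, y, v))).1 + (-F.Y.φ (e.symm (e (x, y, v))).2.1 + 0),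
    F.Z.π (e.symm (e (x, y, v))).2.2) = _
  rw [e.symm_apply_apply, add_zero, neg_add]

theorem legZ_ι (s z) : (legZ F a e).ι (s, z) = e (s • F.X.u, s • F.Y.u, F.Z.ι z) := rfl

theorem legZ_φ (s z) : (legZ F a e).φ (s, z) =
    -(a + lam + tau) * s + F.Z.φ (F.Z.B z + lam • z) := rfl

theorem legZ_B (s z) : (legZ F a e).B (s, z) = (tau * s, F.Z.B z - s • F.Z.u) := rfl

theorem legZ_B' (s z) : (legZ F a e).B' (s, z) =
    (lam * s - F.Z.φ (F.Z.B z + lam • z - s • F.Z.u), s • F.Z.u - F.Z.B z) := rfl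

end legs

end KZSystem

namespace KZSystem

variable {S : KZSystem} {lam tau : ℂ} {α α' β β' γ γ' : Multiset ℂ}

theorem presents_legX {F : Frame S.A α α' β β' γ γ'} {κX κY : ℂ}
    {e : (F.X.X × F.Y.X × S.V) ≃ₗ[ℂ] (S.midConv lam tau).V} (h : IsModel F lam tau κX κY e)
    (hs : Function.Surjective fun v => S.A 0 3 v + lam • v) :
    (legX F κX e).Presents ((S.midConv lam tau).A 0 1) ((S.midConv lam tau).A 2 3)
      ((S.midConv lam tau).A 2 4) (κX + lam + tau) (γ.sum + γ'.sum) γ γ' where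
  fac w := by
    obtain ⟨⟨x, y, v⟩, rfl⟩ := e.surjective w
    rw [h.f01, legX_π, legX_ι]
  inj := fun (x : F.X.X) (x' : F.X.X) hxx => by
    rw [legX_ι, legX_ι] at hxx
    simpa using hxx
  surj := fun (x : F.X.X) => by
    obtain ⟨v, rfl⟩ := F.isX.surj x
    obtain ⟨v, rfl⟩ := hs v
    refine ⟨e (0, 0, v), ?_⟩
    rw [legX_π]
    simp
  π_ι := fun (x : F.X.X) => by
    rw [legX_ι, legX_π]
    simp
  φ_u := F.isX.φ_u
  ι_B := fun (x : F.X.X) => by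
    show e (F.X.B x, 0, 0) = (S.midConv lam tau).A 2 3 (e (x, 0, 0))
    rw [h.f23]
    simp
  ι_B' := fun (x : F.X.X) => by
    show e (F.X.B' x, 0, 0) = (S.midConv lam tau).A 2 4 (e (x, 0, 0))
    rw [h.f24]
    simp
  specB := F.isX.specB
  specB' := F.isX.specB'

theorem presents_legY {F : Frame S.A α α' β β' γ γ'} {κX κY : ℂ}
    {e : (F.X.X × F.Y.X × S.V) ≃ₗ[ℂ] (S.midConv lam tau).V} (h : IsModel F lam tau κX κY e)
    (hs : Function.Surjective fun v => S.A 0 3 v + lam • v) :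
    (legY F κY e).Presents ((S.midConv lam tau).A 0 2) ((S.midConv lam tau).A 1 3)
      ((S.midConv lam tau).A 1 4) (κY + lam + tau) (β.sum + β'.sum) β' β where
  fac w := by
    obtain ⟨⟨x, y, v⟩, rfl⟩ := e.surjective w
    rw [h.f02, legY_π, legY_ι]
  inj := fun (x : F.Y.X) (x' : F.Y.X) hxx => by
    rw [legY_ι, legY_ι] at hxx
    simpa using hxx
  surj := fun (x : F.Y.X) => by
    obtain ⟨v, rfl⟩ := F.isY.surj x
    obtain ⟨v, rfl⟩ := hs v
    refine ⟨e (0, 0, v), ?_⟩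
    rw [legY_π]
    simp
  π_ι := fun (x : F.Y.X) => by
    rw [legY_ι, legY_π]
    simp
    module
  φ_u := F.isY.φ_u
  ι_B := fun (x : F.Y.X) => by
    show e (0, F.Y.B x, 0) = (S.midConv lam tau).A 1 3 (e (0, x, 0))
    rw [h.f13]
    simp
  ι_B' := fun (x : F.Y.X) => by
    show e (0, F.Y.B' x, 0) = (S.midConv lam tau).A 1 4 (e (0, x, 0))
    rw [h.f14]
    simp
  specB := F.isY.specB
  specB' := F.isY.specB'

/-- On the image of `A₁₂` the sum of the residues `A₀₃` and `A₀₄` has rank at most one. -/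
theorem Z_B_add_B' (F : Frame S.A α α' β β' γ γ') (z : F.Z.X) :
    F.Z.B z + F.Z.B' z = F.Z.φ z • F.Z.u := by
  apply F.isZ.inj
  rw [map_add, F.isZ.ι_B, F.isZ.ι_B', S.A04_eq, map_smul]
  simp only [LinearMap.neg_apply, LinearMap.add_apply, F.isX.fac, F.isY.fac]
  rw [F.crossXZ, F.crossYZ, map_smul, map_smul]
  linear_combination (norm := module) (-F.Z.φ z) • F.sum_u

theorem surjective_of_or_ne_zero {X Y : Type} [AddCommGroup X] [Module ℂ X] [AddCommGroup Y]
    [Module ℂ Y] {φ : X →ₗ[ℂ] ℂ} {ψ : Y →ₗ[ℂ] ℂ} (h : φ ≠ 0 ∨ ψ ≠ 0) (s : ℂ) :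
    ∃ x y, φ x + ψ y = s := by
  rcases h with h | h
  · obtain ⟨x, hx⟩ := LinearMap.surjective h s
    exact ⟨x, 0, by rw [hx, map_zero, add_zero]⟩
  · obtain ⟨y, hy⟩ := LinearMap.surjective h s
    exact ⟨0, y, by rw [hy, map_zero, zero_add]⟩

theorem presents_legZ {F : Frame S.A α α' β β' γ γ'} {κX κY : ℂ}
    {e : (F.X.X × F.Y.X × S.V) ≃ₗ[ℂ] (S.midConv lam tau).V} (h : IsModel F lam tau κX κY e)
    (hκX : κX = (α.sum + α'.sum) + (β.sum + β'.sum))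
    (hκY : κY = (α.sum + α'.sum) + (γ.sum + γ'.sum)) :
    (legZ F (α.sum + α'.sum) e).Presents ((S.midConv lam tau).A 1 2) ((S.midConv lam tau).A 0 3)
      ((S.midConv lam tau).A 0 4) ((β.sum + β'.sum) + (γ.sum + γ'.sum))
      (α.sum + α'.sum + lam + tau) (tau ::ₘ α') (lam ::ₘ α) where
  fac w := by
    obtain ⟨⟨x, y, v⟩, rfl⟩ := e.surjective w
    rw [h.f12, legZ_π, legZ_ι, F.isZ.fac]
  inj := fun (p : ℂ × F.Z.X) (p' : ℂ × F.Z.X) hxx => by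
    obtain ⟨s, z⟩ := p
    obtain ⟨s', z'⟩ := p'
    rw [legZ_ι, legZ_ι] at hxx
    have h1 := e.injective hxx
    simp only [Prod.mk.injEq] at h1
    obtain ⟨h1, h2, h3⟩ := h1
    refine Prod.ext ?_ (F.isZ.inj h3)
    rcases F.nzXY.1 with hu | hu
    · exact smul_left_injective ℂ hu h1
    · exact smul_left_injective ℂ hu h2
  surj := fun (p : ℂ × F.Z.X) => by
    obtain ⟨s, z⟩ := p
    obtain ⟨v, rfl⟩ := F.isZ.surj z
    obtain ⟨x, y, hxy⟩ := surjective_of_or_ne_zero F.nzXY.2 (-s)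
    refine ⟨e (x, y, v), ?_⟩
    rw [legZ_π, hxy, neg_neg]
  π_ι := fun (p : ℂ × F.Z.X) => by
    obtain ⟨s, z⟩ := p
    rw [legZ_ι, legZ_π, F.isZ.π_ι, map_smul, map_smul, F.isX.φ_u, F.isY.φ_u]
    refine Prod.ext ?_ rfl
    simp
    ring
  φ_u := by
    rw [legZ_φ]
    simp
  ι_B := fun (p : ℂ × F.Z.X) => by
    obtain ⟨s, z⟩ := p
    rw [legZ_B, legZ_ι, legZ_ι, h.f03, map_smul, map_smul, ← F.isZ.ι_B, map_sub, map_smul,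
      mul_smul, mul_smul]
    congr 1
    refine Prod.ext rfl (Prod.ext rfl ?_)
    linear_combination (norm := module) (-s) • F.sum_u
  ι_B' := fun (p : ℂ × F.Z.X) => by
    obtain ⟨s, z⟩ := p
    have hX : ∀ z, F.X.π (F.Z.ι z) = F.Z.φ z • F.X.u := F.crossXZ
    have hY : ∀ z, F.Y.π (F.Z.ι z) = F.Z.φ z • F.Y.u := F.crossYZ
    rw [legZ_B', legZ_ι, legZ_ι, h.f04]
    congr 1
    simp only [map_add, map_smul, map_sub, smul_eq_mul, F.isX.φ_u, F.isY.φ_u, F.isZ.φ_u, hX, hY,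
      ← F.isZ.ι_B]
    subst hκX hκY
    refine Prod.ext ?_ (Prod.ext ?_ ?_)
    · show _ • _ = _
      module
    · show _ • _ = _
      module
    · show _ - _ = -_
      linear_combination (norm := module) s • F.sum_u
  specB := by
    have h1 := hasGenEigenvalues_smul_one (V := ℂ) tau
    rw [finrank_self, Multiset.replicate_one] at h1
    rw [← Multiset.singleton_add, add_comm _ α']
    -- The subspace is the copy of `Z`, on which `B` restricts to the old `B`.
    refine F.isZ.specB.of_exact h1 (i := LinearMap.inr ℂ ℂ F.Z.X) (f := LinearMap.fst ℂ ℂ F.Z.X)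
      LinearMap.inr_injective LinearMap.fst_surjective ?_ ?_ ?_
    · rintro ⟨s, z⟩
      constructor
      · rintro (rfl : s = 0)
        exact ⟨z, rfl⟩
      · rintro ⟨z, hz⟩
        exact congrArg Prod.fst hz.symm
    · intro z
      refine Prod.ext ?_ ?_
      · show (0 : ℂ) = tau * 0
        ring
      · show F.Z.B z = F.Z.B z - (0 : ℂ) • F.Z.u
        rw [zero_smul, sub_zero]
    · rintro ⟨s, z⟩
      rfl
  specB' := by
    have h1 := hasGenEigenvalues_smul_one (V := ℂ) lam
    rw [finrank_self, Multiset.replicate_one] at h1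
    rw [← Multiset.singleton_add, add_comm _ α]
    -- The subspace is the graph of `φ_Z`, on which `B'` restricts to the old `B'`.
    refine F.isZ.specB'.of_exact h1 (i := F.Z.φ.prod LinearMap.id)
      (f := LinearMap.fst ℂ ℂ F.Z.X - F.Z.φ ∘ₗ LinearMap.snd ℂ ℂ F.Z.X) ?_ ?_ ?_ ?_ ?_
    · exact fun z z' hz => congrArg Prod.snd hz
    · exact fun s => ⟨(s, 0), by simp⟩
    · rintro ⟨s, z⟩
      constructor
      · intro (hs : s - F.Z.φ z = 0)
        exact ⟨z, Prod.ext (sub_eq_zero.mp hs).symm rfl⟩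
      · rintro ⟨z, hz⟩
        rw [← hz]
        exact sub_self (F.Z.φ z)
    · intro z
      have hB := Z_B_add_B' F z
      rw [← eq_sub_iff_add_eq'] at hB
      refine Prod.ext ?_ hB
      show F.Z.φ (F.Z.B' z) = lam * F.Z.φ z - F.Z.φ (F.Z.B z + lam • z - F.Z.φ z • F.Z.u)
      rw [hB]
      simp only [map_sub, map_add, map_smul, smul_eq_mul]
      ring
    · rintro ⟨s, z⟩
      show lam * s - F.Z.φ (F.Z.B z + lam • z - s • F.Z.u) - F.Z.φ (s • F.Z.u - F.Z.B z) =
        lam * (s - F.Z.φ z)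
      simp only [map_sub, map_add, map_smul, smul_eq_mul]
      ring

end KZSystem

/-! ### Eigenvalues of a middle convolution -/

theorem HasGenEigenvalues.of_filtration {U V W X : Type} [AddCommGroup U] [Module ℂ U]
    [AddCommGroup V] [Module ℂ V] [AddCommGroup W] [Module ℂ W] [AddCommGroup X] [Module ℂ X]
    [FiniteDimensional ℂ V] [FiniteDimensional ℂ W] [FiniteDimensional ℂ X]
    {AU : End ℂ U} {A : End ℂ V} {AW : End ℂ W} {AX : End ℂ X} {s t r : Multiset ℂ}
    (hU : HasGenEigenvalues AU s) (hW : HasGenEigenvalues AW t) (hX : HasGenEigenvalues AX r)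
    {i : U →ₗ[ℂ] V} {g : V →ₗ[ℂ] W} {f : V →ₗ[ℂ] X} (hi : Function.Injective i)
    (hfg : ∀ x w, ∃ v, f v = x ∧ g v = w)
    (hfi : ∀ u, f (i u) = 0) (hgi : ∀ u, g (i u) = 0)
    (hex : ∀ v, f v = 0 → g v = 0 → ∃ u, i u = v)
    (hiA : ∀ u, i (AU u) = A (i u)) (hgA : ∀ v, f v = 0 → g (A v) = AW (g v))
    (hfA : ∀ v, f (A v) = AX (f v)) :
    HasGenEigenvalues A (s + t + r) := by
  have h := ((hU.pair_add_add 0 0).of_filtration (hW.pair_add_add 0 0) (hX.pair_add_add 0 0)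
    (Commute.refl A) hi hfg hfi hgi hex (by simpa using hiA) (by simpa using hiA)
    (by simpa using hgA) (by simpa using hgA) (by simpa using hfA) (by simpa using hfA)).right
    (Commute.refl A)
  simpa using h

namespace KZSystem

variable {S : KZSystem} {lam tau : ℂ} {α α' β β' γ γ' : Multiset ℂ}

section coordinates

variable (F : Frame S.A α α' β β' γ γ')
  (e : (F.X.X × F.Y.X × S.V) ≃ₗ[ℂ] (S.midConv lam tau).V)

/-- The projection to `X` along the graph of `v ↦ s π_X v`. -/
noncomputable def coordX (s : ℂ) : (S.midConv lam tau).V →ₗ[ℂ] F.X.X :=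
  (LinearMap.fst ℂ F.X.X (F.Y.X × S.V) - (s • F.X.π) ∘ₗ LinearMap.snd ℂ F.Y.X S.V ∘ₗ
    LinearMap.snd ℂ F.X.X (F.Y.X × S.V)) ∘ₗ e.symm.toLinearMap

/-- The projection to `Y` along the graph of `v ↦ t π_Y v`. -/
noncomputable def coordY (t : ℂ) : (S.midConv lam tau).V →ₗ[ℂ] F.Y.X :=
  (LinearMap.fst ℂ F.Y.X S.V - (t • F.Y.π) ∘ₗ LinearMap.snd ℂ F.Y.X S.V) ∘ₗ
    LinearMap.snd ℂ F.X.X (F.Y.X × S.V) ∘ₗ e.symm.toLinearMap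

/-- The projection to `V`. -/
noncomputable def coordV : (S.midConv lam tau).V →ₗ[ℂ] S.V :=
  LinearMap.snd ℂ F.Y.X S.V ∘ₗ LinearMap.snd ℂ F.X.X (F.Y.X × S.V) ∘ₗ e.symm.toLinearMap

theorem coordX_apply (s x y v) : coordX F e s (e (x, y, v)) = x - s • F.X.π v := by simp [coordX]

theorem coordY_apply (t x y v) : coordY F e t (e (x, y, v)) = y - t • F.Y.π v := by simp [coordY]

theorem coordV_apply (x y v) : coordV F e (e (x, y, v)) = v := by simp [coordV]

/-- The embedding of `V` as a graph in `X × Y × V`. -/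
noncomputable def embV (s t : ℂ) : S.V →ₗ[ℂ] (S.midConv lam tau).V :=
  e.toLinearMap ∘ₗ (s • F.X.π).prod ((t • F.Y.π).prod LinearMap.id)

theorem embV_apply (s t : ℂ) (v) : embV F e s t v = e (s • F.X.π v, t • F.Y.π v, v) := rfl

theorem embV_injective (s t : ℂ) : Function.Injective (embV F e s t) := fun v w h => by
  have := congrArg (coordV F e) h
  simpa [embV_apply, coordV_apply] using this

variable {F e}

/-- Simultaneous eigenvalues of a pair of residues that preserves the graph of `(s π_X, t π_Y)` and
the sum of this graph and `Y`. -/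
theorem hasSimultaneousGenEigenvalues_XY {A B : End ℂ (S.midConv lam tau).V}
    (hcomm : Commute A B) (s t : ℂ) {AX BX : End ℂ F.X.X} {AY BY : End ℂ F.Y.X} {AV BV : End ℂ S.V}
    {mX mY mV : Multiset (ℂ × ℂ)}
    (hV : HasSimultaneousGenEigenvalues AV BV mV) (hY : HasSimultaneousGenEigenvalues AY BY mY)
    (hX : HasSimultaneousGenEigenvalues AX BX mX)
    (hVA : ∀ v, A (e (s • F.X.π v, t • F.Y.π v, v)) =
      e (s • F.X.π (AV v), t • F.Y.π (AV v), AV v))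
    (hVB : ∀ v, B (e (s • F.X.π v, t • F.Y.π v, v)) =
      e (s • F.X.π (BV v), t • F.Y.π (BV v), BV v))
    (hYA : ∀ y v, coordY F e t (A (e (s • F.X.π v, y, v))) = AY (y - t • F.Y.π v))
    (hYB : ∀ y v, coordY F e t (B (e (s • F.X.π v, y, v))) = BY (y - t • F.Y.π v))
    (hXA : ∀ x y v, coordX F e s (A (e (x, y, v))) = AX (x - s • F.X.π v))
    (hXB : ∀ x y v, coordX F e s (B (e (x, y, v))) = BX (x - s • F.X.π v)) :
    HasSimultaneousGenEigenvalues A B (mV + mY + mX) := by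
  refine hV.of_filtration hY hX hcomm (embV_injective F e s t) (g := coordY F e t)
    (f := coordX F e s) ?_ ?_ ?_ ?_ (fun v => (hVA v).symm) (fun v => (hVB v).symm) ?_ ?_ ?_ ?_
  · exact fun x y => ⟨e (x, y, 0), by simp [coordX_apply], by simp [coordY_apply]⟩
  · intro v
    rw [embV_apply, coordX_apply, sub_self]
  · intro v
    rw [embV_apply, coordY_apply, sub_self]
  · intro w h1 h2
    obtain ⟨⟨x, y, v⟩, rfl⟩ := e.surjective w
    rw [coordX_apply, sub_eq_zero] at h1
    rw [coordY_apply, sub_eq_zero] at h2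
    exact ⟨v, by rw [embV_apply, h1, h2]⟩
  · intro w h1
    obtain ⟨⟨x, y, v⟩, rfl⟩ := e.surjective w
    rw [coordX_apply, sub_eq_zero] at h1
    rw [h1, hYA, coordY_apply]
  · intro w h1
    obtain ⟨⟨x, y, v⟩, rfl⟩ := e.surjective w
    rw [coordX_apply, sub_eq_zero] at h1
    rw [h1, hYB, coordY_apply]
  · intro w
    obtain ⟨⟨x, y, v⟩, rfl⟩ := e.surjective w
    rw [hXA, coordX_apply]
  · intro w
    obtain ⟨⟨x, y, v⟩, rfl⟩ := e.surjective w
    rw [hXB, coordX_apply]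

/-- Simultaneous eigenvalues of a pair of residues that preserves the graph of `(s π_X, t π_Y)` and
the sum of this graph and `X`. -/
theorem hasSimultaneousGenEigenvalues_YX {A B : End ℂ (S.midConv lam tau).V}
    (hcomm : Commute A B) (s t : ℂ) {AX BX : End ℂ F.X.X} {AY BY : End ℂ F.Y.X} {AV BV : End ℂ S.V}
    {mX mY mV : Multiset (ℂ × ℂ)}
    (hV : HasSimultaneousGenEigenvalues AV BV mV) (hX : HasSimultaneousGenEigenvalues AX BX mX)
    (hY : HasSimultaneousGenEigenvalues AY BY mY)
    (hVA : ∀ v, A (e (s • F.X.π v, t • F.Y.π v, v)) =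
      e (s • F.X.π (AV v), t • F.Y.π (AV v), AV v))
    (hVB : ∀ v, B (e (s • F.X.π v, t • F.Y.π v, v)) =
      e (s • F.X.π (BV v), t • F.Y.π (BV v), BV v))
    (hXA : ∀ x v, coordX F e s (A (e (x, t • F.Y.π v, v))) = AX (x - s • F.X.π v))
    (hXB : ∀ x v, coordX F e s (B (e (x, t • F.Y.π v, v))) = BX (x - s • F.X.π v))
    (hYA : ∀ x y v, coordY F e t (A (e (x, y, v))) = AY (y - t • F.Y.π v))
    (hYB : ∀ x y v, coordY F e t (B (e (x, y, v))) = BY (y - t • F.Y.π v)) :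
    HasSimultaneousGenEigenvalues A B (mV + mX + mY) := by
  refine hV.of_filtration hX hY hcomm (embV_injective F e s t) (g := coordX F e s)
    (f := coordY F e t) ?_ ?_ ?_ ?_ (fun v => (hVA v).symm) (fun v => (hVB v).symm) ?_ ?_ ?_ ?_
  · exact fun y x => ⟨e (x, y, 0), by simp [coordY_apply], by simp [coordX_apply]⟩
  · intro v
    rw [embV_apply, coordY_apply, sub_self]
  · intro v
    rw [embV_apply, coordX_apply, sub_self]
  · intro w h2 h1
    obtain ⟨⟨x, y, v⟩, rfl⟩ := e.surjective w
    rw [coordX_apply, sub_eq_zero] at h1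
    rw [coordY_apply, sub_eq_zero] at h2
    exact ⟨v, by rw [embV_apply, h1, h2]⟩
  · intro w h1
    obtain ⟨⟨x, y, v⟩, rfl⟩ := e.surjective w
    rw [coordY_apply, sub_eq_zero] at h1
    rw [h1, hXA, coordX_apply]
  · intro w h1
    obtain ⟨⟨x, y, v⟩, rfl⟩ := e.surjective w
    rw [coordY_apply, sub_eq_zero] at h1
    rw [h1, hXB, coordX_apply]
  · intro w
    obtain ⟨⟨x, y, v⟩, rfl⟩ := e.surjective w
    rw [hYA, coordY_apply]
  · intro w
    obtain ⟨⟨x, y, v⟩, rfl⟩ := e.surjective w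
    rw [hYB, coordY_apply]

end coordinates

/-- The relations between the projections to the images of `A₀₁`, `A₀₂` and the residues. -/
structure LegRelations (F : Frame S.A α α' β β' γ γ') (κX κY : ℂ) : Prop where
  ιX : ∀ x, F.X.π (F.X.ι x) = (-κX) • x
  ιY : ∀ y, F.Y.π (F.Y.ι y) = (-κY) • y
  XY : ∀ y, F.X.π (F.Y.ι y) = F.Y.φ y • F.X.u
  YX : ∀ x, F.Y.π (F.X.ι x) = F.X.φ x • F.Y.u
  X23 : ∀ v, F.X.π (S.A 2 3 v) = F.X.B (F.X.π v)
  X13 : ∀ v, F.X.π (S.A 1 3 v) = F.X.B' (F.X.π v) + κX • F.X.π v - F.X.π (S.A 0 3 v)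
  X24 : ∀ v, F.X.π (S.A 2 4 v) = F.X.B' (F.X.π v)
  Y13 : ∀ v, F.Y.π (S.A 1 3 v) = F.Y.B (F.Y.π v)
  Y23 : ∀ v, F.Y.π (S.A 2 3 v) = F.Y.B' (F.Y.π v) + κY • F.Y.π v - F.Y.π (S.A 0 3 v)
  Y14 : ∀ v, F.Y.π (S.A 1 4 v) = F.Y.B' (F.Y.π v)

theorem _root_.Frame.legRelations (F : Frame S.A α α' β β' γ γ') :
    LegRelations F ((α.sum + α'.sum) + (β.sum + β'.sum))
      ((α.sum + α'.sum) + (γ.sum + γ'.sum)) := by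
  have X24 : ∀ v, F.X.π (S.A 2 4 v) = F.X.B' (F.X.π v) := F.isX.flip.π_comm
    (S.comm 0 1 2 4 (by decide) (by decide) (by decide) (by decide))
  have Y14 : ∀ v, F.Y.π (S.A 1 4 v) = F.Y.B' (F.Y.π v) := F.isY.flip.π_comm
    (S.comm 0 2 1 4 (by decide) (by decide) (by decide) (by decide))
  refine ⟨F.isX.π_ι, F.isY.π_ι, F.crossXY, F.crossYX,
    F.isX.π_comm (S.comm 0 1 2 3 (by decide) (by decide) (by decide) (by decide)), fun v => ?_, X24,
    F.isY.π_comm (S.comm 0 2 1 3 (by decide) (by decide) (by decide) (by decide)), fun v => ?_, Y14⟩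
  · rw [← X24, S.A24_eq]
    simp only [LinearMap.add_apply, map_add, F.isX.fac, F.isX.π_ι]
    module
  · rw [← Y14, S.A14_eq]
    simp only [LinearMap.add_apply, map_add, F.isY.fac, F.isY.π_ι]
    module

section spectra

variable {F : Frame S.A α α' β β' γ γ'} {κX κY : ℂ}
  {e : (F.X.X × F.Y.X × S.V) ≃ₗ[ℂ] (S.midConv lam tau).V}

open Multiset (crossMap)

theorem spec0314_midConv (h : IsModel F lam tau κX κY e) :
    HasSimultaneousGenEigenvalues ((S.midConv lam tau).A 0 3) ((S.midConv lam tau).A 1 4)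
      (crossMap (fun i j => (i, j)) (tau ::ₘ α') β + crossMap (fun j k => (j + k, j)) β γ' +
        crossMap (fun i k => (i, i + k)) (tau ::ₘ α') γ) := by
  refine (hasSimultaneousGenEigenvalues_XY (e := e) (KZSystem.comm _ _ _ _ _ (by decide) (by decide)
    (by decide) (by decide)) 0 0 F.spec0314 (F.isY.specB'.pair_smul_one_add tau 0)
    (F.isX.specB.pair_smul_one_add tau tau) ?_ ?_ ?_ ?_ ?_ ?_).of_eq ?_
  · intro v; simp [h.f03]
  · intro v; simp [h.f14]
  · intro y v; rw [h.f03, coordY_apply]; simp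
  · intro y v; rw [h.f14, coordY_apply]; simp
  · intro x y v; rw [h.f03, coordX_apply]; simp
  · intro x y v; rw [h.f14, coordX_apply]; simp
  · simp only [Multiset.crossMap_cons_left, add_zero, add_comm tau]
    abel

theorem spec0324_midConv (h : IsModel F lam tau κX κY e) :
    HasSimultaneousGenEigenvalues ((S.midConv lam tau).A 0 3) ((S.midConv lam tau).A 2 4)
      (crossMap (fun i j => (i, i + j)) (tau ::ₘ α') β' +
        crossMap (fun i k => (i, k)) (tau ::ₘ α') γ' + crossMap (fun j k => (j + k, k)) β γ') := by
  refine (hasSimultaneousGenEigenvalues_YX (e := e) (KZSystem.comm _ _ _ _ _ (by decide) (by decide)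
    (by decide) (by decide)) 0 0 F.spec0324 (F.isX.specB'.pair_smul_one_add tau 0)
    (F.isY.specB.pair_smul_one_add tau tau) ?_ ?_ ?_ ?_ ?_ ?_).of_eq ?_
  · intro v; simp [h.f03]
  · intro v; simp [h.f24]
  · intro y v; rw [h.f03, coordX_apply]; simp
  · intro y v; rw [h.f24, coordX_apply]; simp
  · intro x y v; rw [h.f03, coordY_apply]; simp
  · intro x y v; rw [h.f24, coordY_apply]; simp
  · simp only [Multiset.crossMap_cons_left, add_zero, add_comm tau]
    abel

theorem spec0413_midConv (h : IsModel F lam tau κX κY e) (r : LegRelations F κX κY) :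
    HasSimultaneousGenEigenvalues ((S.midConv lam tau).A 0 4) ((S.midConv lam tau).A 1 3)
      (crossMap (fun i j => (i, j)) (lam ::ₘ α) β' +
        crossMap (fun i k => (i, i + k)) (lam ::ₘ α) γ' +
        crossMap (fun j k => (j + k, j)) β' γ) := by
  refine (hasSimultaneousGenEigenvalues_XY (e := e) (KZSystem.comm _ _ _ _ _ (by decide) (by decide)
    (by decide) (by decide)) 1 1 F.spec0413 (F.isY.specB.pair_smul_one_add lam 0)
    (F.isX.specB'.pair_smul_one_add lam lam) ?_ ?_ ?_ ?_ ?_ ?_).of_eq ?_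
  · intro v
    rw [h.f04, S.A04_eq]
    simp [F.isX.fac, F.isY.fac, r.ιX, r.ιY, r.XY, r.YX]
    refine ⟨?_, ?_⟩ <;> module
  · intro v
    rw [h.f13]
    simp [F.isX.fac, r.X13, r.Y13]
    module
  · intro y v
    rw [h.f04, coordY_apply]
    simp [r.ιY, r.YX]
    module
  · intro y v
    rw [h.f13, coordY_apply]
    simp [F.isX.fac, r.Y13]
  · intro x y v
    rw [h.f04, coordX_apply]
    simp [r.ιX, r.XY]
    module
  · intro x y v
    rw [h.f13, coordX_apply]
    simp [F.isX.fac, r.ιX, r.X13]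
    module
  · simp only [Multiset.crossMap_cons_left, add_zero, add_comm lam]
    abel

theorem spec0423_midConv (h : IsModel F lam tau κX κY e) (r : LegRelations F κX κY) :
    HasSimultaneousGenEigenvalues ((S.midConv lam tau).A 0 4) ((S.midConv lam tau).A 2 3)
      (crossMap (fun i j => (i, i + j)) (lam ::ₘ α) β +
        crossMap (fun i k => (i, k)) (lam ::ₘ α) γ + crossMap (fun j k => (j + k, k)) β' γ) := by
  refine (hasSimultaneousGenEigenvalues_YX (e := e) (KZSystem.comm _ _ _ _ _ (by decide) (by decide)
    (by decide) (by decide)) 1 1 F.spec0423 (F.isX.specB.pair_smul_one_add lam 0)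
    (F.isY.specB'.pair_smul_one_add lam lam) ?_ ?_ ?_ ?_ ?_ ?_).of_eq ?_
  · intro v
    rw [h.f04, S.A04_eq]
    simp [F.isX.fac, F.isY.fac, r.ιX, r.ιY, r.XY, r.YX]
    refine ⟨?_, ?_⟩ <;> module
  · intro v
    rw [h.f23]
    simp [F.isY.fac, r.X23, r.Y23]
    module
  · intro x v
    rw [h.f04, coordX_apply]
    simp [r.ιX, r.XY]
    module
  · intro x v
    rw [h.f23, coordX_apply]
    simp [F.isY.fac, r.X23]
  · intro x y v
    rw [h.f04, coordY_apply]
    simp [r.ιY, r.YX]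
    module
  · intro x y v
    rw [h.f23, coordY_apply]
    simp [F.isY.fac, r.ιY, r.Y23]
    module
  · simp only [Multiset.crossMap_cons_left, add_zero, add_comm lam]
    abel

theorem spec1324_midConv (h : IsModel F lam tau κX κY e) (r : LegRelations F κX κY) :
    HasSimultaneousGenEigenvalues ((S.midConv lam tau).A 1 3) ((S.midConv lam tau).A 2 4)
      (crossMap (fun i j => (j, i + j)) (tau ::ₘ α') β' + crossMap (fun j k => (j, k)) β' γ' +
        crossMap (fun i k => (i + k, k)) (lam ::ₘ α) γ') := by
  refine (hasSimultaneousGenEigenvalues_YX (e := e) (KZSystem.comm _ _ _ _ _ (by decide) (by decide)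
    (by decide) (by decide)) 1 0 F.spec1324 (F.isX.specB'.pair_add_add lam 0)
    (F.isY.specB.pair_add_add 0 tau) ?_ ?_ ?_ ?_ ?_ ?_).of_eq ?_
  · intro v
    rw [h.f13]
    simp [F.isX.fac, r.X13]
    module
  · intro v
    rw [h.f24]
    simp [r.X24]
  · intro x v
    rw [h.f13, coordX_apply]
    simp [F.isX.fac, r.ιX, r.X13]
    module
  · intro x v
    rw [h.f24, coordX_apply]
    simp [r.X24]
  · intro x y v
    rw [h.f13, coordY_apply]
    simp
  · intro x y v
    rw [h.f24, coordY_apply]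
    simp
  · simp only [Multiset.crossMap_cons_left, add_zero, add_comm lam, add_comm tau]
    abel

theorem spec1423_midConv (h : IsModel F lam tau κX κY e) (r : LegRelations F κX κY) :
    HasSimultaneousGenEigenvalues ((S.midConv lam tau).A 1 4) ((S.midConv lam tau).A 2 3)
      (crossMap (fun i j => (j, i + j)) (lam ::ₘ α) β + crossMap (fun j k => (j, k)) β γ +
        crossMap (fun i k => (i + k, k)) (tau ::ₘ α') γ) := by
  refine (hasSimultaneousGenEigenvalues_XY (e := e) (KZSystem.comm _ _ _ _ _ (by decide) (by decide)
    (by decide) (by decide)) 0 1 F.spec1423 (F.isY.specB'.pair_add_add 0 lam)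
    (F.isX.specB.pair_add_add tau 0) ?_ ?_ ?_ ?_ ?_ ?_).of_eq ?_
  · intro v
    rw [h.f14]
    simp [r.Y14]
  · intro v
    rw [h.f23]
    simp [F.isY.fac, r.Y23]
    module
  · intro y v
    rw [h.f14, coordY_apply]
    simp [r.Y14]
  · intro y v
    rw [h.f23, coordY_apply]
    simp [F.isY.fac, r.ιY, r.Y23]
    module
  · intro x y v
    rw [h.f14, coordX_apply]
    simp
  · intro x y v
    rw [h.f23, coordX_apply]
    simp
  · simp only [Multiset.crossMap_cons_left, add_zero, add_comm lam, add_comm tau]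
    abel

end spectra

end KZSystem

namespace KZSystem

variable {S : KZSystem} {lam tau : ℂ} {α α' β β' γ γ' : Multiset ℂ}

theorem _root_.Frame.card_eq {V : Type} [AddCommGroup V] [Module ℂ V]
    {A : Fin 5 → Fin 5 → End ℂ V} (F : Frame A α α' β β' γ γ') :
    α'.card = α.card ∧ β'.card = β.card ∧ γ'.card = γ.card :=
  ⟨by rw [← F.isZ.card_eq, F.isZ.card_eq'], by rw [← F.isY.card_eq, F.isY.card_eq'],
    by rw [← F.isX.card_eq, F.isX.card_eq']⟩

theorem _root_.Frame.finrank_eq (F : Frame S.A α α' β β' γ γ') :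
    finrank ℂ S.V = α.card * β.card + β.card * γ.card + γ.card * α.card := by
  obtain ⟨h1, h2, h3⟩ := F.card_eq
  rw [(F.spec0314.left (S.comm 0 3 1 4 (by decide) (by decide) (by decide) (by decide))).finrank_eq]
  simp only [Multiset.card_map, Multiset.card_add, Multiset.card_crossMap, h1, h3]
  ring

/-- In `X × Y × V` the residue `A₃₄` is block triangular: on `X` and `Y` it is a scalar plus an
operator of rank one, on `V` it is the old `A₁₂`. -/
theorem exists_spec34_midConv {F : Frame S.A α α' β β' γ γ'} {κX κY : ℂ}
    {e : (F.X.X × F.Y.X × S.V) ≃ₗ[ℂ] (S.midConv lam tau).V} (h : IsModel F lam tau κX κY e) :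
    ∃ s : Multiset ℂ, HasGenEigenvalues ((S.midConv lam tau).A 3 4) s ∧
      s + Multiset.replicate (α.card + 1 + β.card + γ.card) 0 +
        {-((β.sum + β'.sum) + (γ.sum + γ'.sum))} + {-(κY + lam + tau)} + {-(κX + lam + tau)} =
      {-(κX + lam + tau) - (γ.sum + γ'.sum)} + {-(κY + lam + tau) - (β.sum + β'.sum)} +
      Multiset.replicate (α.card + 1) (-((β.sum + β'.sum) + (γ.sum + γ'.sum))) +
      Multiset.replicate β.card (-(κY + lam + tau)) +
      Multiset.replicate γ.card (-(κX + lam + tau)) +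
      Multiset.replicate
        ((α.card + 1) * β.card + β.card * γ.card + γ.card * (α.card + 1) + 1) 0 := by
  obtain ⟨s1, h1, e1⟩ := hasGenEigenvalues_smul_one_sub_smulRight (-(κX + lam + tau)) F.X.φ F.X.u
  obtain ⟨s2, h2, e2⟩ := hasGenEigenvalues_smul_one_sub_smulRight (-(κY + lam + tau)) F.Y.φ F.Y.u
  obtain ⟨m, hm, h3⟩ := F.isZ.hasGenEigenvalues
  rw [F.isX.φ_u, F.isX.card_eq] at e1
  rw [F.isY.φ_u, F.isY.card_eq, F.card_eq.2.1] at e2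
  rw [F.isZ.card_eq, F.card_eq.1] at h3 hm
  rw [F.finrank_eq] at hm
  refine ⟨_, h2.of_filtration h1 h3
    (i := e.toLinearMap ∘ₗ LinearMap.inr ℂ F.X.X (F.Y.X × S.V) ∘ₗ LinearMap.inl ℂ F.Y.X S.V)
    (g := coordX F e 0) (f := coordV F e) ?_ ?_ ?_ ?_ ?_ ?_ ?_ ?_, ?_⟩
  · intro y y' hy
    simpa using hy
  · exact fun v x => ⟨e (x, 0, v), by rw [coordV_apply], by rw [coordX_apply, zero_smul, sub_zero]⟩
  · exact fun y => coordV_apply F e 0 y 0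
  · exact fun y => (coordX_apply F e 0 0 y 0).trans (by simp)
  · intro w hw hw'
    obtain ⟨⟨x, y, v⟩, rfl⟩ := e.surjective w
    rw [coordV_apply] at hw
    rw [coordX_apply, zero_smul, sub_zero] at hw'
    subst hw hw'
    exact ⟨y, rfl⟩
  · intro y
    show e (0, _, 0) = (S.midConv lam tau).A 3 4 (e (0, y, 0))
    rw [h.f34]
    simp
  · intro w hw
    obtain ⟨⟨x, y, v⟩, rfl⟩ := e.surjective w
    rw [coordV_apply] at hw
    subst hw
    rw [h.f34, coordX_apply, coordX_apply]
    simp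
  · intro w
    obtain ⟨⟨x, y, v⟩, rfl⟩ := e.surjective w
    rw [h.f34, coordV_apply, coordV_apply]
  · have e3 : Multiset.replicate ((α.card + 1) * β.card + β.card * γ.card +
        γ.card * (α.card + 1) + 1) (0 : ℂ) = Multiset.replicate m 0 +
        Multiset.replicate (α.card + 1 + β.card + γ.card) 0 := by
      rw [← Multiset.replicate_add]
      congr 1
      linarith
    rw [e3, Multiset.replicate_add α.card 1, Multiset.replicate_one]
    calc _ = (s1 + {-(κX + lam + tau)}) + (s2 + {-(κY + lam + tau)}) +
          Multiset.replicate α.card (-((β.sum + β'.sum) + (γ.sum + γ'.sum))) +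
          {-((β.sum + β'.sum) + (γ.sum + γ'.sum))} + Multiset.replicate m 0 +
          Multiset.replicate (α.card + 1 + β.card + γ.card) 0 := by abel
      _ = _ := by rw [e1, e2]; abel

/-- Middle convolution adds `lam` to the parameters `α` and `tau` to the parameters `α'`. -/
theorem nonempty_frame_midConv (F : Frame S.A α α' β β' γ γ') (hμ : lam + tau ≠ 0)
    (h1 : ∀ x ∈ α', lam + x ≠ 0) (h2 : ∀ y ∈ β, ∀ z ∈ γ', lam + y + z ≠ 0)
    (h3 : ∀ x ∈ α, tau + x ≠ 0) (h4 : ∀ y ∈ β', ∀ z ∈ γ, tau + y + z ≠ 0) :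
    Nonempty (Frame (S.midConv lam tau).A (lam ::ₘ α) (tau ::ₘ α') β β' γ γ') := by
  have h03 : ∀ v, S.A 0 3 v = (-lam) • v → v = 0 := fun v =>
    (F.spec0314.left (S.comm 0 3 1 4 (by decide) (by decide) (by decide)
      (by decide))).eq_zero_of_eigenvector (by
        simp only [Multiset.map_add, Multiset.map_crossMap, Multiset.mem_add,
          Multiset.mem_crossMap]
        rintro ((⟨x, hx, y, hy, hxy⟩ | ⟨y, hy, z, hz, hyz⟩) | ⟨x, hx, y, hy, hxy⟩)
        · exact h1 x hx (by rw [hxy]; ring)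
        · exact h2 y hy z hz (by rw [add_assoc, hyz]; ring)
        · exact h1 x hx (by rw [hxy]; ring))
  have h04 : ∀ v, S.A 0 4 v = (-tau) • v → v = 0 := fun v =>
    (F.spec0413.left (S.comm 0 4 1 3 (by decide) (by decide) (by decide)
      (by decide))).eq_zero_of_eigenvector (by
        simp only [Multiset.map_add, Multiset.map_crossMap, Multiset.mem_add,
          Multiset.mem_crossMap]
        rintro ((⟨x, hx, y, hy, hxy⟩ | ⟨x, hx, y, hy, hxy⟩) | ⟨y, hy, z, hz, hyz⟩)
        · exact h3 x hx (by rw [hxy]; ring)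
        · exact h3 x hx (by rw [hxy]; ring)
        · exact h4 y hy z hz (by rw [add_assoc, hyz]; ring))
  obtain ⟨e, h⟩ := exists_isModel F hμ h03 h04
  have r := F.legRelations
  have hs : Function.Surjective fun v => S.A 0 3 v + lam • v := by
    have hinj : Function.Injective (S.A 0 3 + lam • LinearMap.id : End ℂ S.V) := by
      rw [← LinearMap.ker_eq_bot, LinearMap.ker_eq_bot']
      intro v hv
      have hv' : S.A 0 3 v + lam • v = 0 := hv
      exact h03 v (by rw [neg_smul]; exact eq_neg_of_add_eq_zero_left hv')
    exact LinearMap.surjective_of_injective hinj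
  have hsZ : Function.Surjective fun z => F.Z.B z + lam • z := by
    have hinj : Function.Injective (F.Z.B + lam • LinearMap.id : End ℂ F.Z.X) := by
      rw [← LinearMap.ker_eq_bot, LinearMap.ker_eq_bot']
      intro v hv
      have hv' : F.Z.B v + lam • v = 0 := hv
      refine F.isZ.specB.eq_zero_of_eigenvector (μ := -lam) (fun hm => h1 _ hm (by ring)) ?_
      rw [neg_smul]
      exact eq_neg_of_add_eq_zero_left hv'
    exact LinearMap.surjective_of_injective hinj
  have hφ : F.Z.φ ≠ 0 → (legZ F (α.sum + α'.sum) e).φ ≠ 0 := by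
    intro h0 h0'
    apply h0
    ext z
    obtain ⟨z, rfl⟩ := hsZ z
    have := congrArg (fun f : (ℂ × F.Z.X) →ₗ[ℂ] ℂ => f (0, z)) h0'
    rw [legZ_φ] at this
    simpa using this
  have hu : (legZ F (α.sum + α'.sum) e).u ≠ 0 := fun h0 => by simpa using congrArg Prod.fst h0
  obtain ⟨s, hs34, es34⟩ := exists_spec34_midConv h
  exact ⟨{
    X := legX F _ e
    Y := legY F _ e
    Z := legZ F (α.sum + α'.sum) e
    isX := by
      convert presents_legX h hs using 1
      simp only [Multiset.sum_cons]
      ring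
    isY := by
      convert presents_legY h hs using 1
      simp only [Multiset.sum_cons]
      ring
    isZ := by
      convert presents_legZ h rfl rfl using 1
      simp only [Multiset.sum_cons]
      ring
    crossXY := fun (y : F.Y.X) => by rw [legY_ι, legX_π]; simp
    crossYX := fun (x : F.X.X) => by rw [legX_ι, legY_π]; simp
    crossXZ := fun (p : ℂ × F.Z.X) => by
      obtain ⟨s, z⟩ := p
      rw [legZ_ι, legX_π, legZ_φ, ← F.isZ.ι_B, ← map_smul F.Z.ι, ← map_add, F.crossXZ, map_smul,
        F.isY.φ_u]
      simp only [smul_eq_mul]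
      module
    crossZX := fun (x : F.X.X) => by
      rw [legX_ι, legZ_π]
      simp
    crossYZ := fun (p : ℂ × F.Z.X) => by
      obtain ⟨s, z⟩ := p
      rw [legZ_ι, legY_π, legZ_φ, ← F.isZ.ι_B, ← map_smul F.Z.ι, ← map_add, F.crossYZ, map_smul,
        F.isX.φ_u]
      simp only [smul_eq_mul]
      module
    crossZY := fun (y : F.Y.X) => by
      rw [legY_ι, legZ_π]
      simp
    sum_u := by
      rw [legX_ι, legY_ι, legZ_ι, ← map_add, ← map_add]
      simp
    sum_φ := fun w => by
      obtain ⟨⟨x, y, v⟩, rfl⟩ := e.surjective w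
      have hc := F.sum_φ (S.A 0 3 v + lam • v)
      have hZ : F.Z.π (S.A 0 3 v + lam • v) = F.Z.B (F.Z.π v) + lam • F.Z.π v := by
        rw [map_add, map_smul, F.isZ.π_comm (S.comm 1 2 0 3 (by decide) (by decide) (by decide)
          (by decide))]
      rw [hZ] at hc
      rw [legX_π, legY_π, legZ_π, legZ_φ]
      simp only [map_add, map_sub, map_smul, smul_eq_mul, F.isX.φ_u, F.isY.φ_u] at hc ⊢
      linear_combination hc
    nzXY := F.nzXY
    nzXZ := ⟨Or.inr hu, F.nzXZ.2.imp_right hφ⟩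
    nzYZ := ⟨Or.inr hu, F.nzYZ.2.imp_right hφ⟩
    spec0314 := spec0314_midConv h
    spec0324 := spec0324_midConv h
    spec0413 := spec0413_midConv h r
    spec0423 := spec0423_midConv h r
    spec1324 := spec1324_midConv h r
    spec1423 := spec1423_midConv h r
    s34 := s
    spec34 := hs34
    s34_eq := by
      simp only [Multiset.sum_cons, Multiset.card_cons]
      have k1 : lam + α.sum + (tau + α'.sum) + (β.sum + β'.sum) + (γ.sum + γ'.sum) =
        -(-(α.sum + α'.sum + (β.sum + β'.sum) + lam + tau) - (γ.sum + γ'.sum)) := by ring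
      have k2 : -(α.sum + α'.sum + (γ.sum + γ'.sum) + lam + tau) - (β.sum + β'.sum) =
        -(α.sum + α'.sum + (β.sum + β'.sum) + lam + tau) - (γ.sum + γ'.sum) := by ring
      have k3 : lam + α.sum + (tau + α'.sum) + (γ.sum + γ'.sum) =
        α.sum + α'.sum + (γ.sum + γ'.sum) + lam + tau := by ring
      have k4 : lam + α.sum + (tau + α'.sum) + (β.sum + β'.sum) =
        α.sum + α'.sum + (β.sum + β'.sum) + lam + tau := by ring
      rw [k2] at es34
      rw [k1, k3, k4, es34, neg_neg]
      rfl }⟩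

end KZSystem

/-! ### The system of `F_{p,q,r}` has a frame -/

namespace KZSystem

theorem hasSimultaneousGenEigenvalues_of_eq_smul_one {A B : End ℂ ℂ} {c d : ℂ}
    (hA : A = c • 1) (hB : B = d • 1) : HasSimultaneousGenEigenvalues A B {(c, d)} := by
  subst hA hB
  simpa using (hasGenEigenvalues_smul_one (V := ℂ) d).pair_smul_one_add c 0

theorem hasGenEigenvalues_of_eq_smul_one {A : End ℂ ℂ} {c : ℂ} (hA : A = c • 1) :
    HasGenEigenvalues A {c} := by
  subst hA
  simpa using hasGenEigenvalues_smul_one (V := ℂ) c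

/-- The frame of the system of rank one: the image of `A₀₁ = 0` is zero, those of `A₀₂` and `A₁₂`
are the whole space. -/
noncomputable def frameRankOne (α α' β β' : ℂ) (hα : α + α' ≠ 0) (hβ : β + β' ≠ 0) :
    Frame (rankOne α α' β β').A {α} {α'} {β} {β'} 0 0 := by
  show Frame (V := ℂ) _ _ _ _ _ _ _
  let A : Fin 5 → Fin 5 → End ℂ ℂ :=
    residues 0 (-(α + α') • 1) (α' • 1) (-(β + β') • 1) (β' • 1) ((α + β) • 1)
  have e03 : A 0 3 = α' • 1 := rfl
  have e13 : A 1 3 = β' • 1 := rfl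
  have e23 : A 2 3 = (α + β) • 1 := rfl
  have e04 : A 0 4 = α • 1 := by
    show -(0 + -(α + α') • (1 : End ℂ ℂ) + α' • 1) = α • 1
    module
  have e14 : A 1 4 = β • 1 := by
    show -(0 + -(β + β') • (1 : End ℂ ℂ) + β' • 1) = β • 1
    module
  have e24 : A 2 4 = (α' + β') • 1 := by
    show -(-(α + α') • (1 : End ℂ ℂ) + -(β + β') • (1 : End ℂ ℂ) + (α + β) • 1) = (α' + β') • 1
    module
  have e34 : A 3 4 = (-((α + α') + (β + β'))) • 1 := by
    show -(α' • (1 : End ℂ ℂ) + β' • (1 : End ℂ ℂ) + (α + β) • 1) = (-((α + α') + (β + β'))) • 1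
    module
  let X : Leg ℂ := { X := PUnit, π := 0, ι := 0, u := 0, φ := 0, B := 0, B' := 0 }
  let Y : Leg ℂ := { X := ℂ, π := (-(α + α')) • LinearMap.id, ι := LinearMap.id, u := -1,
                     φ := (-(β + β')) • LinearMap.id, B := A 1 3, B' := A 1 4 }
  let Z : Leg ℂ := { X := ℂ, π := (-(β + β')) • LinearMap.id, ι := LinearMap.id, u := 1,
                     φ := (α + α') • LinearMap.id, B := A 0 3, B' := A 0 4 }
  have hYu : Y.u ≠ 0 := neg_ne_zero.mpr one_ne_zero
  have hZu : Z.u ≠ 0 := one_ne_zero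
  have hYφ : Y.φ ≠ 0 := fun h => neg_ne_zero.mpr hβ (by
    have : (-(β + β')) * 1 = 0 := congrArg (fun f : ℂ →ₗ[ℂ] ℂ => f 1) h
    simpa using this)
  have hZφ : Z.φ ≠ 0 := fun h => hα (by
    have : (α + α') * 1 = 0 := congrArg (fun f : ℂ →ₗ[ℂ] ℂ => f 1) h
    simpa using this)
  have hspec : HasGenEigenvalues (0 : End ℂ PUnit) 0 := fun μ => by
    rw [Multiset.count_zero, Submodule.finrank_eq_zero]
    exact Subsingleton.elim _ _
  refine
    { X := X, Y := Y, Z := Z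
      isX := ⟨fun _ => rfl, fun _ _ _ => rfl, fun _ => ⟨0, rfl⟩, fun _ => rfl, by simp [X],
        fun _ => (map_zero _).symm, fun _ => (map_zero _).symm, hspec, hspec⟩
      isY := ⟨fun v => ?_, fun _ _ h => h, fun w => ⟨(-(α + α'))⁻¹ * w, ?_⟩, fun v => ?_, ?_,
        fun _ => rfl, fun _ => rfl, hasGenEigenvalues_of_eq_smul_one e13,
        hasGenEigenvalues_of_eq_smul_one e14⟩
      isZ := ⟨fun v => ?_, fun _ _ h => h, fun w => ⟨(-(β + β'))⁻¹ * w, ?_⟩, fun v => ?_, ?_,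
        fun _ => rfl, fun _ => rfl, hasGenEigenvalues_of_eq_smul_one e03,
        hasGenEigenvalues_of_eq_smul_one e04⟩
      crossXY := fun _ => rfl
      crossXZ := fun _ => rfl
      crossYX := fun _ => ?_
      crossZX := fun _ => ?_
      crossYZ := fun v => ?_
      crossZY := fun v => ?_
      sum_u := ?_
      sum_φ := fun v => ?_
      nzXY := ⟨Or.inr hYu, Or.inr hYφ⟩
      nzXZ := ⟨Or.inr hZu, Or.inr hZφ⟩
      nzYZ := ⟨Or.inr hZu, Or.inr hZφ⟩
      spec0314 := (hasSimultaneousGenEigenvalues_of_eq_smul_one e03 e14).of_eq (by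
        simp [Multiset.crossMap])
      spec0324 := (hasSimultaneousGenEigenvalues_of_eq_smul_one e03 e24).of_eq (by
        simp [Multiset.crossMap])
      spec0413 := (hasSimultaneousGenEigenvalues_of_eq_smul_one e04 e13).of_eq (by
        simp [Multiset.crossMap])
      spec0423 := (hasSimultaneousGenEigenvalues_of_eq_smul_one e04 e23).of_eq (by
        simp [Multiset.crossMap])
      spec1324 := (hasSimultaneousGenEigenvalues_of_eq_smul_one e13 e24).of_eq (by
        simp [Multiset.crossMap])
      spec1423 := (hasSimultaneousGenEigenvalues_of_eq_smul_one e14 e23).of_eq (by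
        simp [Multiset.crossMap])
      s34 := {-((α + α') + (β + β'))}
      spec34 := hasGenEigenvalues_of_eq_smul_one e34
      s34_eq := ?_ }
  · rfl
  · exact mul_inv_cancel_left₀ (neg_ne_zero.mpr hα) w
  · simp only [Multiset.sum_singleton, Multiset.sum_zero, add_zero]
    rfl
  · show -(β + β') * (-1) = _
    simp
  · rfl
  · exact mul_inv_cancel_left₀ (neg_ne_zero.mpr hβ) w
  · simp only [Multiset.sum_singleton, Multiset.sum_zero, add_zero]
    rfl
  · show (α + α') * 1 = _
    simp
  · show Y.π 0 = (0 : ℂ) • Y.u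
    rw [map_zero, zero_smul]
  · show Z.π 0 = (0 : ℂ) • Z.u
    rw [map_zero, zero_smul]
  · show -(α + α') * v = ((α + α') * v) * (-1)
    ring
  · show -(β + β') * v = (-(β + β') * v) * 1
    ring
  · show (0 : ℂ) + -1 + 1 = 0
    ring
  · show (0 : ℂ) + -(β + β') * (-(α + α') * v) + (α + α') * (-(β + β') * v) = 0
    ring
  · simp only [Multiset.sum_singleton, Multiset.sum_zero, add_zero, Multiset.card_singleton,
      Multiset.card_zero, mul_one, mul_zero, Multiset.replicate_zero, Multiset.replicate_succ,
      ← Multiset.singleton_add]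
    abel

/-- The genericity of the parameters in terms of multisets. -/
structure NondegenerateOn (α α' β β' γ γ' : Multiset ℂ) : Prop where
  αα' : ∀ x ∈ α, ∀ x' ∈ α', x + x' ≠ 0
  ββ' : ∀ y ∈ β, ∀ y' ∈ β', y + y' ≠ 0
  γγ' : ∀ z ∈ γ, ∀ z' ∈ γ', z + z' ≠ 0
  αβγ' : ∀ x ∈ α, ∀ y ∈ β, ∀ z ∈ γ', x + y + z ≠ 0
  α'β'γ : ∀ x ∈ α', ∀ y ∈ β', ∀ z ∈ γ, x + y + z ≠ 0

theorem NondegenerateOn.mono {α α' β β' γ γ' δ δ' ε ε' ζ ζ' : Multiset ℂ}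
    (h : NondegenerateOn α α' β β' γ γ') (h1 : δ ≤ α) (h2 : δ' ≤ α') (h3 : ε ≤ β) (h4 : ε' ≤ β')
    (h5 : ζ ≤ γ) (h6 : ζ' ≤ γ') : NondegenerateOn δ δ' ε ε' ζ ζ' where
  αα' x hx x' hx' := h.αα' x (Multiset.mem_of_le h1 hx) x' (Multiset.mem_of_le h2 hx')
  ββ' y hy y' hy' := h.ββ' y (Multiset.mem_of_le h3 hy) y' (Multiset.mem_of_le h4 hy')
  γγ' z hz z' hz' := h.γγ' z (Multiset.mem_of_le h5 hz) z' (Multiset.mem_of_le h6 hz')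
  αβγ' x hx y hy z hz := h.αβγ' x (Multiset.mem_of_le h1 hx) y (Multiset.mem_of_le h3 hy) z
    (Multiset.mem_of_le h6 hz)
  α'β'γ x hx y hy z hz := h.α'β'γ x (Multiset.mem_of_le h2 hx) y (Multiset.mem_of_le h4 hy) z
    (Multiset.mem_of_le h5 hz)

variable {S : KZSystem} {lam tau : ℂ} {α α' β β' γ γ' : Multiset ℂ}

theorem nonempty_frame_Kx (F : Nonempty (Frame S.A α α' β β' γ γ'))
    (h : NondegenerateOn (lam ::ₘ α) (tau ::ₘ α') β β' γ γ') :
    Nonempty (Frame (S.Kx lam tau).A (lam ::ₘ α) (tau ::ₘ α') β β' γ γ') := by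
  obtain ⟨F⟩ := F
  have hl := Multiset.mem_cons_self lam α
  have ht := Multiset.mem_cons_self tau α'
  exact nonempty_frame_midConv F (h.αα' _ hl _ ht)
    (fun x hx => h.αα' _ hl _ (Multiset.mem_cons_of_mem hx))
    (fun y hy z hz => h.αβγ' _ hl _ hy _ hz)
    (fun x hx => by rw [add_comm]; exact h.αα' _ (Multiset.mem_cons_of_mem hx) _ ht)
    (fun y hy z hz => h.α'β'γ _ ht _ hy _ hz)

theorem nonempty_frame_Ky (F : Nonempty (Frame S.A α α' β β' γ γ'))
    (h : NondegenerateOn α α' (lam ::ₘ β) (tau ::ₘ β') γ γ') :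
    Nonempty (Frame (S.Ky lam tau).A α α' (lam ::ₘ β) (tau ::ₘ β') γ γ') := by
  obtain ⟨F⟩ := F
  have hl := Multiset.mem_cons_self lam β
  have ht := Multiset.mem_cons_self tau β'
  obtain ⟨G⟩ := nonempty_frame_midConv (S := S.perm (Equiv.swap 0 1)) (F.swap S.symm)
    (h.ββ' _ hl _ ht)
    (fun x hx => h.ββ' _ hl _ (Multiset.mem_cons_of_mem hx))
    (fun y hy z hz => by rw [add_comm lam]; exact h.αβγ' _ hy _ hl _ hz)
    (fun x hx => by rw [add_comm]; exact h.ββ' _ (Multiset.mem_cons_of_mem hx) _ ht)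
    (fun y hy z hz => by rw [add_comm tau]; exact h.α'β'γ _ hy _ ht _ hz)
  exact ⟨G.swap (KZSystem.symm _)⟩

theorem nonempty_frame_Kxy (F : Nonempty (Frame S.A α α' β β' γ γ'))
    (h : NondegenerateOn α α' β β' (lam ::ₘ γ) (tau ::ₘ γ')) :
    Nonempty (Frame (S.Kxy lam tau).A α α' β β' (lam ::ₘ γ) (tau ::ₘ γ')) := by
  obtain ⟨F⟩ := F
  have hl := Multiset.mem_cons_self lam γ
  have ht := Multiset.mem_cons_self tau γ'
  obtain ⟨G⟩ := nonempty_frame_midConv (S := S.perm (Equiv.swap 0 2 * Equiv.swap 3 4))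
    (F.swapSwap S.symm) (h.γγ' _ hl _ ht)
    (fun x hx => h.γγ' _ hl _ (Multiset.mem_cons_of_mem hx))
    (fun y hy z hz => by
      rw [add_comm, add_comm lam, ← add_assoc]; exact h.α'β'γ _ hz _ hy _ hl)
    (fun x hx => by rw [add_comm]; exact h.γγ' _ (Multiset.mem_cons_of_mem hx) _ ht)
    (fun y hy z hz => by
      rw [add_comm, add_comm tau, ← add_assoc]; exact h.αβγ' _ hz _ hy _ ht)
  exact ⟨G.swapSwap (KZSystem.symm _)⟩

theorem nonempty_frame_foldl_Kx (l : List (ℂ × ℂ)) :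
    ∀ {S : KZSystem} {α α' : Multiset ℂ}, Nonempty (Frame S.A α α' β β' γ γ') →
      NondegenerateOn (l.map Prod.fst + α) (l.map Prod.snd + α') β β' γ γ' →
      Nonempty (Frame (l.foldl (fun S a => S.Kx a.1 a.2) S).A (l.map Prod.fst + α)
        (l.map Prod.snd + α') β β' γ γ') := by
  induction l with
  | nil =>
    intro S α α' F _
    have e1 : (([] : List (ℂ × ℂ)).map Prod.fst : List ℂ) + α = α := zero_add _
    have e2 : (([] : List (ℂ × ℂ)).map Prod.snd : List ℂ) + α' = α' := zero_add _
    rw [e1, e2]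
    exact F
  | cons c l ih =>
    intro S α α' F h
    have e1 : (((c :: l).map Prod.fst : List ℂ) : Multiset ℂ) + α =
        (l.map Prod.fst : List ℂ) + (c.1 ::ₘ α) := by
      simp [← Multiset.cons_coe]
    have e2 : (((c :: l).map Prod.snd : List ℂ) : Multiset ℂ) + α' =
        (l.map Prod.snd : List ℂ) + (c.2 ::ₘ α') := by
      simp [← Multiset.cons_coe]
    rw [e1, e2] at h ⊢
    exact ih (nonempty_frame_Kx F (h.mono (Multiset.le_add_left _ _) (Multiset.le_add_left _ _)
      le_rfl le_rfl le_rfl le_rfl)) h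

theorem nonempty_frame_foldl_Ky (l : List (ℂ × ℂ)) :
    ∀ {S : KZSystem} {β β' : Multiset ℂ}, Nonempty (Frame S.A α α' β β' γ γ') →
      NondegenerateOn α α' (l.map Prod.fst + β) (l.map Prod.snd + β') γ γ' →
      Nonempty (Frame (l.foldl (fun S b => S.Ky b.1 b.2) S).A α α' (l.map Prod.fst + β)
        (l.map Prod.snd + β') γ γ') := by
  induction l with
  | nil =>
    intro S β β' F _
    have e1 : (([] : List (ℂ × ℂ)).map Prod.fst : List ℂ) + β = β := zero_add _
    have e2 : (([] : List (ℂ × ℂ)).map Prod.snd : List ℂ) + β' = β' := zero_add _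
    rw [e1, e2]
    exact F
  | cons c l ih =>
    intro S β β' F h
    have e1 : (((c :: l).map Prod.fst : List ℂ) : Multiset ℂ) + β =
        (l.map Prod.fst : List ℂ) + (c.1 ::ₘ β) := by
      simp [← Multiset.cons_coe]
    have e2 : (((c :: l).map Prod.snd : List ℂ) : Multiset ℂ) + β' =
        (l.map Prod.snd : List ℂ) + (c.2 ::ₘ β') := by
      simp [← Multiset.cons_coe]
    rw [e1, e2] at h ⊢
    exact ih (nonempty_frame_Ky F (h.mono le_rfl le_rfl (Multiset.le_add_left _ _)
      (Multiset.le_add_left _ _) le_rfl le_rfl)) h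

theorem nonempty_frame_foldl_Kxy (l : List (ℂ × ℂ)) :
    ∀ {S : KZSystem} {γ γ' : Multiset ℂ}, Nonempty (Frame S.A α α' β β' γ γ') →
      NondegenerateOn α α' β β' (l.map Prod.fst + γ) (l.map Prod.snd + γ') →
      Nonempty (Frame (l.foldl (fun S c => S.Kxy c.1 c.2) S).A α α' β β' (l.map Prod.fst + γ)
        (l.map Prod.snd + γ')) := by
  induction l with
  | nil =>
    intro S γ γ' F _
    have e1 : (([] : List (ℂ × ℂ)).map Prod.fst : List ℂ) + γ = γ := zero_add _
    have e2 : (([] : List (ℂ × ℂ)).map Prod.snd : List ℂ) + γ' = γ' := zero_add _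
    rw [e1, e2]
    exact F
  | cons c l ih =>
    intro S γ γ' F h
    have e1 : (((c :: l).map Prod.fst : List ℂ) : Multiset ℂ) + γ =
        (l.map Prod.fst : List ℂ) + (c.1 ::ₘ γ) := by
      simp [← Multiset.cons_coe]
    have e2 : (((c :: l).map Prod.snd : List ℂ) : Multiset ℂ) + γ' =
        (l.map Prod.snd : List ℂ) + (c.2 ::ₘ γ') := by
      simp [← Multiset.cons_coe]
    rw [e1, e2] at h ⊢
    exact ih (nonempty_frame_Kxy F (h.mono le_rfl le_rfl le_rfl le_rfl (Multiset.le_add_left _ _)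
      (Multiset.le_add_left _ _))) h

theorem ofFn_castLE_add_singleton {p : ℕ} (hp : 0 < p) (f : Fin p → ℂ) :
    ((List.ofFn fun i : Fin (p - 1) => f (i.castLE (Nat.sub_le p 1)) : List ℂ) : Multiset ℂ) +
      {f ⟨p - 1, Nat.sub_lt hp one_pos⟩} = Finset.univ.val.map f := by
  obtain ⟨n, rfl⟩ : ∃ n, p = n + 1 := ⟨p - 1, by omega⟩
  rw [Fin.univ_val_map, List.ofFn_succ', List.concat_eq_append, ← Multiset.coe_add]
  rfl

theorem nonempty_frame_kzF {p q r : ℕ} (hp : 0 < p) (hq : 0 < q)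
    (α α' : Fin p → ℂ) (β β' : Fin q → ℂ) (γ γ' : Fin r → ℂ)
    (h : Nondegenerate α α' β β' γ γ') :
    Nonempty (Frame (kzF hp hq α α' β β' γ γ').A (Finset.univ.val.map α) (Finset.univ.val.map α')
      (Finset.univ.val.map β) (Finset.univ.val.map β') (Finset.univ.val.map γ)
      (Finset.univ.val.map γ')) := by
  have hnd : NondegenerateOn (Finset.univ.val.map α) (Finset.univ.val.map α')
      (Finset.univ.val.map β) (Finset.univ.val.map β') (Finset.univ.val.map γ)
      (Finset.univ.val.map γ') := by
    constructor <;> simp only [Multiset.mem_map] <;>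
      first
      | (rintro _ ⟨i, -, rfl⟩ _ ⟨j, -, rfl⟩ _ ⟨k, -, rfl⟩
         first | exact h.αβγ' i j k | exact h.α'β'γ i j k)
      | (rintro _ ⟨i, -, rfl⟩ _ ⟨j, -, rfl⟩
         first | exact h.αα' i j | exact h.ββ' i j | exact h.γγ' i j)
  have e1 := ofFn_castLE_add_singleton hp α
  have e2 := ofFn_castLE_add_singleton hp α'
  have e3 := ofFn_castLE_add_singleton hq β
  have e4 := ofFn_castLE_add_singleton hq β'
  have e5 : ((List.ofFn γ : List ℂ) : Multiset ℂ) + 0 = Finset.univ.val.map γ := by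
    rw [add_zero, Fin.univ_val_map]
  have e6 : ((List.ofFn γ' : List ℂ) : Multiset ℂ) + 0 = Finset.univ.val.map γ' := by
    rw [add_zero, Fin.univ_val_map]
  rw [← e1, ← e2, ← e3, ← e4, ← e5, ← e6] at hnd ⊢
  have F0 : Nonempty (Frame (rankOne (α ⟨p - 1, Nat.sub_lt hp one_pos⟩)
      (α' ⟨p - 1, Nat.sub_lt hp one_pos⟩) (β ⟨q - 1, Nat.sub_lt hq one_pos⟩)
      (β' ⟨q - 1, Nat.sub_lt hq one_pos⟩)).A _ _ _ _ 0 0) :=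
    ⟨frameRankOne _ _ _ _ (h.αα' _ _) (h.ββ' _ _)⟩
  have F1 := nonempty_frame_foldl_Kxy (List.ofFn fun k : Fin r => (γ k, γ' k)) F0
    (hnd.mono (Multiset.le_add_left _ _) (Multiset.le_add_left _ _) (Multiset.le_add_left _ _)
      (Multiset.le_add_left _ _) (by simp [List.map_ofFn, Function.comp_def])
      (by simp [List.map_ofFn, Function.comp_def]))
  have F2 := nonempty_frame_foldl_Ky (List.ofFn fun j : Fin (q - 1) =>
    (β (j.castLE (Nat.sub_le q 1)), β' (j.castLE (Nat.sub_le q 1)))) F1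
    (hnd.mono (Multiset.le_add_left _ _) (Multiset.le_add_left _ _)
      (by simp [List.map_ofFn, Function.comp_def]) (by simp [List.map_ofFn, Function.comp_def])
      (by simp [List.map_ofFn, Function.comp_def]) (by simp [List.map_ofFn, Function.comp_def]))
  have F3 := nonempty_frame_foldl_Kx (List.ofFn fun i : Fin (p - 1) =>
    (α (i.castLE (Nat.sub_le p 1)), α' (i.castLE (Nat.sub_le p 1)))) F2
    (hnd.mono (by simp [List.map_ofFn, Function.comp_def])
      (by simp [List.map_ofFn, Function.comp_def])
      (by simp [List.map_ofFn, Function.comp_def]) (by simp [List.map_ofFn, Function.comp_def])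
      (by simp [List.map_ofFn, Function.comp_def]) (by simp [List.map_ofFn, Function.comp_def]))
  simp only [List.map_ofFn, Function.comp_def] at F3
  exact F3

end KZSystem

/-! ### The singular residues and their partners -/

namespace Multiset

theorem crossMap_const_left {ι κ σ : Type} (g : κ → σ) (s : Multiset ι) (t : Multiset κ) :
    crossMap (fun _ b => g b) s t = card s • t.map g := by
  rw [crossMap, bind, map_const', join, sum_replicate]

theorem crossMap_const_right {ι κ σ : Type} (g : ι → σ) (s : Multiset ι) (t : Multiset κ) :
    crossMap (fun a _ => g a) s t = card t • s.map g := by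
  rw [crossMap_swap, crossMap_const_left]

end Multiset

section

variable {V : Type} [AddCommGroup V] [Module ℂ V]

/-- An operator `M` commuting with a presented residue `A`: the pair has
the eigenvalues of `M` on the image of `A`, paired with the scalar, and the eigenvalues of `M` on
the cokernel, paired with zero. -/
theorem Leg.Presents.hasSimultaneousGenEigenvalues [FiniteDimensional ℂ V] {L : Leg V}
    {A C C' M : End ℂ V} {κ c : ℂ} {s s' u t : Multiset ℂ} (h : L.Presents A C C' κ c s s')
    {m : End ℂ L.X} (hm : ∀ x, L.ι (m x) = M (L.ι x)) (hc : Commute A M)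
    (hu : HasGenEigenvalues m u) (hM : HasGenEigenvalues M (u + t)) :
    HasSimultaneousGenEigenvalues A M (u.map (fun z => (-κ, z)) + t.map fun z => (0, z)) := by
  have hinv : LinearMap.range L.ι ≤ (LinearMap.range L.ι).comap M := by
    rintro _ ⟨x, rfl⟩
    exact ⟨m x, hm x⟩
  have hex : ∀ v, (LinearMap.range L.ι).mkQ v = 0 ↔ ∃ x, L.ι x = v := fun v => by
    rw [Submodule.mkQ_apply, Submodule.Quotient.mk_eq_zero, LinearMap.mem_range]
  have hW := hu.of_add_of_exact hM (AW := (LinearMap.range L.ι).mapQ _ M hinv) h.inj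
    (Submodule.mkQ_surjective _) hex hm (fun _ => rfl)
  have h1 := hu.pair_smul_one_add (-κ) 0
  have h2 := hW.pair_smul_one_add 0 0
  simp only [zero_smul, add_zero] at h1 h2
  refine h1.of_exact h2 hc h.inj (Submodule.mkQ_surjective _) hex (fun x => ?_) hm (fun v => ?_)
    (fun _ => rfl)
  · rw [h.fac, h.π_ι]
    rfl
  · exact (hex _).mpr ⟨L.π v, (h.fac v).symm⟩

theorem Leg.Presents.apply_apply {L : Leg V} {A C C' : End ℂ V} {κ c : ℂ}
    {s s' : Multiset ℂ} (h : L.Presents A C C' κ c s s') (v : V) : A (A v) = (-κ) • A v := by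
  rw [h.fac, h.fac v, h.π_ι, map_smul]

/-- The pair of a singular residue `A` and a nonsingular partner `C`, one copy of whose eigenvalues
`s` belongs to the image of `A`. -/
theorem Leg.Presents.pair_partner [FiniteDimensional ℂ V] {L : Leg V} {A C C' : End ℂ V} {κ c : ℂ}
    {s s' t : Multiset ℂ} {n : ℕ} (h : L.Presents A C C' κ c s s') (hc : Commute A C) (hn : 0 < n)
    (hC : HasGenEigenvalues C (t + n • s)) :
    HasSimultaneousGenEigenvalues A C (t.map (fun z => (0, z)) +
      (n - 1) • s.map (fun z => (0, z)) + s.map fun z => (-κ, z)) := by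
  obtain ⟨n, rfl⟩ : ∃ k, n = k + 1 := ⟨n - 1, by omega⟩
  refine (h.hasSimultaneousGenEigenvalues h.ι_B hc h.specB (t := t + n • s) ?_).of_eq ?_
  · rwa [add_left_comm, ← succ_nsmul']
  · rw [Multiset.map_add, Multiset.map_nsmul, Nat.add_sub_cancel]; abel

/-- The operator `M` is on the image of `A` a scalar plus an operator of rank at most one. -/
theorem Leg.Presents.pair_rank_one [FiniteDimensional ℂ V] {L : Leg V} {A C C' M : End ℂ V}
    {κ c : ℂ} {s s' t : Multiset ℂ} (h : L.Presents A C C' κ c s s') (hc : Commute A M)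
    (hm : ∀ x, M (L.ι x) = (-κ) • L.ι x - L.φ x • L.ι L.u) (hs : 0 < s.card)
    (hM : HasGenEigenvalues M ((s.card - 1) • {-κ} + {-κ - c} + t)) :
    HasSimultaneousGenEigenvalues A M
      ((s.card - 1) • {(-κ, -κ)} + {(-κ, -κ - c)} + t.map fun z => (0, z)) := by
  obtain ⟨u, hu, hus⟩ := hasGenEigenvalues_smul_one_sub_smulRight (-κ) L.φ L.u
  have e : u = (s.card - 1) • {-κ} + {-κ - c} := by
    rw [h.card_eq, h.φ_u, show s.card = s.card - 1 + 1 by omega, Multiset.replicate_add,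
      Multiset.replicate_one, ← Multiset.nsmul_singleton, add_right_comm] at hus
    exact add_right_cancel hus
  subst e
  refine (h.hasSimultaneousGenEigenvalues (fun x => ?_) hc hu hM).of_eq ?_
  · rw [hm, LinearMap.sub_apply, map_sub, LinearMap.smulRight_apply, map_smul,
      LinearMap.smul_apply, End.one_apply, map_smul]
  · rw [Multiset.map_add, Multiset.map_nsmul, Multiset.map_singleton, Multiset.map_singleton]

end

theorem HasGenEigenvalues.of_eq {V : Type} [AddCommGroup V] [Module ℂ V] {A : End ℂ V}
    {s t : Multiset ℂ} (h : HasGenEigenvalues A s) (hst : s = t) : HasGenEigenvalues A t := hst ▸ h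

namespace Frame

variable {S : KZSystem} {α α' β β' γ γ' : Multiset ℂ}

theorem hasGenEigenvalues_A23 (F : Frame S.A α α' β β' γ γ') : HasGenEigenvalues (S.A 2 3)
    (Multiset.crossMap (fun i j => i + j) α β + (α.card + β.card) • γ) := by
  refine (F.spec0423.right (S.comm 0 4 2 3 (by decide) (by decide) (by decide)
    (by decide))).of_eq ?_
  simp only [Multiset.map_add, Multiset.map_crossMap, Multiset.crossMap_const_left,
    Multiset.map_id', F.card_eq.2.1]
  rw [add_smul, add_assoc]

theorem hasGenEigenvalues_A24 (F : Frame S.A α α' β β' γ γ') : HasGenEigenvalues (S.A 2 4)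
    (Multiset.crossMap (fun i j => i + j) α' β' + (α.card + β.card) • γ') := by
  refine (F.spec0324.right (S.comm 0 3 2 4 (by decide) (by decide) (by decide)
    (by decide))).of_eq ?_
  simp only [Multiset.map_add, Multiset.map_crossMap, Multiset.crossMap_const_left,
    Multiset.map_id', F.card_eq.1]
  rw [add_smul, add_assoc]

theorem hasGenEigenvalues_A13 (F : Frame S.A α α' β β' γ γ') : HasGenEigenvalues (S.A 1 3)
    (Multiset.crossMap (fun i k => i + k) α γ' + (α.card + γ.card) • β') := by
  refine (F.spec0413.right (S.comm 0 4 1 3 (by decide) (by decide) (by decide)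
    (by decide))).of_eq ?_
  simp only [Multiset.map_add, Multiset.map_crossMap, Multiset.crossMap_const_left,
    Multiset.crossMap_const_right, Multiset.map_id']
  rw [add_smul]
  abel

theorem hasGenEigenvalues_A14 (F : Frame S.A α α' β β' γ γ') : HasGenEigenvalues (S.A 1 4)
    (Multiset.crossMap (fun i k => i + k) α' γ + (α.card + γ.card) • β) := by
  refine (F.spec0314.right (S.comm 0 3 1 4 (by decide) (by decide) (by decide)
    (by decide))).of_eq ?_
  simp only [Multiset.map_add, Multiset.map_crossMap, Multiset.crossMap_const_left,
    Multiset.crossMap_const_right, Multiset.map_id', F.card_eq.1, F.card_eq.2.2]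
  rw [add_smul]
  abel

theorem hasGenEigenvalues_A03 (F : Frame S.A α α' β β' γ γ') : HasGenEigenvalues (S.A 0 3)
    (Multiset.crossMap (fun j k => j + k) β γ' + (β.card + γ.card) • α') := by
  refine (F.spec0314.left (S.comm 0 3 1 4 (by decide) (by decide) (by decide)
    (by decide))).of_eq ?_
  simp only [Multiset.map_add, Multiset.map_crossMap, Multiset.crossMap_const_right,
    Multiset.map_id']
  rw [add_smul]
  abel

theorem hasGenEigenvalues_A04 (F : Frame S.A α α' β β' γ γ') : HasGenEigenvalues (S.A 0 4)
    (Multiset.crossMap (fun j k => j + k) β' γ + (β.card + γ.card) • α) := by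
  refine (F.spec0413.left (S.comm 0 4 1 3 (by decide) (by decide) (by decide)
    (by decide))).of_eq ?_
  simp only [Multiset.map_add, Multiset.map_crossMap, Multiset.crossMap_const_right,
    Multiset.map_id', F.card_eq.2.1, F.card_eq.2.2]
  rw [add_smul]
  abel

/-- The eigenvalues of `A₃₄`, in which the multiplicity of zero is a difference. -/
theorem hasGenEigenvalues_A34 (F : Frame S.A α α' β β' γ γ') (hα : 0 < α.card) (hβ : 0 < β.card)
    (hγ : 0 < γ.card) : HasGenEigenvalues (S.A 3 4)
    ((α.card * β.card + β.card * γ.card + γ.card * α.card - (α.card + β.card + γ.card) + 1) • {0} +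
      2 • {-((α.sum + α'.sum) + (β.sum + β'.sum) + (γ.sum + γ'.sum))} +
      (α.card - 1) • {-((β.sum + β'.sum) + (γ.sum + γ'.sum))} +
      (β.card - 1) • {-((α.sum + α'.sum) + (γ.sum + γ'.sum))} +
      (γ.card - 1) • {-((α.sum + α'.sum) + (β.sum + β'.sum))}) := by
  refine F.spec34.of_eq ?_
  have h := F.s34_eq
  have hle : α.card + β.card + γ.card ≤
      α.card * β.card + β.card * γ.card + γ.card * α.card := by nlinarith
  obtain ⟨m, hm⟩ := Nat.exists_eq_add_of_le hle
  obtain ⟨p, hp⟩ : ∃ p, α.card = p + 1 := ⟨α.card - 1, by omega⟩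
  obtain ⟨q, hq⟩ : ∃ q, β.card = q + 1 := ⟨β.card - 1, by omega⟩
  obtain ⟨r, hr⟩ : ∃ r, γ.card = r + 1 := ⟨γ.card - 1, by omega⟩
  rw [hm, Nat.add_sub_cancel_left]
  rw [hm] at h
  generalize α.card + β.card + γ.card = N at h
  rw [hp, hq, hr] at h ⊢
  simp only [Nat.add_sub_cancel]
  simp only [← Multiset.nsmul_singleton, add_smul, one_smul] at h ⊢
  rw [add_assoc, add_assoc, add_assoc] at h
  refine add_right_cancel (h.trans ?_)
  abel

theorem A34_ι_X (F : Frame S.A α α' β β' γ γ') (x : F.X.X) : S.A 3 4 (F.X.ι x) =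
    (-((α.sum + α'.sum) + (β.sum + β'.sum))) • F.X.ι x - F.X.φ x • F.X.ι F.X.u := by
  rw [S.A34_eq, LinearMap.add_apply, LinearMap.add_apply, F.isX.fac, F.isY.fac, F.isZ.fac,
    F.isX.π_ι, F.crossYX, F.crossZX, map_smul, map_smul, map_smul]
  linear_combination (norm := module) F.X.φ x • F.sum_u

theorem A34_ι_Y (F : Frame S.A α α' β β' γ γ') (x : F.Y.X) : S.A 3 4 (F.Y.ι x) =
    (-((α.sum + α'.sum) + (γ.sum + γ'.sum))) • F.Y.ι x - F.Y.φ x • F.Y.ι F.Y.u := by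
  rw [S.A34_eq, LinearMap.add_apply, LinearMap.add_apply, F.isX.fac, F.isY.fac, F.isZ.fac,
    F.isY.π_ι, F.crossXY, F.crossZY, map_smul, map_smul, map_smul]
  linear_combination (norm := module) F.Y.φ x • F.sum_u

theorem A34_ι_Z (F : Frame S.A α α' β β' γ γ') (x : F.Z.X) : S.A 3 4 (F.Z.ι x) =
    (-((β.sum + β'.sum) + (γ.sum + γ'.sum))) • F.Z.ι x - F.Z.φ x • F.Z.ι F.Z.u := by
  rw [S.A34_eq, LinearMap.add_apply, LinearMap.add_apply, F.isX.fac, F.isY.fac, F.isZ.fac,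
    F.isZ.π_ι, F.crossXZ, F.crossYZ, map_smul, map_smul, map_smul]
  linear_combination (norm := module) F.Z.φ x • F.sum_u

theorem spec0134 (F : Frame S.A α α' β β' γ γ') (hα : 0 < α.card) (hβ : 0 < β.card)
    (hγ : 0 < γ.card) {a b c : ℂ} (ha : α.sum + α'.sum = a) (hb : β.sum + β'.sum = b)
    (hc : γ.sum + γ'.sum = c) : HasSimultaneousGenEigenvalues (S.A 0 1) (S.A 3 4)
    ((α.card * β.card + β.card * γ.card + γ.card * α.card - (α.card + β.card + γ.card) + 1) •
        {(0, 0)} + {(0, -a - b - c)} + {(-a - b, -a - b - c)} + (α.card - 1) • {(0, -b - c)} +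
      (β.card - 1) • {(0, -a - c)} + (γ.card - 1) • {(-a - b, -a - b)}) := by
  have h := F.hasGenEigenvalues_A34 hα hβ hγ
  have hL := F.isX
  have hι := F.A34_ι_X
  rw [ha, hb] at hL hι
  rw [ha, hb, hc] at h
  rw [hc] at hL
  generalize α.card * β.card + β.card * γ.card + γ.card * α.card -
    (α.card + β.card + γ.card) + 1 = n at h ⊢
  refine (hL.pair_rank_one (S.comm 0 1 3 4 (by decide) (by decide) (by decide) (by decide)) hι hγ
    (t := n • {0} + {-(a + b + c)} + (α.card - 1) • {-(b + c)} + (β.card - 1) • {-(a + c)})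
    (h.of_eq ?_)).of_eq ?_
  · rw [show -(a + b) - c = -(a + b + c) by ring, two_nsmul]
    abel
  · simp only [Multiset.map_add, Multiset.map_nsmul, Multiset.map_singleton]
    rw [show -(a + b) - c = -a - b - c by ring, show -(a + b + c) = -a - b - c by ring,
      show -(a + b) = -a - b by ring, show -(a + c) = -a - c by ring,
      show -(b + c) = -b - c by ring]
    abel

theorem spec0234 (F : Frame S.A α α' β β' γ γ') (hα : 0 < α.card) (hβ : 0 < β.card)
    (hγ : 0 < γ.card) {a b c : ℂ} (ha : α.sum + α'.sum = a) (hb : β.sum + β'.sum = b)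
    (hc : γ.sum + γ'.sum = c) : HasSimultaneousGenEigenvalues (S.A 0 2) (S.A 3 4)
    ((α.card * β.card + β.card * γ.card + γ.card * α.card - (α.card + β.card + γ.card) + 1) •
        {(0, 0)} + {(-a - c, -a - b - c)} + {(0, -a - b - c)} + (α.card - 1) • {(0, -b - c)} +
      (β.card - 1) • {(-a - c, -a - c)} + (γ.card - 1) • {(0, -a - b)}) := by
  have h := F.hasGenEigenvalues_A34 hα hβ hγ
  have hL := F.isY
  have hι := F.A34_ι_Y
  rw [ha, hc] at hL hι
  rw [ha, hb, hc] at h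
  rw [hb] at hL
  have hβ' := F.card_eq.2.1
  rw [← hβ'] at hβ
  generalize α.card * β.card + β.card * γ.card + γ.card * α.card -
    (α.card + β.card + γ.card) + 1 = n at h ⊢
  refine (hL.pair_rank_one (S.comm 0 2 3 4 (by decide) (by decide) (by decide) (by decide)) hι hβ
    (t := n • {0} + {-(a + b + c)} + (α.card - 1) • {-(b + c)} + (γ.card - 1) • {-(a + b)})
    (h.of_eq ?_)).of_eq ?_
  · rw [show -(a + c) - b = -(a + b + c) by ring, two_nsmul, hβ']
    abel
  · simp only [Multiset.map_add, Multiset.map_nsmul, Multiset.map_singleton, hβ']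
    rw [show -(a + c) - b = -a - b - c by ring, show -(a + b + c) = -a - b - c by ring,
      show -(a + b) = -a - b by ring, show -(a + c) = -a - c by ring,
      show -(b + c) = -b - c by ring]
    abel

theorem spec1234 (F : Frame S.A α α' β β' γ γ') (hα : 0 < α.card) (hβ : 0 < β.card)
    (hγ : 0 < γ.card) {a b c : ℂ} (ha : α.sum + α'.sum = a) (hb : β.sum + β'.sum = b)
    (hc : γ.sum + γ'.sum = c) : HasSimultaneousGenEigenvalues (S.A 1 2) (S.A 3 4)
    ((α.card * β.card + β.card * γ.card + γ.card * α.card - (α.card + β.card + γ.card) + 1) •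
        {(0, 0)} + {(-b - c, -a - b - c)} + {(0, -a - b - c)} +
      (α.card - 1) • {(-b - c, -b - c)} + (β.card - 1) • {(0, -a - c)} +
      (γ.card - 1) • {(0, -a - b)}) := by
  have h := F.hasGenEigenvalues_A34 hα hβ hγ
  have hL := F.isZ
  have hι := F.A34_ι_Z
  rw [hb, hc] at hL hι
  rw [ha, hb, hc] at h
  rw [ha] at hL
  have hα' := F.card_eq.1
  rw [← hα'] at hα
  generalize α.card * β.card + β.card * γ.card + γ.card * α.card -
    (α.card + β.card + γ.card) + 1 = n at h ⊢
  refine (hL.pair_rank_one (S.comm 1 2 3 4 (by decide) (by decide) (by decide) (by decide)) hι hα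
    (t := n • {0} + {-(a + b + c)} + (β.card - 1) • {-(a + c)} + (γ.card - 1) • {-(a + b)})
    (h.of_eq ?_)).of_eq ?_
  · rw [show -(b + c) - a = -(a + b + c) by ring, two_nsmul, hα']
    abel
  · simp only [Multiset.map_add, Multiset.map_nsmul, Multiset.map_singleton, hα']
    rw [show -(b + c) - a = -a - b - c by ring, show -(a + b + c) = -a - b - c by ring,
      show -(a + b) = -a - b by ring, show -(a + c) = -a - c by ring,
      show -(b + c) = -b - c by ring]
    abel

end Frame

/-! ### Semisimplicity -/

section

open Multiset

theorem Multiset.nodup_crossMap {ι κ σ : Type} {f : ι → κ → σ} {s : Multiset ι} {t : Multiset κ}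
    (hs : s.Nodup) (ht : t.Nodup) (hf : ∀ a b a' b', f a b = f a' b' → a = a' ∧ b = b') :
    (crossMap f s t).Nodup := by
  have h : crossMap f s t = (s ×ˢ t).map fun z => f z.1 z.2 := by
    simp [crossMap, SProd.sprod, Multiset.product, map_bind]
  rw [h]
  exact (hs.product ht).map fun z w hzw => Prod.ext (hf _ _ _ _ hzw).1 (hf _ _ _ _ hzw).2

/-- The common shape of the lists of eigenvalues of the pairs of nonsingular residues. -/
theorem nodup_crossMap_add_add {P Q K K' : Multiset ℂ} (hP : P.Nodup) (hQ : Q.Nodup)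
    (hK : K.Nodup) (hK' : K'.Nodup) (h1 : ∀ i ∈ P, ∀ j ∈ Q, ∀ k ∈ K', i ≠ j + k)
    (h2 : ∀ i ∈ P, ∀ j ∈ Q, ∀ k ∈ K, j ≠ i + k) :
    (crossMap (fun i j => (i, j)) P Q + crossMap (fun j k => (j + k, j)) Q K' +
      crossMap (fun i k => (i, i + k)) P K).Nodup := by
  have n1 : (crossMap (fun i j : ℂ => (i, j)) P Q).Nodup :=
    nodup_crossMap hP hQ fun a b a' b' h => Prod.mk.inj h
  have n2 : (crossMap (fun j k : ℂ => (j + k, j)) Q K').Nodup :=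
    nodup_crossMap hQ hK' fun a b a' b' h => by
      obtain ⟨e1, e2⟩ := Prod.mk.inj h
      subst e2
      exact ⟨rfl, add_left_cancel e1⟩
  have n3 : (crossMap (fun i k : ℂ => (i, i + k)) P K).Nodup :=
    nodup_crossMap hP hK fun a b a' b' h => by
      obtain ⟨e1, e2⟩ := Prod.mk.inj h
      subst e1
      exact ⟨rfl, add_left_cancel e2⟩
  have d12 : Disjoint (crossMap (fun i j : ℂ => (i, j)) P Q)
      (crossMap (fun j k => (j + k, j)) Q K') := by
    rw [disjoint_left]
    rintro z hz hz'
    obtain ⟨i, hi, j, hj, rfl⟩ := (mem_crossMap _).mp hz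
    obtain ⟨j', hj', k, hk, e⟩ := (mem_crossMap _).mp hz'
    obtain ⟨e1, rfl⟩ := Prod.mk.inj e
    exact h1 i hi _ hj k hk e1.symm
  have d3 : Disjoint (crossMap (fun i j : ℂ => (i, j)) P Q +
      crossMap (fun j k => (j + k, j)) Q K') (crossMap (fun i k => (i, i + k)) P K) := by
    rw [disjoint_left]
    rintro z hz hz'
    obtain ⟨i, hi, k, hk, rfl⟩ := (mem_crossMap _).mp hz'
    rcases mem_add.mp hz with hz | hz
    · obtain ⟨i', hi', j, hj, e⟩ := (mem_crossMap _).mp hz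
      obtain ⟨rfl, e2⟩ := Prod.mk.inj e
      exact h2 _ hi j hj k hk e2
    · obtain ⟨j, hj, k', hk', e⟩ := (mem_crossMap _).mp hz
      exact h1 i hi j hj k' hk' (Prod.mk.inj e).1.symm
  exact nodup_add.mpr ⟨nodup_add.mpr ⟨n1, n2, d12⟩, n3, d3⟩

end

namespace Frame

variable {S : KZSystem} {α α' β β' γ γ' : Multiset ℂ}

/-- On the generalized eigenspace of `A₃₄` for zero all three singular residues vanish; on the one
for `-a - b - c` the residue `A₀₁` has simple spectrum; on each of the others, the images of the
three singular residues add up to the dimension. -/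
theorem isDiagonal_A34 (F : Frame S.A α α' β β' γ γ') (hα : 0 < α.card) (hβ : 0 < β.card)
    (hγ : 0 < γ.card) {a b c : ℂ} (ha : α.sum + α'.sum = a) (hb : β.sum + β'.sum = b)
    (hc : γ.sum + γ'.sum = c) (ha0 : a ≠ 0) (hb0 : b ≠ 0) (hc0 : c ≠ 0) (hab : a + b ≠ 0)
    (hac : a + c ≠ 0) (hbc : b + c ≠ 0) (habc : a + b + c ≠ 0) : IsDiagonal (S.A 3 4) := by
  have c01 : Commute (S.A 0 1) (S.A 3 4) :=
    S.comm 0 1 3 4 (by decide) (by decide) (by decide) (by decide)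
  have c02 : Commute (S.A 0 2) (S.A 3 4) :=
    S.comm 0 2 3 4 (by decide) (by decide) (by decide) (by decide)
  have c12 : Commute (S.A 1 2) (S.A 3 4) :=
    S.comm 1 2 3 4 (by decide) (by decide) (by decide) (by decide)
  have p01 := F.isX.apply_apply
  have p02 := F.isY.apply_apply
  have p12 := F.isZ.apply_apply
  rw [ha, hb] at p01
  rw [ha, hc] at p02
  rw [hb, hc] at p12
  rw [neg_add'] at p01 p02 p12
  have mab : -a - b ≠ 0 := by rw [← neg_add']; exact neg_ne_zero.mpr hab
  have mac : -a - c ≠ 0 := by rw [← neg_add']; exact neg_ne_zero.mpr hac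
  have mbc : -b - c ≠ 0 := by rw [← neg_add']; exact neg_ne_zero.mpr hbc
  have mabc : -a - b - c ≠ 0 := by
    rw [← neg_add', ← neg_add']; exact neg_ne_zero.mpr habc
  have nc : -a - b - c ≠ -a - b := fun h => hc0 (by linear_combination -h)
  have nb : -a - b - c ≠ -a - c := fun h => hb0 (by linear_combination -h)
  have na : -a - b - c ≠ -b - c := fun h => ha0 (by linear_combination -h)
  have s01 := F.spec0134 hα hβ hγ ha hb hc
  have s02 := F.spec0234 hα hβ hγ ha hb hc
  have s12 := F.spec1234 hα hβ hγ ha hb hc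
  have e01 := isDiagonal_of_apply_apply mab p01
  have e02 := isDiagonal_of_apply_apply mac p02
  have e12 := isDiagonal_of_apply_apply mbc p12
  intro ν
  have g01 := s01 (-a - b) ν
  have g02 := s02 (-a - c) ν
  have g12 := s12 (-b - c) ν
  rw [e01] at g01
  rw [e02] at g02
  rw [e12] at g12
  by_cases h0 : ν = 0
  · subst h0
    refine le_antisymm (fun v hv => ?_) End.eigenspace_le_maxGenEigenspace
    have vanish : ∀ {A : End ℂ S.V} {κ : ℂ}, Commute A (S.A 3 4) → (∀ v, A (A v) = κ • A v) →
        finrank ℂ ↥(A.eigenspace κ ⊓ (S.A 3 4).maxGenEigenspace 0) = 0 → A v = 0 := by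
      intro A κ hA hp hd
      rw [Submodule.finrank_eq_zero] at hd
      have : A v ∈ A.eigenspace κ ⊓ (S.A 3 4).maxGenEigenspace 0 :=
        ⟨End.mem_eigenspace_iff.mpr (hp v), End.mapsTo_maxGenEigenspace_of_comm hA.symm 0 hv⟩
      rwa [hd, Submodule.mem_bot] at this
    rw [End.mem_eigenspace_iff, zero_smul, S.A34_eq, LinearMap.add_apply, LinearMap.add_apply,
      vanish c01 p01 ?_, vanish c02 p02 ?_, vanish c12 p12 ?_, add_zero, add_zero]
    · rw [g12]
      simp [Ne.symm mbc, Ne.symm mabc, mbc]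
    · rw [g02]
      simp [Ne.symm mac, Ne.symm mabc, mac]
    · rw [g01]
      simp [Ne.symm mab, Ne.symm mabc, mab]
  by_cases h1 : ν = -a - b - c
  · subst h1
    refine maxGenEigenspace_eq_eigenspace_of_finrank_inf_le_one c01 fun μ => ?_
    rw [s01]
    by_cases hμ : μ = 0
    · subst hμ
      simp [mabc, na, nb, nc, Ne.symm mab]
    · simp only [Multiset.count_add, Multiset.count_nsmul, Multiset.count_singleton,
        Prod.mk.injEq, hμ, nc, and_false, false_and, if_false, mul_zero, zero_add, add_zero]
      split_ifs <;> simp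
  · refine maxGenEigenspace_eq_eigenspace_of_finrank_sum_le S.A34_eq h0 p01 p02 p12 c01 c02 c12 ?_
    rw [g01, g02, g12, F.hasGenEigenvalues_A34 hα hβ hγ, ha, hb, hc]
    simp only [Multiset.count_add, Multiset.count_nsmul, Multiset.count_singleton,
        Prod.mk.injEq, h0, h1, mab, mac, mbc, and_false, false_and, if_false, mul_zero, zero_add,
        add_zero, neg_add', true_and, and_self]
    omega

end Frame

/-! ### The table -/

theorem map_map_univ_eq_sum {p : ℕ} {σ : Type} (f : ℂ → σ) (α : Fin p → ℂ) :
    (Finset.univ.val.map α).map f = ∑ i, {f (α i)} := by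
  rw [Multiset.map_map, ← Multiset.sum_map_singleton (Multiset.map (f ∘ α) _), Multiset.map_map]
  rfl

theorem crossMap_map_univ_eq_sum {p q : ℕ} {σ : Type} (f : ℂ → ℂ → σ) (α : Fin p → ℂ)
    (β : Fin q → ℂ) : Multiset.crossMap f (Finset.univ.val.map α) (Finset.univ.val.map β) =
      ∑ i, ∑ j, {f (α i) (β j)} := by
  simp only [← map_map_univ_eq_sum (f (α _))]
  rw [Multiset.crossMap, Multiset.bind_map]
  rfl

theorem sum_map_univ_add {p : ℕ} (f g : Fin p → ℂ) :
    (Finset.univ.val.map f).sum + (Finset.univ.val.map g).sum = ∑ i, (f i + g i) :=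
  Finset.sum_add_distrib.symm

/-- Every entry of the table is read off from a frame. -/
theorem hasSimultaneousGenEigenvalues_tableF {S : KZSystem} {p q r : ℕ} (hp : 0 < p) (hq : 0 < q)
    (hr : 0 < r) {α α' : Fin p → ℂ} {β β' : Fin q → ℂ} {γ γ' : Fin r → ℂ}
    (F : Frame S.A (Finset.univ.val.map α) (Finset.univ.val.map α')
      (Finset.univ.val.map β) (Finset.univ.val.map β') (Finset.univ.val.map γ)
      (Finset.univ.val.map γ')) {i j k l : Fin 5} {s : Multiset (ℂ × ℂ)}
    (h : (i, j, k, l, s) ∈ tableF α α' β β' γ γ') :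
    HasSimultaneousGenEigenvalues (S.A i j) (S.A k l) s := by
  have cα : (Finset.univ.val.map α).card = p := by simp
  have cβ : (Finset.univ.val.map β).card = q := by simp
  have cγ : (Finset.univ.val.map γ).card = r := by simp
  have hX := F.isX
  have hY := F.isY
  have hZ := F.isZ
  have c34 := F.spec0134 (hp.trans_eq cα.symm) (hq.trans_eq cβ.symm) (hr.trans_eq cγ.symm)
    (sum_map_univ_add α α') (sum_map_univ_add β β') (sum_map_univ_add γ γ')
  have d34 := F.spec0234 (hp.trans_eq cα.symm) (hq.trans_eq cβ.symm) (hr.trans_eq cγ.symm)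
    (sum_map_univ_add α α') (sum_map_univ_add β β') (sum_map_univ_add γ γ')
  have e34 := F.spec1234 (hp.trans_eq cα.symm) (hq.trans_eq cβ.symm) (hr.trans_eq cγ.symm)
    (sum_map_univ_add α α') (sum_map_univ_add β β') (sum_map_univ_add γ γ')
  have h03 := F.hasGenEigenvalues_A03
  have h04 := F.hasGenEigenvalues_A04
  have h13 := F.hasGenEigenvalues_A13
  have h14 := F.hasGenEigenvalues_A14
  have h23 := F.hasGenEigenvalues_A23
  have h24 := F.hasGenEigenvalues_A24
  simp only [sum_map_univ_add] at hX hY hZ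
  simp only [cα, cβ, cγ] at c34 d34 e34 h03 h04 h13 h14 h23 h24
  have t23 := hX.pair_partner (S.comm 0 1 2 3 (by decide) (by decide) (by decide) (by decide))
    (by omega) h23
  have t24 := hX.flip.pair_partner (S.comm 0 1 2 4 (by decide) (by decide) (by decide)
    (by decide)) (by omega) h24
  have t13 := hY.pair_partner (S.comm 0 2 1 3 (by decide) (by decide) (by decide) (by decide))
    (by omega) h13
  have t14 := hY.flip.pair_partner (S.comm 0 2 1 4 (by decide) (by decide) (by decide)
    (by decide)) (by omega) h14
  have t03 := hZ.pair_partner (S.comm 1 2 0 3 (by decide) (by decide) (by decide) (by decide))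
    (by omega) h03
  have t04 := hZ.flip.pair_partner (S.comm 1 2 0 4 (by decide) (by decide) (by decide)
    (by decide)) (by omega) h04
  have u03 := t03.symm
  have u04 := t04.symm
  have v0314 := F.spec0314
  have v0324 := F.spec0324
  have v0413 := F.spec0413
  have v0423 := F.spec0423
  have v1324 := F.spec1324
  have v1423 := F.spec1423
  simp only [Multiset.map_add, Multiset.map_nsmul, Multiset.map_crossMap, Prod.swap_prod_mk,
    neg_add'] at t23 t24 t13 t14 u03 u04
  have sw : ∀ (f : ℂ → ℂ × ℂ) (s : Multiset ℂ),
    (s.map f).map Prod.swap = s.map fun z => (f z).swap := fun f s => Multiset.map_map _ _ _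
  simp only [sw] at u03 u04
  simp only [crossMap_map_univ_eq_sum, map_map_univ_eq_sum,
    Prod.swap_prod_mk] at t23 t24 t13 t14 u03 u04 v0314 v0324 v0413 v0423 v1324 v1423
  have rot : ∀ x y z : Multiset (ℂ × ℂ), x + y + z = z + y + x := fun x y z => by abel
  simp only [tableF, List.mem_cons, Prod.mk.injEq, List.not_mem_nil, or_false] at h
  rcases h with ⟨rfl, rfl, rfl, rfl, rfl⟩ | ⟨rfl, rfl, rfl, rfl, rfl⟩ | ⟨rfl, rfl, rfl, rfl, rfl⟩ |
    ⟨rfl, rfl, rfl, rfl, rfl⟩ | ⟨rfl, rfl, rfl, rfl, rfl⟩ | ⟨rfl, rfl, rfl, rfl, rfl⟩ |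
    ⟨rfl, rfl, rfl, rfl, rfl⟩ | ⟨rfl, rfl, rfl, rfl, rfl⟩ | ⟨rfl, rfl, rfl, rfl, rfl⟩ |
    ⟨rfl, rfl, rfl, rfl, rfl⟩ | ⟨rfl, rfl, rfl, rfl, rfl⟩ | ⟨rfl, rfl, rfl, rfl, rfl⟩ |
    ⟨rfl, rfl, rfl, rfl, rfl⟩ | ⟨rfl, rfl, rfl, rfl, rfl⟩ | ⟨rfl, rfl, rfl, rfl, rfl⟩
  · exact t23
  · exact t24
  · exact c34
  · exact t13.of_eq (rot _ _ _)
  · exact t14.of_eq (rot _ _ _)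
  · exact d34
  · exact u03.of_eq (rot _ _ _)
  · exact v0314
  · exact v0324
  · exact u04.of_eq (rot _ _ _)
  · exact v0413
  · exact v0423
  · exact e34
  · exact v1324
  · exact v1423

/-- The semisimplicity of all residues that occur in the table. -/
theorem isDiagonal_of_mem_tableF {S : KZSystem} {p q r : ℕ} (hp : 0 < p) (hq : 0 < q)
    (hr : 0 < r) {α α' : Fin p → ℂ} {β β' : Fin q → ℂ} {γ γ' : Fin r → ℂ}
    (F : Frame S.A (Finset.univ.val.map α) (Finset.univ.val.map α')
      (Finset.univ.val.map β) (Finset.univ.val.map β') (Finset.univ.val.map γ)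
      (Finset.univ.val.map γ')) (hn : NoCoincidence α α' β β' γ γ') {i j k l : Fin 5}
    {s : Multiset (ℂ × ℂ)} (h : (i, j, k, l, s) ∈ tableF α α' β β' γ γ') :
    IsDiagonal (S.A i j) ∧ IsDiagonal (S.A k l) := by
  have cα : (Finset.univ.val.map α).card = p := by simp
  have cβ : (Finset.univ.val.map β).card = q := by simp
  have cγ : (Finset.univ.val.map γ).card = r := by simp
  have nα := Finset.univ.nodup.map hn.α_inj
  have nα' := Finset.univ.nodup.map hn.α'_inj
  have nβ := Finset.univ.nodup.map hn.β_inj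
  have nβ' := Finset.univ.nodup.map hn.β'_inj
  have nγ := Finset.univ.nodup.map hn.γ_inj
  have nγ' := Finset.univ.nodup.map hn.γ'_inj
  have d34 : IsDiagonal (S.A 3 4) := F.isDiagonal_A34 (hp.trans_eq cα.symm)
    (hq.trans_eq cβ.symm) (hr.trans_eq cγ.symm) (sum_map_univ_add α α') (sum_map_univ_add β β')
    (sum_map_univ_add γ γ') hn.a_ne hn.b_ne hn.c_ne hn.ab_ne hn.ac_ne hn.bc_ne hn.abc_ne
  have d01 := isDiagonal_of_apply_apply (neg_ne_zero.mpr (by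
    rw [sum_map_univ_add, sum_map_univ_add]; exact hn.ab_ne)) F.isX.apply_apply
  have d02 := isDiagonal_of_apply_apply (neg_ne_zero.mpr (by
    rw [sum_map_univ_add, sum_map_univ_add]; exact hn.ac_ne)) F.isY.apply_apply
  have d12 := isDiagonal_of_apply_apply (neg_ne_zero.mpr (by
    rw [sum_map_univ_add, sum_map_univ_add]; exact hn.bc_ne)) F.isZ.apply_apply
  have c0314 := S.comm 0 3 1 4 (by decide) (by decide) (by decide) (by decide)
  have c0413 := S.comm 0 4 1 3 (by decide) (by decide) (by decide) (by decide)
  have c0324 := S.comm 0 3 2 4 (by decide) (by decide) (by decide) (by decide)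
  have c0423 := S.comm 0 4 2 3 (by decide) (by decide) (by decide) (by decide)
  have m : ∀ {p q r : ℕ} {f : Fin p → ℂ} {g : Fin q → ℂ} {h : Fin r → ℂ},
      (∀ i j k, f i ≠ g j + h k) → ∀ x ∈ Finset.univ.val.map f, ∀ y ∈ Finset.univ.val.map g,
        ∀ z ∈ Finset.univ.val.map h, x ≠ y + z := by
    intro p q r f g h hne x hx y hy z hz
    obtain ⟨i, -, rfl⟩ := Multiset.mem_map.mp hx
    obtain ⟨j, -, rfl⟩ := Multiset.mem_map.mp hy
    obtain ⟨k, -, rfl⟩ := Multiset.mem_map.mp hz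
    exact hne i j k
  have n0314 := nodup_crossMap_add_add nα' nβ nγ nγ' (m hn.α'_ne)
    fun i hi j hj k hk => m (fun j i k => hn.β_ne i j k) j hj i hi k hk
  have n0413 := nodup_crossMap_add_add nα nβ' nγ' nγ (m hn.α_ne)
    fun i hi j hj k hk => m (fun j i k => hn.β'_ne i j k) j hj i hi k hk
  have n0324 := nodup_crossMap_add_add nα' nγ' nβ' nβ
    (fun i hi j hj k hk => add_comm k j ▸ m hn.α'_ne i hi k hk j hj)
    fun i hi j hj k hk => m (fun k i j => hn.γ'_ne i j k) j hj i hi k hk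
  have n0423 := nodup_crossMap_add_add nα nγ nβ nβ'
    (fun i hi j hj k hk => add_comm k j ▸ m hn.α_ne i hi k hk j hj)
    fun i hi j hj k hk => m (fun k i j => hn.γ_ne i j k) j hj i hi k hk
  have flip : ∀ s t : Multiset ℂ, Multiset.crossMap (fun j k => (j + k, k)) s t =
      Multiset.crossMap (fun j k => (j + k, j)) t s := fun s t => by
    rw [Multiset.crossMap_swap]
    simp only [add_comm]
  have d03 := F.spec0314.isDiagonal_left c0314 n0314
  have d14 := F.spec0314.isDiagonal_right c0314 n0314
  have d04 := F.spec0413.isDiagonal_left c0413 (by convert n0413 using 1; abel)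
  have d13 := F.spec0413.isDiagonal_right c0413 (by convert n0413 using 1; abel)
  have d24 := F.spec0324.isDiagonal_right c0324 (by
    convert n0324 using 1
    rw [flip]
    abel)
  have d23 := F.spec0423.isDiagonal_right c0423 (by
    convert n0423 using 1
    rw [flip]
    abel)
  simp only [tableF, List.mem_cons, Prod.mk.injEq, List.not_mem_nil, or_false] at h
  rcases h with ⟨rfl, rfl, rfl, rfl, -⟩ | ⟨rfl, rfl, rfl, rfl, -⟩ | ⟨rfl, rfl, rfl, rfl, -⟩ |
    ⟨rfl, rfl, rfl, rfl, -⟩ | ⟨rfl, rfl, rfl, rfl, -⟩ | ⟨rfl, rfl, rfl, rfl, -⟩ |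
    ⟨rfl, rfl, rfl, rfl, -⟩ | ⟨rfl, rfl, rfl, rfl, -⟩ | ⟨rfl, rfl, rfl, rfl, -⟩ |
    ⟨rfl, rfl, rfl, rfl, -⟩ | ⟨rfl, rfl, rfl, rfl, -⟩ | ⟨rfl, rfl, rfl, rfl, -⟩ |
    ⟨rfl, rfl, rfl, rfl, -⟩ | ⟨rfl, rfl, rfl, rfl, -⟩ | ⟨rfl, rfl, rfl, rfl, -⟩ <;>
  constructor <;> assumption

theorem mainTheorem5 {p q r : ℕ} (hp : 0 < p) (hq : 0 < q) (hr : 0 < r)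
    (α α' : Fin p → ℂ) (β β' : Fin q → ℂ) (γ γ' : Fin r → ℂ)
    (hnd : Nondegenerate α α' β β' γ γ') :
    Module.finrank ℂ (kzF hp hq α α' β β' γ γ').V = p * q + q * r + r * p ∧
    (∀ i j k l s, (i, j, k, l, s) ∈ tableF α α' β β' γ γ' →
      HasSimultaneousGenEigenvalues ((kzF hp hq α α' β β' γ γ').A i j)
        ((kzF hp hq α α' β β' γ γ').A k l) s) ∧
    (NoCoincidence α α' β β' γ γ' →
      ∀ i j k l s, (i, j, k, l, s) ∈ tableF α α' β β' γ γ' →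
        HasSimultaneousEigenvalues ((kzF hp hq α α' β β' γ γ').A i j)
          ((kzF hp hq α α' β β' γ γ').A k l) s) := by
  obtain ⟨F⟩ := KZSystem.nonempty_frame_kzF hp hq α α' β β' γ γ' hnd
  refine ⟨?_, fun i j k l s h => hasSimultaneousGenEigenvalues_tableF hp hq hr F h,
    fun hn i j k l s h => ?_⟩
  · simpa using F.finrank_eq
  · obtain ⟨h1, h2⟩ := isDiagonal_of_mem_tableF hp hq hr F hn h
    exact (hasSimultaneousGenEigenvalues_tableF hp hq hr F h).toEigenvalues h1 h2
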